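/- Let $n\ge 3$. Let $\mathbb R^{2,n+2}=\mathbb R^2\oplus\mathbb R^{n+2}$ with a bilinear form $h$ that is minus the standard inner product on $\mathbb R^2$ (basis $f_1,f_2$) and the standard inner product on $\mathbb R^{n+2}$ (basis $e_1,e_2,\varepsilon_1,\dots,\varepsilon_n$). Let $G=SO_o(2,n+2)$, let $P\subset G$ be the stabilizer of the totally isotropic plane $[f_1+e_1,f_2+e_2]$, let $G_0=GL^+(2,\mathbb R)\times SO(n)$ be its Levi subgroup, and let $\mathfrak g_-=\mathfrak g_{-2}\oplus\mathfrak g_{-1}$, where $\mathfrak g_{-1}=M_{n\times 2}(\mathbb R)$, $\mathfrak g_{-2}$ is the space of skew-symmetric $2\times2$ matrices, $[X_1,X_2]=X_2^TX_1-X_1^TX_2$ for $X_1,X_2\in\mathfrak g_{-1}$, and $(A,B)\in G_0$ acts by $X\mapsto BXA^{-1}$ and $Y\mapsto A^{-T}YA^{-1}$. **Lie contact structures.** A Lie contact structure of type $(G,P)$ on a $(2n+1)$-dimensional manifold $M^\sharp$ is a distribution $H$ of codimension one together with a principal $G_0$-bundle $p_0^\sharp:\mathcal G_0^\sharp\to M^\sharp$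 whose points over $x$ give, smoothly and $G_0$-equivariantly, isomorphisms $\phi=(\phi_{-2},\phi_{-1}):\mathfrak g_-\to T_xM^\sharp/H_x\oplus H_x$ of graded Lie algebras, the target carrying the Levi bracket. Then $\theta^\sharp_{-2}=\phi_{-2}^{-1}\circ Tp_0^\sharp$ (modulo $H$), and $\theta^\sharp_{-1}=\phi_{-1}^{-1}\circ Tp_0^\sharp$ is defined on $T^{-1}\mathcal G_0^\sharp=(Tp_0^\sharp)^{-1}(H)$. A vector field $\xi$ on $M^\sharp$ is an infinitesimal symmetry if it lifts to a $G_0$-invariant vector field $\xi_0$ on $\mathcal G^\sharp_0$ whose Lie derivatives of $\theta^\sharp_{-2}$ and $\theta^\sharp_{-1}$ vanish; it is transversal if $\xi(x)\notin H_x$ for all $x$. **PCS-structures.** A (positive definite) PCS-structure of Grassmannian type on a $2n$-dimensional manifold $M$ consists of oriented vector bundles $E,F$ of rank $2,n$, an isomorphism $E^*\otimes F\cong TM$, a positive trivialization of $\Lambda^2E\otimes\Lambda^nF$, and a line subbundle $\ell\subset\Lambda^2T^*M$ such that all non-zero elements of $\ell$ are non-degenerate, $\ell$ has near each point a closed nowhere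 vanishing section, $\ell\subset\Lambda^2E\otimes S^2F^*$, and the ray of bundle metrics on $F$ that $\ell$ determines is positive definite. Its $G_0$-structure is the bundle $\mathcal G_0$ of pairs of an oriented frame of $E$ and an oriented frame of $F$ that is orthonormal for a metric of the ray, with the induced frames $\mathfrak g_{-1}\cong T_xM$ and the resulting soldering form $\theta$. **PCS-quotients.** A PCS-quotient of a Lie contact structure by a transversal infinitesimal symmetry $\xi$ is a PCS-structure $(\mathcal G_0,M,p_0,\theta)$ with a morphism $q_0:\mathcal G_0^\sharp\to\mathcal G_0$ of principal $G_0$-bundles that is surjective with connected fibres, such that $\ker T_uq_0$ is spanned by $\xi_0(u)$ for each $u\in\mathcal G_0^\sharp$, and such that $q_0^*\theta=\theta^\sharp_{-1}$ on $T^{-1}\mathcal G_0^\sharp$. **Theorem.** The Stiefel manifold $V_2(\mathbb R^{n+2})$ of orthonormal 2-frames is identified with $G/P$, by letting $(v_1,v_2)$ correspond to the isotropic plane $[f_1+v_1,f_2+v_2]$; it carries the homogeneous Lie contact structure $\mathcal G_0^\sharp=G/P_+\to G/P$ of type $(G,P)$, where $P_+$ is the kernel of the projection $P\to G_0$, the frames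 being given by differentiating $g\exp(tZ)P$ for $Z\in\mathfrak g_-$. Let $K^\sharp=SO(2)\times SO(n+2)\subset G$, and let $\xi$ be the vector field on $V_2(\mathbb R^{n+2})$ generated by a non-zero element of the Lie algebra of the center $Z(K^\sharp)$. Then $\xi$ is a transversal infinitesimal symmetry of this structure. Moreover, on the Grassmannian $G_2^+(\mathbb R^{n+2})$ of oriented planes there is a PCS-structure $(\mathcal G_0,G_2^+(\mathbb R^{n+2}),p_0,\theta)$ of Grassmannian type which is homogeneous and invariant under $K=SO(n+2)$ (the canonical transitive action of $K$ on $G_2^+(\mathbb R^{n+2})$ lifts to an action on $\mathcal G_0$ by automorphisms of the $G_0$-structure), together with a PCS-quotient $q_0:\mathcal G_0^\sharp\to\mathcal G_0$ by $\xi$ that covers the map $q:V_2(\mathbb R^{n+2})\to G_2^+(\mathbb R^{n+2})$, $(v_1,v_2)\mapsto[v_1,v_2]^+$. The underlying Grassmannian structure is the standard one: $E$ is the tautological plane bundle, $F=E^\perp\subset\mathbb R^{n+2}$, the isomorphism $\mathrm{Hom}(E,F)\cong TG_2^+(\mathbb R^{n+2})$ sends $\varphi$ to the velocity at $t=0$ of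 the family of planes $\{v+t\varphi(v)\}$, and the orientations and the trivialization of $\Lambda^2E\otimes\Lambda^nF$ are those given by $E\oplus F=\mathbb R^{n+2}$. The conformally symplectic structure $\ell$ corresponds to the ray of bundle metrics on $F$ that contains the metric induced by the standard inner product of $\mathbb R^{n+2}$. -/

import Mathlib

open scoped ContDiff Matrix Topology

attribute [local instance] Matrix.normedAddCommGroup Matrix.normedSpace

noncomputable section

/-! ### Manifolds

A smooth manifold is represented as an embedded submanifold `S` of a finite-dimensional real vector
space (by Whitney's theorem this is no restriction).  Smooth maps on `S` are the maps that are
`ContDiffOn ℝ ∞` on `S`, and the differential at `x` of a smooth map `f` on `S` is the restriction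
of `fderivWithin ℝ f S x` to the tangent space at `x`, where it does not depend on choices. -/

/-- `S` is an embedded smooth `d`-dimensional submanifold: near each of its points it admits a smooth
local parametrization `σ` by an open subset of `ℝ^d` whose inverse is the restriction of a smooth
map `ψ`. -/
def IsSubmanifold {E : Type} [NormedAddCommGroup E] [NormedSpace ℝ E] (S : Set E) (d : ℕ) : Prop :=
  ∀ x ∈ S, ∃ (O : Set E) (W : Set (EuclideanSpace ℝ (Fin d)))
    (ψ : E → EuclideanSpace ℝ (Fin d)) (σ : EuclideanSpace ℝ (Fin d) → E),
    IsOpen O ∧ x ∈ O ∧ IsOpen W ∧ ContDiffOn ℝ ∞ ψ O ∧ ContDiffOn ℝ ∞ σ W ∧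
    Set.MapsTo ψ (S ∩ O) W ∧ Set.MapsTo σ W (S ∩ O) ∧
    (∀ y ∈ S ∩ O, σ (ψ y) = y) ∧ (∀ w ∈ W, ψ (σ w) = w)

/-- The tangent space of `S` at `x`, as a subspace of the ambient space. -/
def tangentSpaceAt {E : Type} [NormedAddCommGroup E] [NormedSpace ℝ E] (S : Set E) (x : E) :
    Submodule ℝ E :=
  Submodule.span ℝ (tangentConeAt ℝ S x)

/-- `ξ` is a smooth vector field on `S`. -/
structure IsVectorField {E : Type} [NormedAddCommGroup E] [NormedSpace ℝ E] (S : Set E)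
    (ξ : E → E) : Prop where
  smooth : ContDiffOn ℝ ∞ ξ S
  tangent : ∀ x ∈ S, ξ x ∈ tangentSpaceAt S x

/-! ### The group `G₀ = GL⁺(2, ℝ) × SO(n)` and the graded Lie algebra `𝔤₋ = 𝔤₋₂ ⊕ 𝔤₋₁`

`𝔤₋₁` is the space of real `n × 2` matrices and `𝔤₋₂` is the space of skew-symmetric `2 × 2`
matrices. -/

/-- The group `G₀ = GL⁺(2, ℝ) × SO(n)`, as a subset of the algebra of pairs of matrices. -/
def G0 (n : ℕ) : Set (Matrix (Fin 2) (Fin 2) ℝ × Matrix (Fin n) (Fin n) ℝ) :=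
  {a | 0 < a.1.det ∧ a.2 ∈ Matrix.specialOrthogonalGroup (Fin n) ℝ}

/-- `𝔤₋₂`: skew-symmetric `2 × 2` matrices. -/
def gTwo : Submodule ℝ (Matrix (Fin 2) (Fin 2) ℝ) where
  carrier := {Y | Yᵀ = -Y}
  add_mem' := by
    intro a b ha hb
    simp only [Set.mem_ofPred_eq] at ha hb ⊢
    rw [Matrix.transpose_add, ha, hb]; abel
  zero_mem' := by simp
  smul_mem' := by
    intro c a ha
    simp only [Set.mem_ofPred_eq] at ha ⊢
    rw [Matrix.transpose_smul, ha, smul_neg]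

/-- The adjoint action of `(A, B) ∈ G₀` on `𝔤₋₁`. -/
def adOne {n : ℕ} (a : Matrix (Fin 2) (Fin 2) ℝ × Matrix (Fin n) (Fin n) ℝ)
    (X : Matrix (Fin n) (Fin 2) ℝ) : Matrix (Fin n) (Fin 2) ℝ :=
  a.2 * X * a.1⁻¹

/-- The adjoint action of `(A, B) ∈ G₀` on `𝔤₋₂`. -/
def adTwo {n : ℕ} (a : Matrix (Fin 2) (Fin 2) ℝ × Matrix (Fin n) (Fin n) ℝ) (Y : gTwo) : gTwo :=
  ⟨(a.1⁻¹)ᵀ * (Y : Matrix (Fin 2) (Fin 2) ℝ) * a.1⁻¹, by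
    have h : (Y : Matrix (Fin 2) (Fin 2) ℝ)ᵀ = -(Y : Matrix (Fin 2) (Fin 2) ℝ) := Y.2
    change ((a.1⁻¹)ᵀ * (Y : Matrix (Fin 2) (Fin 2) ℝ) * a.1⁻¹)ᵀ = -_
    rw [Matrix.transpose_mul, Matrix.transpose_mul, h, Matrix.transpose_transpose]
    simp [Matrix.mul_assoc]⟩

/-- The Lie bracket `𝔤₋₁ × 𝔤₋₁ → 𝔤₋₂`. -/
def bracketOne {n : ℕ} (X₁ X₂ : Matrix (Fin n) (Fin 2) ℝ) : gTwo :=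
  ⟨X₂ᵀ * X₁ - X₁ᵀ * X₂, by
    change (X₂ᵀ * X₁ - X₁ᵀ * X₂)ᵀ = -_
    rw [Matrix.transpose_sub, Matrix.transpose_mul, Matrix.transpose_mul,
      Matrix.transpose_transpose, Matrix.transpose_transpose, neg_sub]⟩

/-! ### Principal `G₀`-bundles, `G₀`-structures and Lie contact structures -/

/-- The data of a principal `G₀`-bundle: total space, projection and right action. -/
structure G0BundleData (n : ℕ) (V U : Type) where
  total : Set U
  proj : U → V
  act : U → Matrix (Fin 2) (Fin 2) ℝ × Matrix (Fin n) (Fin n) ℝ → U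

/-- The data `D` form a smooth principal `G₀`-bundle over `M`. -/
structure G0BundleData.IsPrincipal {n : ℕ} {V U : Type}
    [NormedAddCommGroup V] [NormedSpace ℝ V] [NormedAddCommGroup U] [NormedSpace ℝ U]
    (D : G0BundleData n V U) (M : Set V) : Prop where
  submanifold : ∃ d : ℕ, IsSubmanifold D.total d
  proj_smooth : ContDiffOn ℝ ∞ D.proj D.total
  proj_mem : ∀ u ∈ D.total, D.proj u ∈ M
  act_smooth : ContDiffOn ℝ ∞
    (fun z : U × (Matrix (Fin 2) (Fin 2) ℝ × Matrix (Fin n) (Fin n) ℝ) => D.act z.1 z.2)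
    (D.total ×ˢ G0 n)
  act_mem : ∀ u ∈ D.total, ∀ a ∈ G0 n, D.act u a ∈ D.total
  act_one : ∀ u ∈ D.total, D.act u 1 = u
  act_mul : ∀ u ∈ D.total, ∀ a ∈ G0 n, ∀ b ∈ G0 n, D.act u (a * b) = D.act (D.act u a) b
  proj_act : ∀ u ∈ D.total, ∀ a ∈ G0 n, D.proj (D.act u a) = D.proj u
  free : ∀ u ∈ D.total, ∀ a ∈ G0 n, D.act u a = u → a = 1
  /-- local triviality: a local section `s`, for which `u = s (proj u) · τ u` with `τ` smooth -/
  locally_trivial : ∀ x ∈ M, ∃ (O : Set V) (s : V → U)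
    (τ : U → Matrix (Fin 2) (Fin 2) ℝ × Matrix (Fin n) (Fin n) ℝ),
    IsOpen O ∧ x ∈ O ∧ ContDiffOn ℝ ∞ s (M ∩ O) ∧ ContDiffOn ℝ ∞ τ (D.total ∩ D.proj ⁻¹' O) ∧
    (∀ y ∈ M ∩ O, s y ∈ D.total ∧ D.proj (s y) = y) ∧
    (∀ u ∈ D.total ∩ D.proj ⁻¹' O, τ u ∈ G0 n ∧ D.act (s (D.proj u)) (τ u) = u)

/-- The data of a `G₀`-structure: a principal `G₀`-bundle each of whose points `u` determines a
frame `𝔤₋₁ → T_{p(u)} M`. -/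
structure G0StructureData (n : ℕ) (V U : Type) [NormedAddCommGroup V] [NormedSpace ℝ V]
    extends G0BundleData n V U where
  frame : U → (Matrix (Fin n) (Fin 2) ℝ →ₗ[ℝ] V)

/-- `P` is a `G₀`-structure on `M`. -/
structure G0StructureData.IsG0Structure {n : ℕ} {V U : Type}
    [NormedAddCommGroup V] [NormedSpace ℝ V] [NormedAddCommGroup U] [NormedSpace ℝ U]
    (P : G0StructureData n V U) (M : Set V) : Prop where
  principal : P.toG0BundleData.IsPrincipal M
  frame_smooth : ∀ X, ContDiffOn ℝ ∞ (fun u => P.frame u X) P.total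
  frame_injective : ∀ u ∈ P.total, Function.Injective (P.frame u)
  frame_range : ∀ u ∈ P.total, LinearMap.range (P.frame u) = tangentSpaceAt M (P.proj u)
  frame_act : ∀ u ∈ P.total, ∀ a ∈ G0 n, ∀ X, P.frame (P.act u a) X = P.frame u (adOne a X)

/-- The soldering form `θ_u(w) = φ_u⁻¹ (T p · w) ∈ 𝔤₋₁`, for `w ∈ T_u 𝒢₀`, where `φ_u` is the frame
given by `u`. -/
def G0StructureData.theta {n : ℕ} {V U : Type}
    [NormedAddCommGroup V] [NormedSpace ℝ V] [NormedAddCommGroup U] [NormedSpace ℝ U]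
    (P : G0StructureData n V U) (u w : U) : Matrix (Fin n) (Fin 2) ℝ :=
  Function.invFun (P.frame u) (fderivWithin ℝ P.proj P.total u w)

/-- The data of a Lie contact structure: a distribution `H` and a principal `G₀`-bundle each of whose
points `u` determines `φ₋₁ : 𝔤₋₁ → H` and `φ₋₂ : 𝔤₋₂ → TM/H`.  The map `φ₋₂` is given by
`frameTwo`, whose values have to be read modulo `H`. -/
structure LieContactData (n : ℕ) (V U : Type) [NormedAddCommGroup V] [NormedSpace ℝ V]
    extends G0BundleData n V U where
  H : V → Submodule ℝ V
  frameOne : U → (Matrix (Fin n) (Fin 2) ℝ →ₗ[ℝ] V)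
  frameTwo : U → (gTwo →ₗ[ℝ] V)

/-- `φ₋₂ : 𝔤₋₂ → TM/H`. -/
def LieContactData.phiTwo {n : ℕ} {V U : Type} [NormedAddCommGroup V] [NormedSpace ℝ V]
    (L : LieContactData n V U) (u : U) : gTwo →ₗ[ℝ] (V ⧸ L.H (L.proj u)) :=
  (L.H (L.proj u)).mkQ ∘ₗ L.frameTwo u

/-- `L` is a Lie contact structure of type `(G, P)` on the `(2n+1)`-dimensional manifold `M`: a
principal `G₀`-bundle of isomorphisms `φ = (φ₋₂, φ₋₁)` of graded Lie algebras from `𝔤₋` to the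
associated graded `TM/H ⊕ H` with the Levi bracket, equivariant for `G₀ → Aut_gr(𝔤₋)`. -/
structure LieContactData.IsLieContact {n : ℕ} {V U : Type}
    [NormedAddCommGroup V] [NormedSpace ℝ V] [NormedAddCommGroup U] [NormedSpace ℝ U]
    (L : LieContactData n V U) (M : Set V) : Prop where
  submanifold : IsSubmanifold M (2 * n + 1)
  principal : L.toG0BundleData.IsPrincipal M
  H_le : ∀ x ∈ M, L.H x ≤ tangentSpaceAt M x
  frameOne_smooth : ∀ X, ContDiffOn ℝ ∞ (fun u => L.frameOne u X) L.total
  frameOne_injective : ∀ u ∈ L.total, Function.Injective (L.frameOne u)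
  frameOne_range : ∀ u ∈ L.total, LinearMap.range (L.frameOne u) = L.H (L.proj u)
  frameOne_act : ∀ u ∈ L.total, ∀ a ∈ G0 n, ∀ X,
    L.frameOne (L.act u a) X = L.frameOne u (adOne a X)
  frameTwo_smooth : ∀ Y, ContDiffOn ℝ ∞ (fun u => L.frameTwo u Y) L.total
  phiTwo_injective : ∀ u ∈ L.total, Function.Injective (L.phiTwo u)
  phiTwo_range : ∀ u ∈ L.total, LinearMap.range (L.phiTwo u) =
    (tangentSpaceAt M (L.proj u)).map (L.H (L.proj u)).mkQ
  frameTwo_act : ∀ u ∈ L.total, ∀ a ∈ G0 n, ∀ Y,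
    L.frameTwo (L.act u a) Y - L.frameTwo u (adTwo a Y) ∈ L.H (L.proj u)
  /-- compatibility with the Levi bracket `(ξ, η) ↦ [ξ, η] mod H` of sections of `H` -/
  levi : ∀ ξ η : V → V, IsVectorField M ξ → IsVectorField M η →
    (∀ x ∈ M, ξ x ∈ L.H x) → (∀ x ∈ M, η x ∈ L.H x) →
    ∀ u ∈ L.total, ∀ X₁ X₂, L.frameOne u X₁ = ξ (L.proj u) → L.frameOne u X₂ = η (L.proj u) →
      L.phiTwo u (bracketOne X₁ X₂) =
        (L.H (L.proj u)).mkQ (VectorField.lieBracketWithin ℝ ξ η M (L.proj u))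

/-- The tautological partial form `θ₋₁`, defined on vectors `w ∈ T⁻¹𝒢₀ = (T p)⁻¹(H)`. -/
def LieContactData.thetaOne {n : ℕ} {V U : Type}
    [NormedAddCommGroup V] [NormedSpace ℝ V] [NormedAddCommGroup U] [NormedSpace ℝ U]
    (L : LieContactData n V U) (u w : U) : Matrix (Fin n) (Fin 2) ℝ :=
  Function.invFun (L.frameOne u) (fderivWithin ℝ L.proj L.total u w)

/-- The tautological form `θ₋₂`. -/
def LieContactData.thetaTwo {n : ℕ} {V U : Type}
    [NormedAddCommGroup V] [NormedSpace ℝ V] [NormedAddCommGroup U] [NormedSpace ℝ U]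
    (L : LieContactData n V U) (u w : U) : gTwo :=
  Function.invFun (L.phiTwo u) ((L.H (L.proj u)).mkQ (fderivWithin ℝ L.proj L.total u w))

/-- `ξ₀` is a lift of the vector field `ξ` on `M` to a `G₀`-invariant vector field on the total space
with `ℒ_{ξ₀} θ₋₂ = 0` and `ℒ_{ξ₀} θ₋₁ = 0`, the latter as partially defined forms. -/
structure LieContactData.IsLift {n : ℕ} {V U : Type}
    [NormedAddCommGroup V] [NormedSpace ℝ V] [NormedAddCommGroup U] [NormedSpace ℝ U]
    (L : LieContactData n V U) (ξ : V → V) (ξ₀ : U → U) : Prop where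
  vectorField : IsVectorField L.total ξ₀
  related : ∀ u ∈ L.total, fderivWithin ℝ L.proj L.total u (ξ₀ u) = ξ (L.proj u)
  invariant : ∀ u ∈ L.total, ∀ a ∈ G0 n,
    fderivWithin ℝ (fun v => L.act v a) L.total u (ξ₀ u) = ξ₀ (L.act u a)
  lie_thetaTwo : ∀ η : U → U, IsVectorField L.total η → ∀ u ∈ L.total,
    fderivWithin ℝ (fun v => L.thetaTwo v (η v)) L.total u (ξ₀ u) =
      L.thetaTwo u (VectorField.lieBracketWithin ℝ ξ₀ η L.total u)
  lie_thetaOne : ∀ η : U → U, IsVectorField L.total η →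
    (∀ u ∈ L.total, fderivWithin ℝ L.proj L.total u (η u) ∈ L.H (L.proj u)) → ∀ u ∈ L.total,
    fderivWithin ℝ L.proj L.total u (VectorField.lieBracketWithin ℝ ξ₀ η L.total u)
      ∈ L.H (L.proj u) ∧
    fderivWithin ℝ (fun v => L.thetaOne v (η v)) L.total u (ξ₀ u) =
      L.thetaOne u (VectorField.lieBracketWithin ℝ ξ₀ η L.total u)

/-- `ξ` is a transversal infinitesimal symmetry of the Lie contact structure `L` on `M`. -/
structure LieContactData.IsTransversalSymmetry {n : ℕ} {V U : Type}
    [NormedAddCommGroup V] [NormedSpace ℝ V] [NormedAddCommGroup U] [NormedSpace ℝ U]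
    (L : LieContactData n V U) (M : Set V) (ξ : V → V) : Prop where
  vectorField : IsVectorField M ξ
  symmetry : ∃ ξ₀ : U → U, L.IsLift ξ ξ₀
  transversal : ∀ x ∈ M, ξ x ∉ L.H x

/-! ### PCS-structures of Grassmannian type -/

/-- The data of a PACS-structure of Grassmannian type on `M`: auxiliary bundles `E` and `F` (families
of subspaces), an identification `E* ⊗ F = Hom(E, F) ≅ TM`, orientations of `E` and `F`, a
trivialization of `Λ²E ⊗ ΛⁿF`, and a line `ℓ ⊆ Λ²T*M`. -/
structure PACSData (n : ℕ) {V : Type} [NormedAddCommGroup V] [NormedSpace ℝ V] (M : Set V)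
    (WE WF : Type) [NormedAddCommGroup WE] [NormedSpace ℝ WE]
    [NormedAddCommGroup WF] [NormedSpace ℝ WF] where
  E : M → Submodule ℝ WE
  F : M → Submodule ℝ WF
  iso : ∀ x : M, (E x →ₗ[ℝ] F x) ≃ₗ[ℝ] tangentSpaceAt M (x : V)
  orE : ∀ x : M, Orientation ℝ (E x) (Fin 2)
  orF : ∀ x : M, Orientation ℝ (F x) (Fin n)
  vol : ∀ x : M, (E x) [⋀^Fin 2]→ₗ[ℝ] ((F x) [⋀^Fin n]→ₗ[ℝ] ℝ)
  ell : ∀ x : M, Submodule ℝ ((tangentSpaceAt M (x : V)) [⋀^Fin 2]→ₗ[ℝ] ℝ)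

/-- `E` and `F` are smooth oriented vector bundles of rank `2` and `n`, the identification
`E* ⊗ F ≅ TM` and the trivialization of `Λ²E ⊗ ΛⁿF` are smooth, and the trivialization is positive
for the orientations.  All this is expressed in smooth local oriented frames `e` of `E` and `f` of
`F`. -/
def PACSData.IsGrassmannian {n : ℕ} {V : Type} [NormedAddCommGroup V] [NormedSpace ℝ V] {M : Set V}
    {WE WF : Type} [NormedAddCommGroup WE] [NormedSpace ℝ WE]
    [NormedAddCommGroup WF] [NormedSpace ℝ WF] (S : PACSData n M WE WF) : Prop :=
  ∀ x₀ ∈ M, ∃ (O : Set V) (e : V → Fin 2 → WE) (f : V → Fin n → WF)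
    (Φ : V → Matrix (Fin n) (Fin 2) ℝ → V) (v : V → ℝ),
    IsOpen O ∧ x₀ ∈ O ∧ ContDiffOn ℝ ∞ e (M ∩ O) ∧ ContDiffOn ℝ ∞ f (M ∩ O) ∧
    (∀ X, ContDiffOn ℝ ∞ (fun x => Φ x X) (M ∩ O)) ∧ ContDiffOn ℝ ∞ v (M ∩ O) ∧
    ∀ x : M, (x : V) ∈ O →
      ∃ (bE : Module.Basis (Fin 2) ℝ (S.E x)) (bF : Module.Basis (Fin n) ℝ (S.F x)),
        (∀ i, (bE i : WE) = e x i) ∧ (∀ j, (bF j : WF) = f x j) ∧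
        bE.orientation = S.orE x ∧ bF.orientation = S.orF x ∧
        (∀ X, (S.iso x (Matrix.toLin bE bF X) : V) = Φ x X) ∧
        S.vol x bE bF = v x ∧ 0 < v x

/-- The restriction to `T_x M` of an alternating form on the ambient space. -/
def restrictForm {V : Type} [NormedAddCommGroup V] [NormedSpace ℝ V] (M : Set V) (x : V)
    (β : V [⋀^Fin 2]→L[ℝ] ℝ) : (tangentSpaceAt M x) [⋀^Fin 2]→ₗ[ℝ] ℝ :=
  β.toAlternatingMap.compLinearMap (tangentSpaceAt M x).subtype

/-- `β` is, on `M ∩ O`, a smooth nowhere vanishing section of `ℓ` that spans `ℓ`. -/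
def PACSData.IsLocalGenerator {n : ℕ} {V : Type} [NormedAddCommGroup V] [NormedSpace ℝ V] {M : Set V}
    {WE WF : Type} [NormedAddCommGroup WE] [NormedSpace ℝ WE]
    [NormedAddCommGroup WF] [NormedSpace ℝ WF] (S : PACSData n M WE WF)
    (O : Set V) (β : V → V [⋀^Fin 2]→L[ℝ] ℝ) : Prop :=
  ContDiffOn ℝ ∞ β (M ∩ O) ∧ ∀ x : M, (x : V) ∈ O →
    restrictForm M x (β x) ≠ 0 ∧ S.ell x = Submodule.span ℝ {restrictForm M x (β x)}

/-- `ℓ` is an almost conformally symplectic structure. -/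
structure PACSData.IsACS {n : ℕ} {V : Type} [NormedAddCommGroup V] [NormedSpace ℝ V] {M : Set V}
    {WE WF : Type} [NormedAddCommGroup WE] [NormedSpace ℝ WE]
    [NormedAddCommGroup WF] [NormedSpace ℝ WF] (S : PACSData n M WE WF) : Prop where
  line : ∀ x ∈ M, ∃ (O : Set V) (β : V → V [⋀^Fin 2]→L[ℝ] ℝ),
    IsOpen O ∧ x ∈ O ∧ S.IsLocalGenerator O β
  nondegenerate : ∀ x : M, ∀ β ∈ S.ell x, β ≠ 0 → ∀ v, (∀ w, β ![v, w] = 0) → v = 0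

/-- `ℓ` is a conformally symplectic structure: it has locally a closed nowhere vanishing section. -/
structure PACSData.IsCS {n : ℕ} {V : Type} [NormedAddCommGroup V] [NormedSpace ℝ V] {M : Set V}
    {WE WF : Type} [NormedAddCommGroup WE] [NormedSpace ℝ WE]
    [NormedAddCommGroup WF] [NormedSpace ℝ WF] (S : PACSData n M WE WF) : Prop where
  acs : S.IsACS
  closed : ∀ x ∈ M, ∃ (O : Set V) (β : V → V [⋀^Fin 2]→L[ℝ] ℝ),
    IsOpen O ∧ x ∈ O ∧ S.IsLocalGenerator O β ∧
    ∀ y ∈ M ∩ O, ∀ v : Fin 3 → V, (∀ i, v i ∈ tangentSpaceAt M y) → extDerivWithin β M y v = 0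

/-- The tangent vector `a ⊗ f`, for `a ∈ E*` and `f ∈ F`. -/
def PACSData.tensor {n : ℕ} {V : Type} [NormedAddCommGroup V] [NormedSpace ℝ V] {M : Set V}
    {WE WF : Type} [NormedAddCommGroup WE] [NormedSpace ℝ WE]
    [NormedAddCommGroup WF] [NormedSpace ℝ WF] (S : PACSData n M WE WF) (x : M)
    (a : Module.Dual ℝ (S.E x)) (f : S.F x) : tangentSpaceAt M (x : V) :=
  S.iso x (LinearMap.smulRight a f)

/-- `ℓ ⊆ Λ²E ⊗ S²F*`: as a form on `E* ⊗ F`, each `β ∈ ℓ` is skew in `E*` and symmetric in `F`. -/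
def PACSData.IsHermitian {n : ℕ} {V : Type} [NormedAddCommGroup V] [NormedSpace ℝ V] {M : Set V}
    {WE WF : Type} [NormedAddCommGroup WE] [NormedSpace ℝ WE]
    [NormedAddCommGroup WF] [NormedSpace ℝ WF] (S : PACSData n M WE WF) : Prop :=
  ∀ x : M, ∀ β ∈ S.ell x, ∀ (a b : Module.Dual ℝ (S.E x)) (f g : S.F x),
    β ![S.tensor x a f, S.tensor x b g] = - β ![S.tensor x b f, S.tensor x a g] ∧
    β ![S.tensor x a f, S.tensor x b g] = β ![S.tensor x a g, S.tensor x b f]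

/-- The positive definite inner product `g` on `F_x` belongs to the ray determined by `ℓ_x`: the
elements of `ℓ_x` are of the form `ν ⊗ g` with `ν ∈ Λ²E_x`. -/
structure PACSData.InRay {n : ℕ} {V : Type} [NormedAddCommGroup V] [NormedSpace ℝ V] {M : Set V}
    {WE WF : Type} [NormedAddCommGroup WE] [NormedSpace ℝ WE]
    [NormedAddCommGroup WF] [NormedSpace ℝ WF] (S : PACSData n M WE WF) (x : M)
    (g : LinearMap.BilinForm ℝ (S.F x)) : Prop where
  symm : ∀ f f', g f f' = g f' f
  pos : ∀ f, f ≠ 0 → 0 < g f f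
  decomposes : ∀ β ∈ S.ell x, ∃ ν : (Module.Dual ℝ (S.E x)) [⋀^Fin 2]→ₗ[ℝ] ℝ,
    ∀ (a b : Module.Dual ℝ (S.E x)) (f f' : S.F x),
      β ![S.tensor x a f, S.tensor x b f'] = ν ![a, b] * g f f'

/-- `S` is a (positive definite) PCS-structure of Grassmannian type on the `2n`-dimensional
manifold `M`. -/
structure PACSData.IsPCS {n : ℕ} {V : Type} [NormedAddCommGroup V] [NormedSpace ℝ V] {M : Set V}
    {WE WF : Type} [NormedAddCommGroup WE] [NormedSpace ℝ WE]
    [NormedAddCommGroup WF] [NormedSpace ℝ WF] (S : PACSData n M WE WF) : Prop where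
  submanifold : IsSubmanifold M (2 * n)
  grassmannian : S.IsGrassmannian
  cs : S.IsCS
  hermitian : S.IsHermitian
  positive : ∀ x : M, ∃ g, S.InRay x g

/-- `P` is the `G₀`-structure of `S`: for some bundle metric `g` on `F` in the ray of `ℓ`, the bundle
`P` is identified with the bundle of pairs of an oriented frame `eFr u` of `E` and an oriented
`g`-orthonormal frame `fFr u` of `F`, and the frame of `TM` determined by `u ∈ P` is the one
induced by these through `E* ⊗ F ≅ TM`. -/
def PACSData.HasG0Structure {n : ℕ} {V : Type} [NormedAddCommGroup V] [NormedSpace ℝ V] {M : Set V}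
    {WE WF : Type} [NormedAddCommGroup WE] [NormedSpace ℝ WE]
    [NormedAddCommGroup WF] [NormedSpace ℝ WF] {U : Type} [NormedAddCommGroup U] [NormedSpace ℝ U]
    (S : PACSData n M WE WF) (P : G0StructureData n V U) : Prop :=
  P.IsG0Structure M ∧
  ∃ (g : ∀ x : M, LinearMap.BilinForm ℝ (S.F x)) (eFr : U → Fin 2 → WE) (fFr : U → Fin n → WF),
    (∀ x : M, S.InRay x (g x)) ∧
    ContDiffOn ℝ ∞ eFr P.total ∧ ContDiffOn ℝ ∞ fFr P.total ∧
    (∀ u ∈ P.total, ∀ a ∈ G0 n,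
      (∀ i, eFr (P.act u a) i = ∑ k, a.1 k i • eFr u k) ∧
      (∀ j, fFr (P.act u a) j = ∑ k, a.2 k j • fFr u k)) ∧
    ∀ u ∈ P.total, ∀ x : M, (x : V) = P.proj u →
      ∃ (bE : Module.Basis (Fin 2) ℝ (S.E x)) (bF : Module.Basis (Fin n) ℝ (S.F x)),
        (∀ i, (bE i : WE) = eFr u i) ∧ (∀ j, (bF j : WF) = fFr u j) ∧
        bE.orientation = S.orE x ∧ bF.orientation = S.orF x ∧
        (∀ i j, g x (bF i) (bF j) = if i = j then 1 else 0) ∧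
        (∀ X, (S.iso x (Matrix.toLin bE bF X) : V) = P.frame u X)

/-- `q₀ : 𝒢₀♯ → 𝒢₀` is a PCS-quotient of the Lie contact structure `L` by `ξ`, onto the PCS-structure
with `G₀`-structure `P`, covering the map `q` of the base manifolds. -/
structure IsPCSQuotient {n : ℕ} {V₁ U₁ V₂ U₂ : Type}
    [NormedAddCommGroup V₁] [NormedSpace ℝ V₁] [NormedAddCommGroup U₁] [NormedSpace ℝ U₁]
    [NormedAddCommGroup V₂] [NormedSpace ℝ V₂] [NormedAddCommGroup U₂] [NormedSpace ℝ U₂]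
    (L : LieContactData n V₁ U₁) (P : G0StructureData n V₂ U₂) (ξ : V₁ → V₁) (q : V₁ → V₂)
    (q₀ : U₁ → U₂) : Prop where
  smooth : ContDiffOn ℝ ∞ q₀ L.total
  mapsTo : Set.MapsTo q₀ L.total P.total
  equivariant : ∀ u ∈ L.total, ∀ a ∈ G0 n, q₀ (L.act u a) = P.act (q₀ u) a
  covers : ∀ u ∈ L.total, P.proj (q₀ u) = q (L.proj u)
  surjective : Set.SurjOn q₀ L.total P.total
  connected_fibers : ∀ v ∈ P.total, IsConnected {u | u ∈ L.total ∧ q₀ u = v}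
  kernel : ∃ ξ₀ : U₁ → U₁, L.IsLift ξ ξ₀ ∧ ∀ u ∈ L.total, ∀ w ∈ tangentSpaceAt L.total u,
    fderivWithin ℝ q₀ L.total u w = 0 ↔ w ∈ Submodule.span ℝ {ξ₀ u}
  pullback_theta : ∀ u ∈ L.total, ∀ w ∈ tangentSpaceAt L.total u,
    fderivWithin ℝ L.proj L.total u w ∈ L.H (L.proj u) →
    P.theta (q₀ u) (fderivWithin ℝ q₀ L.total u w) = L.thetaOne u w

/-! ### The homogeneous Lie contact structure on `V₂(ℝ^{n+2})`

`ℝ^{n+2}` has the orthonormal basis `e₁, e₂, ε₁, …, ε_n` indexed by `Fin 2 ⊕ Fin n`, and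
`ℝ^{2,n+2} = ℝ² ⊕ ℝ^{n+2}` has the basis that consists of `f₁, f₂` followed by this one. -/

/-- Indices of the standard basis of `ℝ^{n+2}`. -/
abbrev Idx (n : ℕ) : Type := Fin 2 ⊕ Fin n

/-- Indices of the basis `f₁, f₂, e₁, e₂, ε₁, …, ε_n` of `ℝ^{2,n+2}`. -/
abbrev Big (n : ℕ) : Type := Fin 2 ⊕ Idx n

/-- The bilinear form `h` of signature `(2, n+2)`. -/
def formH (n : ℕ) : Matrix (Big n) (Big n) ℝ := Matrix.fromBlocks (-1) 0 0 1

/-- The group `G = SO_o(2, n+2)`, the identity component of `O(h)`. -/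
def groupG (n : ℕ) : Set (Matrix (Big n) (Big n) ℝ) :=
  connectedComponentIn {g | gᵀ * formH n * g = formH n} 1

/-- The isotropic basis `τ_i = f_i + e_i`, `τ^i = (e_i - f_i) / 2`, `ε_α` of `ℝ^{2,n+2}`, in this
order, as the columns of a matrix. -/
def tauBasis (n : ℕ) : Matrix (Big n) (Big n) ℝ :=
  Matrix.fromBlocks 1 (Matrix.fromCols (-(1 / 2 : ℝ) • (1 : Matrix (Fin 2) (Fin 2) ℝ)) 0)
    (Matrix.fromRows 1 0) (Matrix.fromBlocks ((1 / 2 : ℝ) • (1 : Matrix (Fin 2) (Fin 2) ℝ)) 0 0 1)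

/-- The element of `𝔤₋ = 𝔤₋₂ ⊕ 𝔤₋₁ ⊆ 𝔰𝔬(2, n+2)` with `τ_i ↦ ∑ Y_{ji} τ^j + ∑ X_{αi} ε_α`,
`ε_α ↦ -∑ X_{αi} τ^i`, `τ^i ↦ 0`. -/
def lieNeg {n : ℕ} (Y : Matrix (Fin 2) (Fin 2) ℝ) (X : Matrix (Fin n) (Fin 2) ℝ) :
    Matrix (Big n) (Big n) ℝ :=
  tauBasis n *
    Matrix.fromBlocks 0 0 (Matrix.fromRows Y X) (Matrix.fromBlocks 0 (-Xᵀ) 0 0) * (tauBasis n)⁻¹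

/-- The element of the Levi subgroup `G₀ ⊆ G` given by `(A, B) ∈ GL⁺(2, ℝ) × SO(n)`, which acts as `A`
on `[τ₁, τ₂]`, as `B` on `[ε₁, …, ε_n]` and as the inverse transpose of `A` on `[τ¹, τ²]`. -/
def leviElement {n : ℕ} (a : Matrix (Fin 2) (Fin 2) ℝ × Matrix (Fin n) (Fin n) ℝ) :
    Matrix (Big n) (Big n) ℝ :=
  tauBasis n * Matrix.fromBlocks a.1 0 0 (Matrix.fromBlocks ((a.1⁻¹)ᵀ) 0 0 a.2) * (tauBasis n)⁻¹

/-- The Stiefel manifold `V₂(ℝ^{n+2})` of orthonormal `2`-frames `(v₁ | v₂)`. -/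
def stiefel (n : ℕ) : Set (Matrix (Idx n) (Fin 2) ℝ) := {x | xᵀ * x = 1}

/-- The origin `(e₁, e₂)` of `V₂(ℝ^{n+2})`. -/
def stiefelOrigin (n : ℕ) : Matrix (Idx n) (Fin 2) ℝ := Matrix.fromRows 1 0

/-- The denominator of the action of `G` on `V₂(ℝ^{n+2})`: the component in `[f₁, f₂]` of the vectors
`g (f_i + v_i)`. -/
def actDenom {n : ℕ} (g : Matrix (Big n) (Big n) ℝ) (x : Matrix (Idx n) (Fin 2) ℝ) :
    Matrix (Fin 2) (Fin 2) ℝ :=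
  g.toBlocks₁₁ + g.toBlocks₁₂ * x

/-- The action of `G` on `V₂(ℝ^{n+2})`, where `(v₁, v₂)` is identified with the totally isotropic plane
`[f₁ + v₁, f₂ + v₂]`. -/
def gAct {n : ℕ} (g : Matrix (Big n) (Big n) ℝ) (x : Matrix (Idx n) (Fin 2) ℝ) :
    Matrix (Idx n) (Fin 2) ℝ :=
  (g.toBlocks₂₁ + g.toBlocks₂₂ * x) * (actDenom g x)⁻¹

/-- The map `G → G / P₊` that is used to realize the total space `𝒢₀♯ = G / P₊ → G / P = V₂(ℝ^{n+2})`.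
The class of `g` is given by `x = g · x₀ = (v₁ | v₂)` in `V₂(ℝ^{n+2})`, by the coordinates of the basis
`g τ₁, g τ₂` of the isotropic plane `[f₁ + v₁, f₂ + v₂]` with respect to `f₁ + v₁, f₂ + v₂`, and by the
vectors of `ℝ^{n+2}` that represent the classes of `g ε₁, …, g ε_n` modulo that plane. -/
def frameMap {n : ℕ} (g : Matrix (Big n) (Big n) ℝ) :
    Matrix (Idx n) (Fin 2) ℝ × Matrix (Fin 2) (Fin 2) ℝ × Matrix (Idx n) (Fin n) ℝ :=
  (gAct g (stiefelOrigin n), actDenom g (stiefelOrigin n),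
    (g.toBlocks₂₂ - gAct g (stiefelOrigin n) * g.toBlocks₁₂) *
      (Matrix.fromRows 0 1 : Matrix (Idx n) (Fin n) ℝ))

/-- The homogeneous Lie contact structure on `V₂(ℝ^{n+2})`: the contact distribution consists of the
infinitesimal displacements `w` of `(v₁ | v₂)` with `w₁, w₂` orthogonal to `[v₁, v₂]`. -/
def homogeneousLieContact (n : ℕ) : LieContactData n (Matrix (Idx n) (Fin 2) ℝ)
    (Matrix (Idx n) (Fin 2) ℝ × Matrix (Fin 2) (Fin 2) ℝ × Matrix (Idx n) (Fin n) ℝ) where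
  total := frameMap '' groupG n
  proj u := u.1
  act u a := (u.1, u.2.1 * a.1, u.2.2 * a.2)
  H x :=
    { carrier := {w | xᵀ * w = 0}
      add_mem' := by
        intro a b ha hb
        simp only [Set.mem_ofPred_eq] at ha hb ⊢
        rw [Matrix.mul_add, ha, hb, add_zero]
      zero_mem' := by simp
      smul_mem' := by
        intro c a ha
        simp only [Set.mem_ofPred_eq] at ha ⊢
        rw [Matrix.mul_smul, ha, smul_zero] }
  frameOne u :=
    { toFun := fun X => u.2.2 * X * u.2.1⁻¹
      map_add' := by intro X Y; rw [Matrix.mul_add, Matrix.add_mul]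
      map_smul' := by intro c X; rw [Matrix.mul_smul, Matrix.smul_mul]; rfl }
  frameTwo u :=
    { toFun := fun Y => u.1 * ((u.2.1⁻¹)ᵀ * (Y : Matrix (Fin 2) (Fin 2) ℝ) * u.2.1⁻¹)
      map_add' := by
        intro X Y
        rw [Submodule.coe_add, Matrix.mul_add, Matrix.add_mul, Matrix.mul_add]
      map_smul' := by
        intro c X
        rw [Submodule.coe_smul, Matrix.mul_smul, Matrix.smul_mul, Matrix.mul_smul]; rfl }

/-- The structure `homogeneousLieContact n` on `V₂(ℝ^{n+2}) = G / P` is the homogeneous one: `G` acts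
transitively on `V₂(ℝ^{n+2})`, the principal action is the right multiplication by `G₀`, and the frames
at the class of `g ∈ G` are obtained by differentiating `g exp(t Z) P` for `Z ∈ 𝔤₋`. -/
structure IsHomogeneousModel (n : ℕ) : Prop where
  transitive : ∀ x, x ∈ stiefel n ↔ ∃ g ∈ groupG n, gAct g (stiefelOrigin n) = x
  levi_mem : ∀ a ∈ G0 n, leviElement a ∈ groupG n
  act_eq : ∀ g ∈ groupG n, ∀ a ∈ G0 n,
    frameMap (g * leviElement a) = (homogeneousLieContact n).act (frameMap g) a
  frameOne_eq : ∀ g ∈ groupG n, ∀ X : Matrix (Fin n) (Fin 2) ℝ,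
    HasDerivAt (fun t : ℝ => gAct (g * NormedSpace.exp (t • lieNeg 0 X)) (stiefelOrigin n))
      ((homogeneousLieContact n).frameOne (frameMap g) X) 0
  frameTwo_eq : ∀ g ∈ groupG n, ∀ Y : gTwo, ∃ w,
    HasDerivAt (fun t : ℝ => gAct (g * NormedSpace.exp
      (t • lieNeg (Y : Matrix (Fin 2) (Fin 2) ℝ) (0 : Matrix (Fin n) (Fin 2) ℝ)))
      (stiefelOrigin n)) w 0 ∧
    w - (homogeneousLieContact n).frameTwo (frameMap g) Y ∈
      (homogeneousLieContact n).H ((homogeneousLieContact n).proj (frameMap g))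

/-- `K♯ = SO(2) × SO(n+2)`, the block diagonal subgroup of `G`. -/
def groupKsharp (n : ℕ) : Set (Matrix (Big n) (Big n) ℝ) :=
  {g | ∃ A ∈ Matrix.specialOrthogonalGroup (Fin 2) ℝ,
    ∃ B ∈ Matrix.specialOrthogonalGroup (Idx n) ℝ, g = Matrix.fromBlocks A 0 0 B}

/-- The center `Z(K♯)` of `K♯`. -/
def centerKsharp (n : ℕ) : Set (Matrix (Big n) (Big n) ℝ) :=
  {z | z ∈ groupKsharp n ∧ ∀ k ∈ groupKsharp n, z * k = k * z}

/-- The Lie algebra of `Z(K♯)`. -/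
def lieCenterKsharp (n : ℕ) : Set (Matrix (Big n) (Big n) ℝ) :=
  {Z | ∀ t : ℝ, NormedSpace.exp (t • Z) ∈ centerKsharp n}

/-- The vector field on `V₂(ℝ^{n+2})` that generates the left action of `exp(t Z)`. -/
def actionGenerator {n : ℕ} (Z : Matrix (Big n) (Big n) ℝ) (x : Matrix (Idx n) (Fin 2) ℝ) :
    Matrix (Idx n) (Fin 2) ℝ :=
  deriv (fun t : ℝ => gAct (NormedSpace.exp (t • Z)) x) 0

/-! ### The Grassmannian of oriented planes

The oriented plane `[v₁, v₂]⁺` is represented by its Plücker bivector `v₁ ∧ v₂`, for `v₁, v₂`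
orthonormal, as the skew-symmetric matrix `J = v₂ v₁ᵀ - v₁ v₂ᵀ`.  The plane is the range of `J`, and `J`
acts on it as the rotation by a right angle that is positive for the orientation. -/

/-- The bivector `a ∧ b`, as a skew-symmetric matrix. -/
def bivec {n : ℕ} (a b : Idx n → ℝ) : Matrix (Idx n) (Idx n) ℝ :=
  Matrix.vecMulVec b a - Matrix.vecMulVec a b

/-- The map `(v₁, v₂) ↦ [v₁, v₂]⁺`. -/
def orientedSpan {n : ℕ} (x : Matrix (Idx n) (Fin 2) ℝ) : Matrix (Idx n) (Idx n) ℝ :=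
  bivec (fun i => x i 0) (fun i => x i 1)

/-- The Grassmannian `G₂⁺(ℝ^{n+2})` of oriented planes. -/
def orientedGrassmannian (n : ℕ) : Set (Matrix (Idx n) (Idx n) ℝ) := orientedSpan '' stiefel n

/-- The Grassmannian structure of `S` is the standard one on `G₂⁺(ℝ^{n+2})`. -/
structure IsStandardGrassmannian {n : ℕ}
    (S : PACSData n (orientedGrassmannian n) (Idx n → ℝ) (Idx n → ℝ)) : Prop where
  /-- `E` is the tautological bundle -/
  E_eq : ∀ J, S.E J = LinearMap.range (J : Matrix (Idx n) (Idx n) ℝ).mulVecLin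
  /-- `F` is its orthogonal complement -/
  mem_F : ∀ J w, w ∈ S.F J ↔ ∀ v ∈ S.E J, v ⬝ᵥ w = 0
  /-- `φ : E → F` corresponds to the velocity of the family of graphs of `t φ` -/
  iso_eq : ∀ J, ∀ φ : S.E J →ₗ[ℝ] S.F J, ∀ v₁ v₂ : S.E J,
    bivec (v₁ : Idx n → ℝ) (v₂ : Idx n → ℝ) = (J : Matrix (Idx n) (Idx n) ℝ) →
    HasDerivAt (fun t : ℝ => bivec ((v₁ : Idx n → ℝ) + t • (φ v₁ : Idx n → ℝ))
      ((v₂ : Idx n → ℝ) + t • (φ v₂ : Idx n → ℝ)))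
      (S.iso J φ : Matrix (Idx n) (Idx n) ℝ) 0
  /-- the orientation of `E` is the tautological one -/
  orE_eq : ∀ J, ∀ b : Module.Basis (Fin 2) ℝ (S.E J), b.orientation = S.orE J ↔
    0 < (b 1 : Idx n → ℝ) ⬝ᵥ ((J : Matrix (Idx n) (Idx n) ℝ) *ᵥ (b 0 : Idx n → ℝ))
  /-- the trivialization of `Λ²E ⊗ ΛⁿF` is given by the determinant of `ℝ^{n+2} = E ⊕ F` -/
  vol_eq : ∀ J, ∀ (e : Fin 2 → S.E J) (f : Fin n → S.F J), S.vol J e f =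
    (Matrix.of fun i k : Idx n =>
      Sum.elim (fun a => (e a : Idx n → ℝ) i) (fun b => (f b : Idx n → ℝ) i) k).det
  /-- the orientation of `F` is such that `E ⊕ F` carries the orientation of `ℝ^{n+2}` -/
  orF_eq : ∀ J, ∀ (b : Module.Basis (Fin 2) ℝ (S.E J)) (c : Module.Basis (Fin n) ℝ (S.F J)),
    b.orientation = S.orE J → (c.orientation = S.orF J ↔ 0 < S.vol J b c)

/-- The restriction of the standard inner product of `ℝ^{n+2}` to a subspace. -/
def standardMetric {n : ℕ} (F : Submodule ℝ (Idx n → ℝ)) : LinearMap.BilinForm ℝ F :=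
  (dotProductBilin ℝ ℝ).domRestrict₁₂ F F

/-- The `G₀`-structure `P` on `G₂⁺(ℝ^{n+2})` is homogeneous and invariant under `K = SO(n+2)`: the action
of `K` on `G₂⁺(ℝ^{n+2})`, which is transitive, lifts to a smooth action on the total space by
automorphisms of the `G₀`-structure. -/
def IsKInvariant {n : ℕ} {U : Type} [NormedAddCommGroup U] [NormedSpace ℝ U]
    (P : G0StructureData n (Matrix (Idx n) (Idx n) ℝ) U) : Prop :=
  (∀ k ∈ Matrix.specialOrthogonalGroup (Idx n) ℝ, ∀ J ∈ orientedGrassmannian n,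
    k * J * kᵀ ∈ orientedGrassmannian n) ∧
  (∀ J ∈ orientedGrassmannian n, ∀ J' ∈ orientedGrassmannian n,
    ∃ k ∈ Matrix.specialOrthogonalGroup (Idx n) ℝ, k * J * kᵀ = J') ∧
  ∃ lact : Matrix (Idx n) (Idx n) ℝ → U → U,
    ContDiffOn ℝ ∞ (fun z : Matrix (Idx n) (Idx n) ℝ × U => lact z.1 z.2)
      ((Matrix.specialOrthogonalGroup (Idx n) ℝ : Set (Matrix (Idx n) (Idx n) ℝ)) ×ˢ P.total) ∧
    (∀ u ∈ P.total, lact 1 u = u) ∧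
    ∀ k ∈ Matrix.specialOrthogonalGroup (Idx n) ℝ, ∀ u ∈ P.total,
      lact k u ∈ P.total ∧
      (∀ k' ∈ Matrix.specialOrthogonalGroup (Idx n) ℝ, lact (k' * k) u = lact k' (lact k u)) ∧
      (∀ a ∈ G0 n, lact k (P.act u a) = P.act (lact k u) a) ∧
      P.proj (lact k u) = k * P.proj u * kᵀ ∧
      ∀ X, P.frame (lact k u) X = k * P.frame u X * kᵀ

end

/-!
# The Stiefel manifold as a Lie contact structure over the Grassmannian

Everything is made explicit in terms of matrices.  The class of `g` in `G / P₊` is recorded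
by the triple `(x, A, C)`, where `x` is the orthonormal frame `g · x₀`, `A` gives the basis
`g τ₁, g τ₂` of the isotropic plane and the columns of `C` represent `g ε₁, …, g ε_n`.  The invariant
form `h` forces `xᵀ x = 1`, `xᵀ C = 0` and `Cᵀ C = 1`, and connectedness of `G` forces `det A > 0` and
`det (x | C) > 0`.  Conversely, every such triple comes from `G`, since `SO(n + 2)` and `GL⁺(2, ℝ)` are
connected: `frameMap_image` identifies `𝒢₀♯` with the bundle `lieTotal n` of adapted frames.  It is
cut out of a vector space by equations with surjective differential, so that tangent vectors and Lie
brackets are described by linear equations; differentiating `xᵀ η = 0` along a second horizontal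
field gives the Levi bracket (`isLieContact_homogeneousLieContact`), and the forms `θ₋₁`, `θ₋₂` become
`Cᵀ dx A` and the skew part of `Aᵀ xᵀ dx A` (`thetaOne_eq`, `thetaTwo_eq`).

An element of the Lie algebra of `Z(K♯)` is a multiple of the rotation `eps` in the `SO(2)`-factor,
because no non-zero skew-symmetric matrix of size at least three commutes with the special orthogonal
group.  Hence `ξ` is `x ↦ -c x ε` with `c ≠ 0`; it is nowhere horizontal, and its lift
`(-c x ε, c ε A, 0)` preserves both forms since the contributions of `x` and of `A` cancel
(`isLift_liftField`).

The oriented plane of `x` is the matrix `J = x ε xᵀ`, and `x A` spans `det A • J` in this sense.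
The flow of the lift is `(x R⁻¹, R A, C)` with rotations `R`, so that its invariants are `J`, the frame
`x A` of the plane, and the frame `C` of the orthogonal complement.  This defines the map `quotMap` onto
the `G₀`-structure of pairs of frames (`grassmannG0Structure`), whose fibres are circles; it pulls `θ`
back to `θ₋₁` because the derivative of `x ↦ J` identifies horizontal vectors with tangent vectors of
the Grassmannian (`mem_tangentSpaceAt_grassmannian`, `isPCSQuotient_quotMap`).

Finally, `ω_J (v, w) = tr (J [v, w])` spans `ℓ`.  On tangent vectors that come from horizontal
`v`, `w` it is `-2 tr (vᵀ w ε)`, which is the area form of `E*` times the standard metric of `F`; this gives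
non-degeneracy, the Hermitian property and the ray of metrics.  Its exterior derivative is an
alternating sum of traces of products of three tangent vectors, and these vanish since tangent vectors
interchange the plane and its complement (`trace_spanDeriv_mul_mul`).
-/

/-! ### Submanifolds and their tangent spaces -/

section Submanifolds

variable {E E' W G : Type} [NormedAddCommGroup E] [NormedSpace ℝ E]
  [NormedAddCommGroup E'] [NormedSpace ℝ E'] [NormedAddCommGroup W] [NormedSpace ℝ W]
  [NormedAddCommGroup G] [NormedSpace ℝ G]

/-- Near `x`, the set `S` has a smooth local parametrization by an open subset of the model
space `G`, whose inverse is the restriction of a smooth map. -/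
def HasSmoothChart (G : Type) [NormedAddCommGroup G] [NormedSpace ℝ G] (S : Set E) (x : E) : Prop :=
  ∃ (O : Set E) (W : Set G) (ψ : E → G) (σ : G → E),
    IsOpen O ∧ x ∈ O ∧ IsOpen W ∧ ContDiffOn ℝ ∞ ψ O ∧ ContDiffOn ℝ ∞ σ W ∧
    Set.MapsTo ψ (S ∩ O) W ∧ Set.MapsTo σ W (S ∩ O) ∧
    (∀ y ∈ S ∩ O, σ (ψ y) = y) ∧ (∀ w ∈ W, ψ (σ w) = w)

theorem HasSmoothChart.congr_model {G' : Type} [NormedAddCommGroup G'] [NormedSpace ℝ G']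
    (L : G ≃L[ℝ] G') {S : Set E} {x : E} (h : HasSmoothChart G S x) : HasSmoothChart G' S x := by
  obtain ⟨O, W, ψ, σ, hO, hx, hW, hψ, hσ, h1, h2, h3, h4⟩ := h
  refine ⟨O, L.symm ⁻¹' W, L ∘ ψ, σ ∘ L.symm, hO, hx, hW.preimage L.symm.continuous,
    L.contDiff.comp_contDiffOn hψ, hσ.comp L.symm.contDiff.contDiffOn fun _ h => h, ?_, ?_, ?_, ?_⟩
  · intro y hy
    simpa using h1 hy
  · exact fun w hw => h2 hw
  · intro y hy
    simpa using h3 y hy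
  · intro w hw
    have := h4 _ hw
    simp only [Function.comp_apply, this, ContinuousLinearEquiv.apply_symm_apply]

theorem IsSubmanifold.of_hasSmoothChart [FiniteDimensional ℝ G] {S : Set E} {x : E} {d : ℕ}
    (hd : Module.finrank ℝ G = d) (h : HasSmoothChart G S x) :
    HasSmoothChart (EuclideanSpace ℝ (Fin d)) S x :=
  h.congr_model (ContinuousLinearEquiv.ofFinrankEq (by simp [hd]))

/-- The graph of a smooth map on a submanifold is a submanifold. -/
theorem HasSmoothChart.graph {S : Set E} {x : E} (hS : HasSmoothChart G S x) (h : E → E')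
    {O : Set E} (hO : IsOpen O) (hx : x ∈ O) (hh : ContDiffOn ℝ ∞ h O) :
    HasSmoothChart G {p : E' × E | p.2 ∈ S ∧ p.1 = h p.2} (h x, x) := by
  obtain ⟨O₁, W, ψ, σ, hO₁, hx₁, hW, hψ, hσ, h1, h2, h3, h4⟩ := hS
  have hσc : IsOpen (W ∩ σ ⁻¹' O) := hσ.continuousOn.isOpen_inter_preimage hW hO
  refine ⟨Prod.snd ⁻¹' (O₁ ∩ O), W ∩ σ ⁻¹' O, fun p => ψ p.2, fun w => (h (σ w), σ w),
    (hO₁.inter hO).preimage continuous_snd, ⟨hx₁, hx⟩, hσc, ?_, ?_, ?_, ?_, ?_, ?_⟩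
  · exact hψ.comp contDiff_snd.contDiffOn fun p hp => hp.1
  · have hσ' := hσ.mono (Set.inter_subset_left (t := σ ⁻¹' O))
    exact (hh.comp hσ' fun w hw => hw.2).prodMk hσ'
  · rintro p ⟨hp, hp'⟩
    refine ⟨h1 ⟨hp.1, hp'.1⟩, ?_⟩
    change σ (ψ p.2) ∈ O
    rw [h3 _ ⟨hp.1, hp'.1⟩]
    exact hp'.2
  · rintro w ⟨hw, hw'⟩
    exact ⟨⟨(h2 hw).1, rfl⟩, (h2 hw).2, hw'⟩
  · rintro p ⟨hp, hp'⟩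
    have := h3 _ ⟨hp.1, hp'.1⟩
    exact Prod.ext (by simp [this, hp.2]) this
  · rintro w ⟨hw, -⟩
    exact h4 w hw

/-- Two derivatives of `f` within `S` agree on the tangent space. -/
theorem HasFDerivWithinAt.eq_of_mem_tangentSpaceAt {f : E → W} {f' f₁' : E →L[ℝ] W} {S : Set E}
    {x w : E} (hf : HasFDerivWithinAt f f' S x) (hf₁ : HasFDerivWithinAt f f₁' S x)
    (hw : w ∈ tangentSpaceAt S x) : f' w = f₁' w := by
  have h : tangentSpaceAt S x ≤ LinearMap.eqLocus f'.toLinearMap f₁'.toLinearMap :=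
    Submodule.span_le.2 fun v hv => hf.unique_on hf₁ hv
  exact h hw

theorem HasFDerivWithinAt.fderivWithin_apply {f : E → W} {f' : E →L[ℝ] W} {S : Set E}
    {x w : E} (hf : HasFDerivWithinAt f f' S x) (hw : w ∈ tangentSpaceAt S x) :
    fderivWithin ℝ f S x w = f' w :=
  hf.differentiableWithinAt.hasFDerivWithinAt.eq_of_mem_tangentSpaceAt hf hw

theorem HasFDerivWithinAt.fderivWithin_apply_of_eqOn {f g : E → W} {g' : E →L[ℝ] W} {S : Set E}
    {x w : E} (hg : HasFDerivWithinAt g g' S x) (hfg : ∀ y ∈ S, f y = g y) (hx : x ∈ S)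
    (hw : w ∈ tangentSpaceAt S x) : fderivWithin ℝ f S x w = g' w :=
  (hg.congr hfg (hfg x hx)).fderivWithin_apply hw

theorem HasFDerivWithinAt.map_mem_tangentSpaceAt {f : E → W} {f' : E →L[ℝ] W} {S : Set E}
    {T : Set W} {x w : E} (hf : HasFDerivWithinAt f f' S x) (hST : Set.MapsTo f S T)
    (hw : w ∈ tangentSpaceAt S x) : f' w ∈ tangentSpaceAt T (f x) := by
  have h : tangentSpaceAt S x ≤ (tangentSpaceAt T (f x)).comap f'.toLinearMap :=
    Submodule.span_le.2 fun v hv => Submodule.subset_span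
      (tangentConeAt_mono hST.image_subset (hf.mapsTo_tangent_cone hv))
  exact h hw

theorem tangentSpaceAt_inter_of_isOpen {S O : Set E} (hO : IsOpen O) {x : E} (hx : x ∈ O) :
    tangentSpaceAt (S ∩ O) x = tangentSpaceAt S x := by
  unfold tangentSpaceAt
  rw [tangentConeAt_congr]
  rw [nhdsWithin_inter_of_mem' (mem_nhdsWithin_of_mem_nhds (hO.mem_nhds hx))]

/-- A function that is constant on `S` near `x` has zero derivative along `S`. -/
theorem HasFDerivWithinAt.apply_eq_zero_of_eqOn {f : E → W} {f' : E →L[ℝ] W} {S O : Set E}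
    {x w : E} {c : W} (hf : HasFDerivWithinAt f f' S x) (hO : IsOpen O) (hx : x ∈ O)
    (hxS : x ∈ S) (hc : ∀ y ∈ S ∩ O, f y = c) (hw : w ∈ tangentSpaceAt S x) : f' w = 0 := by
  have h0 : HasFDerivWithinAt f (0 : E →L[ℝ] W) (S ∩ O) x :=
    (hasFDerivWithinAt_const c x _).congr hc (hc x ⟨hxS, hx⟩)
  rw [← tangentSpaceAt_inter_of_isOpen hO hx] at hw
  exact (hf.mono Set.inter_subset_left).eq_of_mem_tangentSpaceAt h0 hw

theorem fderivWithin_continuousLinearMap_apply (L : E →L[ℝ] W) {S : Set E} {x w : E}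
    (hw : w ∈ tangentSpaceAt S x) : fderivWithin ℝ L S x w = L w :=
  L.hasFDerivWithinAt.fderivWithin_apply hw

/-- Regular value theorem: where `S` is the zero set of a smooth map `Φ` with surjective differential,
it is a submanifold modelled on the kernel of the differential, and this kernel is its tangent
space. -/
theorem hasSmoothChart_and_tangentSpaceAt_of_regular [FiniteDimensional ℝ E]
    {Φ : E → W} (hΦ : ContDiff ℝ ∞ Φ) {S O : Set E} (hO : IsOpen O)
    (hS : ∀ y ∈ O, y ∈ S ↔ Φ y = 0) {x : E} (hxO : x ∈ O) (hxS : x ∈ S)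
    {Φ' : E →L[ℝ] W} (hΦ' : HasFDerivAt Φ Φ' x) (hsurj : Function.Surjective Φ') :
    HasSmoothChart Φ'.ker S x ∧ tangentSpaceAt S x = Φ'.ker := by
  have : FiniteDimensional ℝ W := Module.Finite.of_surjective Φ'.toLinearMap hsurj
  -- a linear projection `π` onto the kernel turns `(Φ, π)` into a local diffeomorphism
  obtain ⟨π₀, hπ₀⟩ := Φ'.ker.subtype.exists_leftInverse_of_injective
    (by simp)
  let π : E →L[ℝ] Φ'.ker := LinearMap.toContinuousLinearMap π₀
  have hπ : ∀ v : Φ'.ker, π v = v := fun v => LinearMap.congr_fun hπ₀ v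
  let f : E → W × Φ'.ker := fun y => (Φ y, π y)
  have hf : ContDiff ℝ ∞ f := hΦ.prodMk π.contDiff
  let L := Φ'.prod π
  have hbij : Function.Bijective L := by
    constructor
    · rw [injective_iff_map_eq_zero]
      intro a ha
      have h1 : Φ' a = 0 := congrArg Prod.fst ha
      have h2 : π a = 0 := congrArg Prod.snd ha
      have := hπ ⟨a, h1⟩
      rw [h2] at this
      exact (congrArg Subtype.val this).symm
    · rintro ⟨b, c⟩
      obtain ⟨a, rfl⟩ := hsurj b
      refine ⟨a - π a + c, Prod.ext ?_ ?_⟩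
      · have h1 : Φ' (π a) = 0 := (π a).2
        have h2 : Φ' c = 0 := c.2
        change Φ' (a - π a + c) = Φ' a
        rw [map_add, map_sub, h1, h2]; simp
      · change π (a - π a + c) = c
        rw [map_add, map_sub, hπ, hπ]; simp
  let Le : E ≃L[ℝ] W × Φ'.ker :=
    (LinearEquiv.ofBijective L.toLinearMap hbij).toContinuousLinearEquiv
  have hLe : (Le : E →L[ℝ] W × Φ'.ker) = L := by ext <;> rfl
  have hfx : HasFDerivAt f (Le : E →L[ℝ] W × Φ'.ker) x := by
    rw [hLe]
    exact hΦ'.prodMk π.hasFDerivAt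
  let e := hf.contDiffAt.toOpenPartialHomeomorph f hfx (by simp)
  have he : ∀ y, e y = f y := fun y => rfl
  have hxe : x ∈ e.source := hf.contDiffAt.mem_toOpenPartialHomeomorph_source hfx (by simp)
  let I : Set E := {y | fderiv ℝ f y ∈ Set.range ((↑) : (E ≃L[ℝ] W × Φ'.ker) → _)}
  have hI : IsOpen I := ContinuousLinearEquiv.isOpen.preimage (hf.continuous_fderiv (by simp))
  let O₁ := e.source ∩ (O ∩ I)
  have hO₁ : IsOpen O₁ := e.open_source.inter (hO.inter hI)
  have hxO₁ : x ∈ O₁ := ⟨hxe, hxO, ⟨Le, hfx.fderiv.symm⟩⟩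
  let W₁ : Set Φ'.ker := (fun w => ((0 : W), w)) ⁻¹' (e.target ∩ e.symm ⁻¹' O₁)
  have hW₁ : IsOpen W₁ :=
    (e.symm.isOpen_inter_preimage hO₁).preimage (by fun_prop)
  have hsymm : ∀ p ∈ e.target ∩ e.symm ⁻¹' O₁, ContDiffAt ℝ ∞ e.symm p := by
    rintro p ⟨hp, hp'⟩
    obtain ⟨Lp, hLp⟩ := hp'.2.2
    refine e.contDiffAt_symm (f₀' := Lp) hp ?_ hf.contDiffAt
    rw [hLp]
    exact (hf.differentiable (by simp) _).hasFDerivAt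
  have hσ : ContDiffOn ℝ ∞ (fun w : Φ'.ker => e.symm (0, w)) W₁ := by
    intro w hw
    exact ((hsymm _ hw).comp w (contDiffAt_const.prodMk contDiffAt_id)).contDiffWithinAt
  have hmem : ∀ w ∈ W₁, e.symm (0, w) ∈ S ∩ O₁ := by
    rintro w ⟨hw, hw'⟩
    refine ⟨(hS _ hw'.2.1).2 ?_, hw'⟩
    have := e.right_inv hw
    rw [he] at this
    exact congrArg Prod.fst this
  have hfx0 : ∀ y ∈ S ∩ O₁, e y = (0, π y) := by
    rintro y ⟨hy, hy'⟩
    exact Prod.ext ((hS y hy'.2.1).1 hy) rfl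
  have hψ : ∀ y ∈ S ∩ O₁, π y ∈ W₁ := by
    intro y hy
    change ((0 : W), π y) ∈ e.target ∩ e.symm ⁻¹' O₁
    rw [← hfx0 y hy]
    exact ⟨e.map_source hy.2.1, by simpa [e.left_inv hy.2.1] using hy.2⟩
  refine ⟨⟨O₁, W₁, π, fun w => e.symm (0, w), hO₁, hxO₁, hW₁, π.contDiff.contDiffOn, hσ, hψ, hmem,
    ?_, ?_⟩, le_antisymm ?_ ?_⟩
  · intro y hy
    change e.symm (0, π y) = y
    rw [← hfx0 y hy, e.left_inv hy.2.1]
  · rintro w ⟨hw, hw'⟩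
    have := e.right_inv hw
    rw [he] at this
    exact congrArg Prod.snd this
  · intro w hw
    exact hΦ'.hasFDerivWithinAt.apply_eq_zero_of_eqOn hO hxO hxS
      (fun y hy => (hS y hy.2).1 hy.1) hw
  · intro w hw
    have h1 : HasFDerivAt e.symm (Le.symm : W × Φ'.ker →L[ℝ] E) (e x) :=
      e.hasFDerivAt_symm (e.map_source hxe) (by rw [e.left_inv hxe]; exact hfx)
    rw [hfx0 x ⟨hxS, hxO₁⟩] at h1
    have h2 : HasFDerivAt (fun w : Φ'.ker => e.symm (0, w))
        ((Le.symm : W × Φ'.ker →L[ℝ] E) ∘L (ContinuousLinearMap.inr ℝ W Φ'.ker)) (π x) := by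
      refine HasFDerivAt.comp (π x) h1 ?_
      exact (hasFDerivAt_const (0 : W) (π x)).prodMk (hasFDerivAt_id (π x))
    have h3 := h2.hasFDerivWithinAt (s := W₁)
    have hx1 : e.symm (0, π x) = x := by rw [← hfx0 x ⟨hxS, hxO₁⟩, e.left_inv hxe]
    have hmap : Set.MapsTo (fun w : Φ'.ker => e.symm (0, w)) W₁ S := fun w hw => (hmem w hw).1
    have hun : (⟨w, hw⟩ : Φ'.ker) ∈ tangentSpaceAt W₁ (π x) := by
      rw [← Set.univ_inter W₁, tangentSpaceAt_inter_of_isOpen hW₁ (hψ x ⟨hxS, hxO₁⟩)]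
      simp [tangentSpaceAt]
    have h4 := h3.map_mem_tangentSpaceAt hmap hun
    simp only [hx1] at h4
    convert h4 using 1
    change w = Le.symm (0, ⟨w, hw⟩)
    rw [eq_comm, ContinuousLinearEquiv.symm_apply_eq]
    exact Prod.ext hw.symm (hπ ⟨w, hw⟩).symm

/-- The Lie bracket of vector fields tangent to a zero set is tangent to it: differentiate
`dΦ(η) = 0` along `ξ` and use the symmetry of the second derivative of `Φ`. -/
theorem fderiv_lieBracketWithin_eq_zero {Φ : E → W} (hΦ : ContDiff ℝ ∞ Φ) {S O : Set E}
    (hO : IsOpen O) {x : E} (hxO : x ∈ O) (hxS : x ∈ S) {ξ η : E → E}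
    (hS : ∀ y ∈ S ∩ O, ∀ w ∈ tangentSpaceAt S y, fderiv ℝ Φ y w = 0)
    (hξ : IsVectorField S ξ) (hη : IsVectorField S η) :
    fderiv ℝ Φ x (VectorField.lieBracketWithin ℝ ξ η S x) = 0 := by
  have key : ∀ ζ : E → E, IsVectorField S ζ → ∀ w ∈ tangentSpaceAt S x,
      fderiv ℝ Φ x (fderivWithin ℝ ζ S x w) = - fderiv ℝ (fderiv ℝ Φ) x w (ζ x) := by
    intro ζ hζ w hw
    have h1 : HasFDerivAt (fderiv ℝ Φ) (fderiv ℝ (fderiv ℝ Φ) x) x :=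
      ((hΦ.fderiv_right (m := 1) (by norm_cast)).differentiable (by simp) x).hasFDerivAt
    have h2 : HasFDerivWithinAt ζ (fderivWithin ℝ ζ S x) S x :=
      ((hζ.smooth x hxS).differentiableWithinAt (by simp)).hasFDerivWithinAt
    have h3 := h1.hasFDerivWithinAt (s := S) |>.clm_apply h2
    have h4 := h3.apply_eq_zero_of_eqOn hO hxO hxS (c := 0)
      (fun y hy => hS y hy _ (hζ.tangent y hy.1)) hw
    simp only [add_apply, ContinuousLinearMap.comp_apply,
      ContinuousLinearMap.flip_apply] at h4
    exact eq_neg_of_add_eq_zero_left h4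
  have hsymm : IsSymmSndFDerivAt ℝ Φ x :=
    hΦ.contDiffAt.isSymmSndFDerivAt (by simpa using ENat.LEInfty.out)
  rw [VectorField.lieBracketWithin, map_sub, key η hη _ (hξ.tangent x hxS),
    key ξ hξ _ (hη.tangent x hxS), hsymm.eq]
  simp

end Submanifolds

/-! ### Calculus of matrix-valued functions -/

section MatrixCalculus

variable {l m n : Type} [Fintype l] [Fintype m] [Fintype n]
  {E : Type} [NormedAddCommGroup E] [NormedSpace ℝ E]

/-- Matrix multiplication as a continuous bilinear map. -/
noncomputable def mulL (l m n : Type) [Fintype l] [Fintype m] [Fintype n] :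
    Matrix l m ℝ →L[ℝ] Matrix m n ℝ →L[ℝ] Matrix l n ℝ :=
  LinearMap.toContinuousBilinearMap (LinearMap.mk₂ ℝ (fun A B => A * B) Matrix.add_mul
    (fun c A B => Matrix.smul_mul c A B) Matrix.mul_add fun c A B => Matrix.mul_smul A c B)

/-- Transposition of matrices as a continuous linear map. -/
noncomputable def transposeL (m n : Type) [Fintype m] [Fintype n] :
    Matrix m n ℝ →L[ℝ] Matrix n m ℝ :=
  LinearMap.toContinuousLinearMap (Matrix.transposeLinearEquiv m n ℝ ℝ).toLinearMap

/-- The derivative of a product of matrix-valued functions with values `A`, `B` and derivatives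
`f'`, `g'`. -/
def mulDeriv (A : Matrix l m ℝ) (B : Matrix m n ℝ) (f' : E →L[ℝ] Matrix l m ℝ)
    (g' : E →L[ℝ] Matrix m n ℝ) : E →L[ℝ] Matrix l n ℝ where
  toFun w := A * g' w + f' w * B
  map_add' v w := by
    rw [map_add, map_add, Matrix.mul_add, Matrix.add_mul]; abel
  map_smul' c w := by
    rw [map_smul, map_smul, Matrix.mul_smul, Matrix.smul_mul, RingHom.id_apply, smul_add]
  cont := (continuous_const.matrix_mul g'.continuous).add
    (f'.continuous.matrix_mul continuous_const)

omit [Fintype l] [Fintype n] in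
@[simp] theorem mulDeriv_apply (A : Matrix l m ℝ) (B : Matrix m n ℝ) (f' : E →L[ℝ] Matrix l m ℝ)
    (g' : E →L[ℝ] Matrix m n ℝ) (w : E) : mulDeriv A B f' g' w = A * g' w + f' w * B := rfl

/-- The derivative of the transpose of a matrix-valued function with derivative `f'`. -/
def transposeDeriv (f' : E →L[ℝ] Matrix l m ℝ) : E →L[ℝ] Matrix m l ℝ where
  toFun w := (f' w)ᵀ
  map_add' v w := by rw [map_add, Matrix.transpose_add]
  map_smul' c w := by rw [map_smul, Matrix.transpose_smul, RingHom.id_apply]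
  cont := f'.continuous.matrix_transpose

theorem HasFDerivWithinAt.matrix_mul {f : E → Matrix l m ℝ} {g : E → Matrix m n ℝ}
    {f' : E →L[ℝ] Matrix l m ℝ} {g' : E →L[ℝ] Matrix m n ℝ} {S : Set E} {x : E}
    (hf : HasFDerivWithinAt f f' S x) (hg : HasFDerivWithinAt g g' S x) :
    HasFDerivWithinAt (fun y => f y * g y) (mulDeriv (f x) (g x) f' g') S x :=
  (mulL l m n).hasFDerivWithinAt_of_bilinear hf hg

theorem HasFDerivAt.matrix_mul {f : E → Matrix l m ℝ} {g : E → Matrix m n ℝ}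
    {f' : E →L[ℝ] Matrix l m ℝ} {g' : E →L[ℝ] Matrix m n ℝ} {x : E}
    (hf : HasFDerivAt f f' x) (hg : HasFDerivAt g g' x) :
    HasFDerivAt (fun y => f y * g y) (mulDeriv (f x) (g x) f' g') x :=
  (mulL l m n).hasFDerivAt_of_bilinear hf hg

theorem HasFDerivWithinAt.matrix_transpose {f : E → Matrix l m ℝ}
    {f' : E →L[ℝ] Matrix l m ℝ} {S : Set E} {x : E} (hf : HasFDerivWithinAt f f' S x) :
    HasFDerivWithinAt (fun y => (f y)ᵀ) (transposeDeriv f') S x :=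
  (transposeL l m).hasFDerivAt.comp_hasFDerivWithinAt x hf

theorem HasFDerivAt.matrix_transpose {f : E → Matrix l m ℝ}
    {f' : E →L[ℝ] Matrix l m ℝ} {x : E} (hf : HasFDerivAt f f' x) :
    HasFDerivAt (fun y => (f y)ᵀ) (transposeDeriv f') x :=
  (transposeL l m).hasFDerivAt.comp x hf

theorem HasDerivAt.matrix_mul {f : ℝ → Matrix l m ℝ} {g : ℝ → Matrix m n ℝ}
    {f' : Matrix l m ℝ} {g' : Matrix m n ℝ} {t : ℝ}
    (hf : HasDerivAt f f' t) (hg : HasDerivAt g g' t) :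
    HasDerivAt (fun y => f y * g y) (f t * g' + f' * g t) t := by
  have := (HasFDerivAt.matrix_mul hf.hasFDerivAt hg.hasFDerivAt).hasDerivAt
  simpa using this

omit [Fintype m] in
theorem HasDerivAt.matrix_entry {f : ℝ → Matrix m n ℝ} {f' : Matrix m n ℝ} {t : ℝ}
    (hf : HasDerivAt f f' t) (i : m) (j : n) : HasDerivAt (fun s => f s i j) (f' i j) t :=
  hasDerivAt_pi.1 (hasDerivAt_pi.1 hf i) j

omit [Fintype m] in
theorem HasDerivAt.of_matrix_entry {f : ℝ → Matrix m n ℝ} {f' : Matrix m n ℝ} {t : ℝ}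
    (hf : ∀ i j, HasDerivAt (fun s => f s i j) (f' i j) t) : HasDerivAt f f' t :=
  hasDerivAt_pi.2 fun i => hasDerivAt_pi.2 fun j => hf i j

@[fun_prop] theorem ContDiffOn.matrix_mul {k : ℕ∞ω} {f : E → Matrix l m ℝ} {g : E → Matrix m n ℝ}
    {S : Set E} (hf : ContDiffOn ℝ k f S) (hg : ContDiffOn ℝ k g S) :
    ContDiffOn ℝ k (fun y => f y * g y) S :=
  (mulL l m n).isBoundedBilinearMap.contDiff.comp_contDiffOn (hf.prodMk hg)

@[fun_prop] theorem ContDiff.matrix_mul {k : ℕ∞ω} {f : E → Matrix l m ℝ} {g : E → Matrix m n ℝ}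
    (hf : ContDiff ℝ k f) (hg : ContDiff ℝ k g) : ContDiff ℝ k (fun y => f y * g y) :=
  contDiffOn_univ.1 (hf.contDiffOn.matrix_mul hg.contDiffOn)

@[fun_prop] theorem ContDiffOn.matrix_transpose {k : ℕ∞ω} {f : E → Matrix l m ℝ}
    {S : Set E} (hf : ContDiffOn ℝ k f S) : ContDiffOn ℝ k (fun y => (f y)ᵀ) S :=
  (transposeL l m).contDiff.comp_contDiffOn hf

@[fun_prop] theorem ContDiff.matrix_transpose {k : ℕ∞ω} {f : E → Matrix l m ℝ}
    (hf : ContDiff ℝ k f) : ContDiff ℝ k (fun y => (f y)ᵀ) :=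
  (transposeL l m).contDiff.comp hf

theorem ContDiffOn.matrix_entry {k : ℕ∞ω} {f : E → Matrix l m ℝ}
    {S : Set E} (hf : ContDiffOn ℝ k f S) (i : l) (j : m) : ContDiffOn ℝ k (fun y => f y i j) S :=
  contDiffOn_pi.1 (contDiffOn_pi.1 hf i) j

theorem ContDiff.matrix_entry {k : ℕ∞ω} {f : E → Matrix l m ℝ}
    (hf : ContDiff ℝ k f) (i : l) (j : m) : ContDiff ℝ k (fun y => f y i j) :=
  contDiff_pi.1 (contDiff_pi.1 hf i) j

theorem ContDiffOn.of_matrix_entry {k : ℕ∞ω} {f : E → Matrix l m ℝ}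
    {S : Set E} (hf : ∀ i j, ContDiffOn ℝ k (fun y => f y i j) S) : ContDiffOn ℝ k f S :=
  contDiffOn_pi.2 fun i => contDiffOn_pi.2 fun j => hf i j

@[fun_prop] theorem ContDiffOn.matrix_det [DecidableEq m] {k : ℕ∞ω} {f : E → Matrix m m ℝ}
    {S : Set E} (hf : ContDiffOn ℝ k f S) : ContDiffOn ℝ k (fun y => (f y).det) S := by
  simp only [Matrix.det_apply']
  refine ContDiffOn.sum fun p _ => ?_
  exact contDiffOn_const.mul (contDiffOn_prod fun i _ => hf.matrix_entry _ _)

@[fun_prop] theorem ContDiff.matrix_det [DecidableEq m] {k : ℕ∞ω} {f : E → Matrix m m ℝ}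
    (hf : ContDiff ℝ k f) : ContDiff ℝ k (fun y => (f y).det) :=
  contDiffOn_univ.1 hf.contDiffOn.matrix_det

@[fun_prop] theorem ContDiffOn.matrix_fromCols {k : ℕ∞ω} {f : E → Matrix l m ℝ} {g : E → Matrix l n ℝ}
    {S : Set E} (hf : ContDiffOn ℝ k f S) (hg : ContDiffOn ℝ k g S) :
    ContDiffOn ℝ k (fun y => Matrix.fromCols (f y) (g y)) S := by
  refine ContDiffOn.of_matrix_entry fun i j => ?_
  rcases j with j | j
  · exact hf.matrix_entry i j
  · exact hg.matrix_entry i j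

@[fun_prop] theorem ContDiff.matrix_fromCols {k : ℕ∞ω} {f : E → Matrix l m ℝ} {g : E → Matrix l n ℝ}
    (hf : ContDiff ℝ k f) (hg : ContDiff ℝ k g) :
    ContDiff ℝ k (fun y => Matrix.fromCols (f y) (g y)) :=
  contDiffOn_univ.1 (hf.contDiffOn.matrix_fromCols hg.contDiffOn)

theorem ContDiffOn.matrix_inv {k : ℕ∞ω} {f : E → Matrix (Fin 2) (Fin 2) ℝ}
    {S : Set E} (hf : ContDiffOn ℝ k f S) (h0 : ∀ y ∈ S, (f y).det ≠ 0) :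
    ContDiffOn ℝ k (fun y => (f y)⁻¹) S := by
  simp only [Matrix.inv_def, Ring.inverse_eq_inv']
  refine (hf.matrix_det.inv h0).smul (ContDiffOn.of_matrix_entry fun i j => ?_)
  simp only [Matrix.adjugate_fin_two]
  fin_cases i <;> fin_cases j <;> simp
  · exact hf.matrix_entry _ _
  · exact (hf.matrix_entry _ _).neg
  · exact (hf.matrix_entry _ _).neg
  · exact hf.matrix_entry _ _

theorem hasDerivAt_exp_smul_zero [DecidableEq n] (Z : Matrix n n ℝ) :
    HasDerivAt (fun t : ℝ => NormedSpace.exp (t • Z)) Z 0 := by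
  -- the derivative depends only on the topology, so a submultiplicative norm may be used
  let i1 : NormedRing (Matrix n n ℝ) := Matrix.linftyOpNormedRing
  let i2 : NormedAlgebra ℝ (Matrix n n ℝ) := Matrix.linftyOpNormedAlgebra
  have : @CompleteSpace (Matrix n n ℝ) i1.toUniformSpace :=
    @FiniteDimensional.complete ℝ (Matrix n n ℝ) _ _ i1.toAddCommGroup i1.toUniformSpace _ _ _ _ _
  have h := hasDerivAt_exp_smul_const (𝕂 := ℝ) Z 0
  simp only [zero_smul, NormedSpace.exp_zero, one_mul] at h
  exact h

/-- Derivative of a quotient `N D⁻¹` with invertible `2 × 2` denominator. -/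
theorem HasDerivAt.matrix_mul_inv {N : ℝ → Matrix m (Fin 2) ℝ} {D : ℝ → Matrix (Fin 2) (Fin 2) ℝ}
    {N' : Matrix m (Fin 2) ℝ} {D' : Matrix (Fin 2) (Fin 2) ℝ} {t : ℝ}
    (hN : HasDerivAt N N' t) (hD : HasDerivAt D D' t) (h0 : (D t).det ≠ 0) :
    HasDerivAt (fun s => N s * (D s)⁻¹) ((N' - N t * (D t)⁻¹ * D') * (D t)⁻¹) t := by
  have hopen : IsOpen {A : Matrix (Fin 2) (Fin 2) ℝ | A.det ≠ 0} :=
    isOpen_ne_fun (Continuous.matrix_det continuous_id) continuous_const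
  have h1 : ContDiffOn ℝ 1 (fun A : Matrix (Fin 2) (Fin 2) ℝ => A⁻¹) {A | A.det ≠ 0} :=
    contDiffOn_id.matrix_inv fun y hy => hy
  have h2 : DifferentiableAt ℝ (fun A : Matrix (Fin 2) (Fin 2) ℝ => A⁻¹) (D t) :=
    (h1.contDiffAt (hopen.mem_nhds h0)).differentiableAt (by simp)
  obtain ⟨I', hI⟩ : ∃ I', HasDerivAt (fun s => (D s)⁻¹) I' t :=
    ⟨_, (h2.hasFDerivAt.comp_hasDerivAt t hD)⟩
  have h3 := hD.matrix_mul hI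
  have h4 : HasDerivAt (fun s => D s * (D s)⁻¹) 0 t := by
    refine (hasDerivAt_const t (1 : Matrix (Fin 2) (Fin 2) ℝ)).congr_of_eventuallyEq ?_
    filter_upwards [hD.continuousAt.preimage_mem_nhds (hopen.mem_nhds h0)] with s hs
    exact Matrix.mul_nonsing_inv _ (isUnit_iff_ne_zero.2 hs)
  have h5 := h3.unique h4
  have hu : IsUnit (D t).det := isUnit_iff_ne_zero.2 h0
  have h6 : I' = - (D t)⁻¹ * D' * (D t)⁻¹ := by
    have : (D t)⁻¹ * (D t * I' + D' * (D t)⁻¹) = 0 := by rw [h5, Matrix.mul_zero]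
    rw [Matrix.mul_add, ← Matrix.mul_assoc, Matrix.nonsing_inv_mul _ hu, Matrix.one_mul] at this
    rw [eq_neg_of_add_eq_zero_left this, Matrix.mul_assoc]
    simp
  convert hN.matrix_mul hI using 1
  rw [h6, Matrix.sub_mul]
  simp only [Matrix.neg_mul, Matrix.mul_neg, Matrix.mul_assoc]
  abel

end MatrixCalculus

/-! ### Connectedness of `SO(m)` and of `GL⁺(2, ℝ)` -/

section Connectedness

/-- A continuous function without zeros on a preconnected set has constant sign. -/
theorem IsPreconnected.pos_of_ne_zero {X : Type} [TopologicalSpace X] {s : Set X}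
    (hs : IsPreconnected s) {f : X → ℝ} (hf : ContinuousOn f s) (h0 : ∀ x ∈ s, f x ≠ 0) {a : X}
    (ha : a ∈ s) (hpos : 0 < f a) : ∀ x ∈ s, 0 < f x := by
  intro x hx
  by_contra hneg
  obtain ⟨y, hy, hy0⟩ := hs.intermediate_value hx ha hf ⟨not_lt.1 hneg, hpos.le⟩
  exact h0 y hy hy0

/-- The group of matrices that preserve the bilinear form with matrix `H`. -/
def formGroup {ι : Type} [Fintype ι] [DecidableEq ι] (H : Matrix ι ι ℝ) : Set (Matrix ι ι ℝ) :=
  {g | gᵀ * H * g = H}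

variable {ι : Type} [Fintype ι] [DecidableEq ι] {H : Matrix ι ι ℝ}

theorem one_mem_formGroup : (1 : Matrix ι ι ℝ) ∈ formGroup H := by simp [formGroup]

theorem mul_mem_formGroup {g k : Matrix ι ι ℝ} (hg : g ∈ formGroup H) (hk : k ∈ formGroup H) :
    g * k ∈ formGroup H := by
  change (g * k)ᵀ * H * (g * k) = H
  calc (g * k)ᵀ * H * (g * k) = kᵀ * (gᵀ * H * g) * k := by
        rw [Matrix.transpose_mul]; simp only [Matrix.mul_assoc]
    _ = H := by rw [hg, hk]

theorem mul_mem_connectedComponentIn_formGroup {g k : Matrix ι ι ℝ}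
    (hg : g ∈ connectedComponentIn (formGroup H) 1)
    (hk : k ∈ connectedComponentIn (formGroup H) 1) :
    g * k ∈ connectedComponentIn (formGroup H) 1 := by
  have hg' := connectedComponentIn_subset _ _ hg
  rw [connectedComponentIn_eq hg]
  refine ((isPreconnected_connectedComponentIn (x := (1 : Matrix ι ι ℝ)) (F := formGroup H)).image
    (fun x => g * x) (by fun_prop)).subset_connectedComponentIn
    ⟨1, mem_connectedComponentIn one_mem_formGroup, by simp⟩ ?_ ⟨k, hk, rfl⟩
  rintro _ ⟨x, hx, rfl⟩
  exact mul_mem_formGroup hg' (connectedComponentIn_subset _ _ hx)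

/-- The reflection in the hyperplane orthogonal to the unit vector `u`. -/
def householder (u : ι → ℝ) : Matrix ι ι ℝ := 1 - (2 : ℝ) • Matrix.vecMulVec u u

omit [Fintype ι] in
theorem householder_transpose (u : ι → ℝ) : (householder u)ᵀ = householder u := by
  simp [householder, Matrix.transpose_vecMulVec]

theorem householder_mul_self {u : ι → ℝ} (hu : u ⬝ᵥ u = 1) :
    householder u * householder u = 1 := by
  have : Matrix.vecMulVec u u * Matrix.vecMulVec u u = Matrix.vecMulVec u u := by
    rw [Matrix.vecMulVec_mul_vecMulVec, hu, one_smul]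
  simp only [householder, Matrix.sub_mul, Matrix.mul_sub, Matrix.one_mul, Matrix.mul_one,
    Matrix.smul_mul, Matrix.mul_smul, this]
  module

theorem householder_mem {u : ι → ℝ} (hu : u ⬝ᵥ u = 1) :
    householder u ∈ formGroup (1 : Matrix ι ι ℝ) := by
  change _ᵀ * _ * _ = _
  rw [householder_transpose, Matrix.mul_one, householder_mul_self hu]

theorem det_householder {u : ι → ℝ} (hu : u ⬝ᵥ u = 1) : (householder u).det = -1 := by
  have : householder u = 1 + Matrix.replicateCol Unit ((-2 : ℝ) • u) * Matrix.replicateRow Unit u := by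
    rw [← Matrix.vecMulVec_eq, Matrix.smul_vecMulVec, householder]
    module
  rw [this, Matrix.det_one_add_replicateCol_mul_replicateRow, dotProduct_smul, hu]
  norm_num

omit [Fintype ι] in
theorem continuous_householder :
    Continuous fun u : EuclideanSpace ℝ ι => householder (u : ι → ℝ) := by
  refine continuous_matrix fun i j => ?_
  simp only [householder, Matrix.sub_apply, Matrix.smul_apply, Matrix.vecMulVec_apply]
  fun_prop

omit [DecidableEq ι] in
theorem dotProduct_self_of_norm_eq_one {u : EuclideanSpace ℝ ι} (hu : ‖u‖ = 1) :
    (u : ι → ℝ) ⬝ᵥ (u : ι → ℝ) = 1 := by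
  have := EuclideanSpace.real_norm_sq_eq u
  rw [hu] at this
  simp only [dotProduct, ← sq]
  linarith

/-- Two reflections are joined by a path of reflections, so their product is in the identity
component. -/
theorem householder_mul_householder_mem [Nontrivial ι] {u v : EuclideanSpace ℝ ι}
    (hu : ‖u‖ = 1) (hv : ‖v‖ = 1) :
    householder (u : ι → ℝ) * householder (v : ι → ℝ) ∈
      connectedComponentIn (formGroup (1 : Matrix ι ι ℝ)) 1 := by
  have hrank : 1 < Module.rank ℝ (EuclideanSpace ℝ ι) := by
    rw [← Module.finrank_eq_rank, finrank_euclideanSpace]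
    exact_mod_cast Fintype.one_lt_card
  have hS := isPreconnected_sphere hrank (0 : EuclideanSpace ℝ ι) 1
  refine (hS.image (fun w => householder (w : ι → ℝ) * householder (v : ι → ℝ))
    (continuous_householder.matrix_mul continuous_const).continuousOn).subset_connectedComponentIn
    ⟨v, by simpa using hv, householder_mul_self (dotProduct_self_of_norm_eq_one hv)⟩ ?_
    ⟨u, by simpa using hu, rfl⟩
  rintro _ ⟨w, hw, rfl⟩
  exact mul_mem_formGroup (householder_mem (dotProduct_self_of_norm_eq_one (by simpa using hw)))
    (householder_mem (dotProduct_self_of_norm_eq_one hv))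

theorem toEuclideanLin_householder {u : EuclideanSpace ℝ ι} (hu : ‖u‖ = 1)
    (w : EuclideanSpace ℝ ι) :
    Matrix.toEuclideanLin (householder (u : ι → ℝ)) w = (ℝ ∙ u)ᗮ.reflection w := by
  rw [Submodule.reflection_orthogonal_apply, Submodule.reflection_singleton_apply, hu,
    Matrix.toLpLin_apply]
  ext i
  simp only [householder, Matrix.sub_mulVec, Matrix.one_mulVec, Matrix.smul_mulVec,
    Matrix.vecMulVec_mulVec, PiLp.inner_apply]
  simp [dotProduct, mul_comm]

/-- A product of reflections is in the identity component, or is so after composition with a fixed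
reflection. -/
theorem exists_matrix_of_reflections [Nontrivial ι] {u₀ : EuclideanSpace ℝ ι} (hu₀ : ‖u₀‖ = 1)
    (l : List (EuclideanSpace ℝ ι)) : ∃ k : Matrix ι ι ℝ,
      (∀ w, Matrix.toEuclideanLin k w = (l.map fun v => (ℝ ∙ v)ᗮ.reflection).prod w) ∧
      (k ∈ connectedComponentIn (formGroup (1 : Matrix ι ι ℝ)) 1 ∨
        householder (u₀ : ι → ℝ) * k ∈ connectedComponentIn (formGroup (1 : Matrix ι ι ℝ)) 1) := by
  induction l with
  | nil =>
    refine ⟨1, fun w => ?_, Or.inl (mem_connectedComponentIn one_mem_formGroup)⟩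
    simp
  | cons v l ih =>
    obtain ⟨k, hk, hk'⟩ := ih
    by_cases hv : v = 0
    · refine ⟨k, fun w => ?_, hk'⟩
      have h0 : ∀ w : EuclideanSpace ℝ ι, (ℝ ∙ v)ᗮ.reflection w = w := fun w =>
        Submodule.reflection_mem_subspace_eq_self
          (Submodule.mem_orthogonal_singleton_iff_inner_right.2 (by rw [hv, inner_zero_left]))
      rw [List.map_cons, List.prod_cons, hk]
      exact (h0 _).symm
    · let u : EuclideanSpace ℝ ι := ‖v‖⁻¹ • v
      have hv0 : ‖v‖ ≠ 0 := norm_ne_zero_iff.2 hv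
      have hu : ‖u‖ = 1 := by simp [u, norm_smul, hv0]
      have hspan : (ℝ ∙ v) = ℝ ∙ u :=
        (Submodule.span_singleton_smul_eq (IsUnit.mk0 _ (inv_ne_zero hv0)) v).symm
      refine ⟨householder (u : ι → ℝ) * k, fun w => ?_, ?_⟩
      · rw [List.map_cons, List.prod_cons]
        simp only [hspan]
        change _ = (ℝ ∙ u)ᗮ.reflection ((l.map fun v => (ℝ ∙ v)ᗮ.reflection).prod w)
        rw [← hk, ← toEuclideanLin_householder hu]
        simp [Matrix.toLpLin_apply]
      · rcases hk' with hk' | hk'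
        · right
          rw [← Matrix.mul_assoc]
          exact mul_mem_connectedComponentIn_formGroup (householder_mul_householder_mem hu₀ hu) hk'
        · left
          have := mul_mem_connectedComponentIn_formGroup
            (householder_mul_householder_mem hu hu₀) hk'
          rwa [Matrix.mul_assoc, ← Matrix.mul_assoc (householder (u₀ : ι → ℝ)),
            householder_mul_self (dotProduct_self_of_norm_eq_one hu₀), Matrix.one_mul] at this

theorem det_ne_zero_of_transpose_mul_self {k : Matrix ι ι ℝ} (hk : kᵀ * k = 1) : k.det ≠ 0 := by
  have := congrArg Matrix.det hk
  rw [Matrix.det_mul, Matrix.det_transpose, Matrix.det_one] at this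
  intro h0
  simp [h0] at this

theorem det_eq_one_of_pos {k : Matrix ι ι ℝ} (hk : kᵀ * k = 1) (hpos : 0 < k.det) : k.det = 1 := by
  have := congrArg Matrix.det hk
  rw [Matrix.det_mul, Matrix.det_transpose, Matrix.det_one] at this
  nlinarith

/-- `SO(m)` is contained in the identity component of `O(m)`: by the theorem of Cartan and Dieudonné,
its elements are products of an even number of reflections. -/
theorem specialOrthogonal_subset_connectedComponentIn [Nontrivial ι] {k : Matrix ι ι ℝ}
    (hk : kᵀ * k = 1) (hdet : 0 < k.det) :
    k ∈ connectedComponentIn (formGroup (1 : Matrix ι ι ℝ)) 1 := by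
  obtain ⟨i₀⟩ : Nonempty ι := inferInstance
  let u₀ : EuclideanSpace ℝ ι := EuclideanSpace.single i₀ 1
  have hu₀ : ‖u₀‖ = 1 := by simp [u₀]
  let φ₀ : EuclideanSpace ℝ ι →ₗᵢ[ℝ] EuclideanSpace ℝ ι :=
    LinearMap.isometryOfInner (Matrix.toEuclideanLin k) fun x y => by
      simp only [Matrix.toLpLin_apply, EuclideanSpace.inner_eq_star_dotProduct, star_trivial]
      rw [Matrix.dotProduct_mulVec, Matrix.vecMul_mulVec, hk, Matrix.vecMul_one]
  obtain ⟨l, -, hl⟩ := (φ₀.toLinearIsometryEquiv rfl).reflections_generate_dim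
  obtain ⟨k', hk', h⟩ := exists_matrix_of_reflections hu₀ l
  have hkk : k = k' := by
    apply Matrix.toEuclideanLin.injective
    ext w : 1
    rw [hk', ← hl]
    rfl
  subst hkk
  rcases h with h | h
  · exact h
  · exfalso
    have hpos := (isPreconnected_connectedComponentIn
      (x := (1 : Matrix ι ι ℝ)) (F := formGroup (1 : Matrix ι ι ℝ))).pos_of_ne_zero
      (f := Matrix.det) (Continuous.matrix_det continuous_id).continuousOn (fun x hx => by
        have hx' : x ∈ formGroup 1 := connectedComponentIn_subset _ _ hx
        change xᵀ * 1 * x = 1 at hx'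
        rw [Matrix.mul_one] at hx'
        exact det_ne_zero_of_transpose_mul_self hx')
      (mem_connectedComponentIn one_mem_formGroup) (by simp) _ h
    rw [Matrix.det_mul, det_householder (dotProduct_self_of_norm_eq_one hu₀)] at hpos
    linarith

/-- A property of `2 × 2` matrices of positive determinant that holds along preconnected sets through
`1` and is closed under multiplication holds for all of them. -/
theorem GLpos_two_induction (p : Matrix (Fin 2) (Fin 2) ℝ → Prop)
    (hconn : ∀ s : Set (Matrix (Fin 2) (Fin 2) ℝ), IsPreconnected s → 1 ∈ s →
      (∀ A ∈ s, 0 < A.det) → ∀ A ∈ s, p A)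
    (hmul : ∀ A B, 0 < A.det → 0 < B.det → p A → p B → p (A * B))
    (A : Matrix (Fin 2) (Fin 2) ℝ) (hA : 0 < A.det) : p A := by
  have key : ∀ B : Matrix (Fin 2) (Fin 2) ℝ, 0 < B.det → 0 ≤ B.trace → p B := by
    intro B hB htr
    refine hconn ((fun t : ℝ => (1 - t) • 1 + t • B) '' Set.Icc 0 1)
      (isPreconnected_Icc.image _ (by fun_prop)) ⟨0, by simp⟩ ?_ B ⟨1, by simp⟩
    rintro _ ⟨t, ⟨ht0, ht1⟩, rfl⟩
    simp only [Matrix.det_fin_two, Matrix.trace_fin_two, Matrix.add_apply, Matrix.smul_apply,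
      Matrix.one_apply, smul_eq_mul] at *
    norm_num
    -- the determinant is `(1 - t)² + t (1 - t) tr B + t² det B`
    rcases ht0.eq_or_lt with rfl | ht0
    · norm_num
    · nlinarith [mul_nonneg (mul_nonneg ht0.le (sub_nonneg.2 ht1)) htr, mul_pos (pow_pos ht0 2) hB,
        sq_nonneg (1 - t)]
  rcases le_total 0 A.trace with htr | htr
  · exact key A hA htr
  · -- `-1` is the square of a rotation by a right angle, which has trace zero
    let R : Matrix (Fin 2) (Fin 2) ℝ := !![0, -1; 1, 0]
    have hR : p R := key R (by simp [R]) (by simp [R, Matrix.trace_fin_two])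
    have hRd : 0 < R.det := by simp [R]
    have hA' : p (-A) := key (-A) (by simpa [Matrix.det_neg] using hA) (by simpa using htr)
    have hRR : R * (R * -A) = A := by
      rw [← Matrix.mul_assoc]
      have : R * R = -1 := by ext i j; fin_cases i <;> fin_cases j <;> simp [R]
      simp [this]
    rw [← hRR]
    have hd : 0 < (R * -A).det := by
      rw [Matrix.det_mul]; exact mul_pos hRd (by simpa [Matrix.det_neg] using hA)
    exact hmul _ _ hRd hd hR (hmul _ _ hRd (by simpa [Matrix.det_neg] using hA) hR hA')

end Connectedness

/-! ### The homogeneous model -/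

section HomogeneousModel

variable {n : ℕ}

/-- The inverse of the matrix of the isotropic basis. -/
noncomputable def tauInv (n : ℕ) : Matrix (Big n) (Big n) ℝ :=
  Matrix.fromBlocks ((1 / 2 : ℝ) • 1) (Matrix.fromCols ((1 / 2 : ℝ) • 1) 0)
    (Matrix.fromRows (-1) 0) (Matrix.fromBlocks 1 0 0 1)

/-- The bilinear form `h` in the isotropic basis. -/
def formTau (n : ℕ) : Matrix (Big n) (Big n) ℝ :=
  Matrix.fromBlocks 0 (Matrix.fromCols 1 0) (Matrix.fromRows 1 0) (Matrix.fromBlocks 0 0 0 1)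

theorem tauBasis_mul_tauInv : tauBasis n * tauInv n = 1 := by
  rw [tauBasis, tauInv, Matrix.fromBlocks_multiply, ← Matrix.fromBlocks_one]
  congr 1
  · simp only [Matrix.fromCols_mul_fromRows, Matrix.one_mul, Matrix.zero_mul, add_zero]
    ext i j; simp [Matrix.one_apply]; split_ifs <;> norm_num
  · ext i j; rcases j with j | j <;>
    simp
  · ext i j; rcases i with i | i <;>
    simp [Matrix.fromBlocks_mul_fromRows]
  · rw [Matrix.fromBlocks_multiply, Matrix.fromRows_mul, Matrix.one_mul, Matrix.zero_mul,
      ← Matrix.fromBlocks_one]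
    ext i j
    rcases i with i | i <;> rcases j with j | j <;> simp [Matrix.one_apply]
    split_ifs <;> norm_num

theorem isUnit_tauBasis_det : IsUnit (tauBasis n).det :=
  Matrix.isUnit_det_of_right_inverse tauBasis_mul_tauInv

theorem transpose_tauBasis_mul_formH : (tauBasis n)ᵀ * formH n * tauBasis n = formTau n := by
  rw [tauBasis, formH, formTau, Matrix.fromBlocks_transpose, Matrix.fromBlocks_multiply,
    Matrix.fromBlocks_multiply]
  congr 1
  · ext i j
    simp [Matrix.transpose_fromRows, Matrix.fromCols_mul_fromRows]
  · ext i j; rcases j with j | j <;>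
    simp [Matrix.transpose_fromRows, Matrix.fromCols_mul_fromBlocks, Matrix.one_apply]
    split_ifs <;> norm_num
  · ext i j; rcases i with i | i <;>
    simp [Matrix.transpose_fromCols, Matrix.fromBlocks_transpose, Matrix.fromBlocks_mul_fromRows,
      Matrix.one_apply]
    split_ifs <;> norm_num
  · ext i j
    rcases i with i | i <;> rcases j with j | j <;>
    simp [Matrix.transpose_fromCols, Matrix.fromBlocks_transpose, Matrix.fromBlocks_multiply,
      Matrix.one_apply]

/-- The columns `ε₁, …, ε_n` of the unit matrix. -/
def epsCol (n : ℕ) : Matrix (Idx n) (Fin n) ℝ := Matrix.fromRows 0 1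

theorem toBlocks₁₁_mul_tauBasis (g : Matrix (Big n) (Big n) ℝ) :
    (g * tauBasis n).toBlocks₁₁ = actDenom g (stiefelOrigin n) := by
  conv_lhs => rw [← Matrix.fromBlocks_toBlocks g, tauBasis, Matrix.fromBlocks_multiply]
  simp [actDenom, stiefelOrigin]

theorem toBlocks₂₁_mul_tauBasis (g : Matrix (Big n) (Big n) ℝ) :
    (g * tauBasis n).toBlocks₂₁ = g.toBlocks₂₁ + g.toBlocks₂₂ * stiefelOrigin n := by
  conv_lhs => rw [← Matrix.fromBlocks_toBlocks g, tauBasis, Matrix.fromBlocks_multiply]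
  simp [stiefelOrigin]

theorem gAct_stiefelOrigin (g : Matrix (Big n) (Big n) ℝ) :
    gAct g (stiefelOrigin n) = (g * tauBasis n).toBlocks₂₁ * ((g * tauBasis n).toBlocks₁₁)⁻¹ := by
  rw [toBlocks₁₁_mul_tauBasis, toBlocks₂₁_mul_tauBasis, gAct]

theorem frameMap_eq (g : Matrix (Big n) (Big n) ℝ) :
    frameMap g = ((g * tauBasis n).toBlocks₂₁ * ((g * tauBasis n).toBlocks₁₁)⁻¹,
      (g * tauBasis n).toBlocks₁₁,
      ((g * tauBasis n).toBlocks₂₂ - (g * tauBasis n).toBlocks₂₁ * ((g * tauBasis n).toBlocks₁₁)⁻¹ *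
        (g * tauBasis n).toBlocks₁₂) * epsCol n) := by
  have h1 : (g * tauBasis n).toBlocks₁₂ * epsCol n = g.toBlocks₁₂ * epsCol n := by
    conv_lhs => rw [← Matrix.fromBlocks_toBlocks g, tauBasis, Matrix.fromBlocks_multiply]
    rw [Matrix.toBlocks_fromBlocks₁₂, Matrix.add_mul, Matrix.mul_assoc, Matrix.mul_assoc, epsCol,
      Matrix.fromBlocks_mul_fromRows, Matrix.fromCols_mul_fromRows]
    simp
  have h2 : (g * tauBasis n).toBlocks₂₂ * epsCol n = g.toBlocks₂₂ * epsCol n := by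
    conv_lhs => rw [← Matrix.fromBlocks_toBlocks g, tauBasis, Matrix.fromBlocks_multiply]
    rw [Matrix.toBlocks_fromBlocks₂₂, Matrix.add_mul, Matrix.mul_assoc, Matrix.mul_assoc, epsCol,
      Matrix.fromBlocks_mul_fromRows, Matrix.fromCols_mul_fromRows]
    simp
  rw [frameMap, gAct_stiefelOrigin, ← toBlocks₁₁_mul_tauBasis, Matrix.sub_mul, Matrix.sub_mul]
  rw [Matrix.mul_assoc _ g.toBlocks₁₂, Matrix.mul_assoc _ (g * tauBasis n).toBlocks₁₂, h1, h2]
  rfl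

theorem toBlocks_of_mem_formGroup {g : Matrix (Big n) (Big n) ℝ} (hg : g ∈ formGroup (formH n)) :
    ((g * tauBasis n).toBlocks₂₁)ᵀ * (g * tauBasis n).toBlocks₂₁ =
      ((g * tauBasis n).toBlocks₁₁)ᵀ * (g * tauBasis n).toBlocks₁₁ ∧
    ((g * tauBasis n).toBlocks₂₁)ᵀ * (g * tauBasis n).toBlocks₂₂ -
      ((g * tauBasis n).toBlocks₁₁)ᵀ * (g * tauBasis n).toBlocks₁₂ = Matrix.fromCols 1 0 ∧
    ((g * tauBasis n).toBlocks₂₂)ᵀ * (g * tauBasis n).toBlocks₂₂ -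
      ((g * tauBasis n).toBlocks₁₂)ᵀ * (g * tauBasis n).toBlocks₁₂ =
        Matrix.fromBlocks 0 0 0 1 := by
  have h : (g * tauBasis n)ᵀ * formH n * (g * tauBasis n) = formTau n := by
    rw [← transpose_tauBasis_mul_formH]
    conv_rhs => rw [← show gᵀ * formH n * g = formH n from hg]
    rw [Matrix.transpose_mul]
    simp only [Matrix.mul_assoc]
  generalize g * tauBasis n = G at h
  rw [← Matrix.fromBlocks_toBlocks G, Matrix.fromBlocks_transpose, formH, formTau,
    Matrix.fromBlocks_multiply, Matrix.fromBlocks_multiply, Matrix.fromBlocks_inj] at h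
  simp only [Matrix.mul_zero, Matrix.mul_one, Matrix.mul_neg,
    Matrix.neg_mul, add_zero, zero_add] at h
  obtain ⟨h1, h2, -, h4⟩ := h
  exact ⟨by rw [neg_add_eq_zero] at h1; exact h1.symm, by rw [← h2]; abel, by rw [← h4]; abel⟩

/-- An isotropic plane is a graph over `[f₁, f₂]`. -/
theorem actDenom_det_ne_zero {g : Matrix (Big n) (Big n) ℝ} (hg : g ∈ formGroup (formH n)) :
    (actDenom g (stiefelOrigin n)).det ≠ 0 := by
  obtain ⟨h1, h2, -⟩ := toBlocks_of_mem_formGroup hg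
  rw [← toBlocks₁₁_mul_tauBasis]
  generalize g * tauBasis n = G at h1 h2
  intro h0
  obtain ⟨v, hv, hAv⟩ := Matrix.exists_mulVec_eq_zero_iff.2 h0
  have hBv : G.toBlocks₂₁ *ᵥ v = 0 := by
    have : (G.toBlocks₂₁ *ᵥ v) ⬝ᵥ (G.toBlocks₂₁ *ᵥ v) = 0 := by
      rw [Matrix.dotProduct_mulVec, Matrix.vecMul_mulVec, h1, ← Matrix.vecMul_mulVec, hAv,
        Matrix.zero_vecMul, zero_dotProduct]
    exact dotProduct_self_eq_zero.1 this
  have h3 := congrArg (fun M => Mᵀ *ᵥ v) h2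
  simp only [Matrix.transpose_sub, Matrix.transpose_mul, Matrix.transpose_transpose,
    Matrix.sub_mulVec, ← Matrix.mulVec_mulVec, hAv, hBv, Matrix.mulVec_zero, sub_zero,
    Matrix.transpose_fromCols, Matrix.transpose_one, Matrix.transpose_zero,
    Matrix.fromRows_mulVec, Matrix.one_mulVec] at h3
  apply hv
  ext i
  exact (congrFun h3 (Sum.inl i)).symm

/-- The total space `G / P₊`: orthonormal pairs `x`, a matrix `A` of positive determinant, and an
orthonormal frame `C` of the complement that completes `x` to an oriented basis. -/
def lieTotal (n : ℕ) :
    Set (Matrix (Idx n) (Fin 2) ℝ × Matrix (Fin 2) (Fin 2) ℝ × Matrix (Idx n) (Fin n) ℝ) :=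
  {u | u.1ᵀ * u.1 = 1 ∧ u.1ᵀ * u.2.2 = 0 ∧ u.2.2ᵀ * u.2.2 = 1 ∧ 0 < u.2.1.det ∧
    0 < (Matrix.fromCols u.1 u.2.2).det}

theorem frameMap_orthonormal {g : Matrix (Big n) (Big n) ℝ} (hg : g ∈ formGroup (formH n)) :
    (frameMap g).1ᵀ * (frameMap g).1 = 1 ∧ (frameMap g).1ᵀ * (frameMap g).2.2 = 0 ∧
      (frameMap g).2.2ᵀ * (frameMap g).2.2 = 1 := by
  have h0 := isUnit_iff_ne_zero.2 (actDenom_det_ne_zero hg)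
  rw [← toBlocks₁₁_mul_tauBasis] at h0
  obtain ⟨h1, h2, h3⟩ := toBlocks_of_mem_formGroup hg
  rw [frameMap_eq]
  generalize g * tauBasis n = G at h0 h1 h2 h3
  have hT : IsUnit (G.toBlocks₁₁ᵀ).det := by rwa [Matrix.det_transpose]
  have hxr : (G.toBlocks₂₁ * G.toBlocks₁₁⁻¹)ᵀ * G.toBlocks₂₂ * epsCol n =
      G.toBlocks₁₂ * epsCol n := by
    have : G.toBlocks₂₁ᵀ * G.toBlocks₂₂ * epsCol n = G.toBlocks₁₁ᵀ * G.toBlocks₁₂ * epsCol n := by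
      rw [← sub_eq_zero, ← Matrix.sub_mul, h2, epsCol, Matrix.fromCols_mul_fromRows]
      simp
    rw [Matrix.transpose_mul, Matrix.transpose_nonsing_inv, Matrix.mul_assoc, Matrix.mul_assoc,
      ← Matrix.mul_assoc _ _ (epsCol n), this, Matrix.mul_assoc, ← Matrix.mul_assoc,
      Matrix.nonsing_inv_mul _ hT, Matrix.one_mul]
  have hxx : (G.toBlocks₂₁ * G.toBlocks₁₁⁻¹)ᵀ * (G.toBlocks₂₁ * G.toBlocks₁₁⁻¹) = 1 := by
    rw [Matrix.transpose_mul, Matrix.mul_assoc, ← Matrix.mul_assoc _ G.toBlocks₂₁, h1,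
      Matrix.mul_assoc, Matrix.mul_nonsing_inv _ h0, Matrix.mul_one, Matrix.transpose_nonsing_inv,
      Matrix.nonsing_inv_mul _ hT]
  generalize G.toBlocks₂₁ * G.toBlocks₁₁⁻¹ = x at hxr hxx
  have hxC : xᵀ * ((G.toBlocks₂₂ - x * G.toBlocks₁₂) * epsCol n) = 0 := by
    rw [Matrix.sub_mul, Matrix.mul_sub, ← Matrix.mul_assoc, hxr, Matrix.mul_assoc x,
      ← Matrix.mul_assoc xᵀ x, hxx, Matrix.one_mul, sub_self]
  refine ⟨hxx, hxC, ?_⟩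
  have hCx : ((G.toBlocks₂₂ - x * G.toBlocks₁₂) * epsCol n)ᵀ * x = 0 := by
    have := congrArg Matrix.transpose hxC
    rwa [Matrix.transpose_mul, Matrix.transpose_transpose, Matrix.transpose_zero] at this
  have hr : (epsCol n)ᵀ * (G.toBlocks₂₂ᵀ * G.toBlocks₂₂) * epsCol n = 1 +
      (epsCol n)ᵀ * (G.toBlocks₁₂ᵀ * G.toBlocks₁₂) * epsCol n := by
    rw [← sub_eq_iff_eq_add, ← Matrix.sub_mul, ← Matrix.mul_sub, h3, epsCol,
      Matrix.transpose_fromRows, Matrix.fromCols_mul_fromBlocks, Matrix.fromCols_mul_fromRows]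
    simp
  change ((G.toBlocks₂₂ - x * G.toBlocks₁₂) * epsCol n)ᵀ *
    ((G.toBlocks₂₂ - x * G.toBlocks₁₂) * epsCol n) = 1
  conv_lhs => rw [Matrix.sub_mul, Matrix.mul_sub, Matrix.mul_assoc x, ← Matrix.mul_assoc _ x]
  have hCx' := hCx
  rw [Matrix.sub_mul, Matrix.mul_assoc x] at hCx'
  rw [hCx', Matrix.zero_mul, sub_zero, Matrix.transpose_sub, Matrix.sub_mul]
  have e1 : (G.toBlocks₂₂ * epsCol n)ᵀ * (G.toBlocks₂₂ * epsCol n) =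
      (epsCol n)ᵀ * (G.toBlocks₂₂ᵀ * G.toBlocks₂₂) * epsCol n := by
    rw [Matrix.transpose_mul]; simp only [Matrix.mul_assoc]
  have e2 : (x * (G.toBlocks₁₂ * epsCol n))ᵀ * (G.toBlocks₂₂ * epsCol n) =
      (epsCol n)ᵀ * (G.toBlocks₁₂ᵀ * G.toBlocks₁₂) * epsCol n := by
    rw [Matrix.transpose_mul, Matrix.transpose_mul, Matrix.mul_assoc, Matrix.mul_assoc,
      ← Matrix.mul_assoc xᵀ, hxr]
    simp only [Matrix.mul_assoc]
  rw [e1, e2, hr, add_sub_cancel_right]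

theorem transpose_mul_fromCols {x : Matrix (Idx n) (Fin 2) ℝ} {C : Matrix (Idx n) (Fin n) ℝ}
    (hx : xᵀ * x = 1) (hxC : xᵀ * C = 0) (hC : Cᵀ * C = 1) :
    (Matrix.fromCols x C)ᵀ * Matrix.fromCols x C = 1 := by
  have hCx : Cᵀ * x = 0 := by
    have := congrArg Matrix.transpose hxC
    rwa [Matrix.transpose_mul, Matrix.transpose_transpose, Matrix.transpose_zero] at this
  rw [Matrix.transpose_fromCols, Matrix.fromRows_mul_fromCols, hx, hxC, hC, hCx,
    Matrix.fromBlocks_one]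

theorem frameMap_mem_lieTotal {g : Matrix (Big n) (Big n) ℝ} (hg : g ∈ groupG n) :
    frameMap g ∈ lieTotal n := by
  have hsub : ∀ g ∈ groupG n, g ∈ formGroup (formH n) := fun g hg =>
    connectedComponentIn_subset _ _ hg
  obtain ⟨h1, h2, h3⟩ := frameMap_orthonormal (hsub g hg)
  have hone : (1 : Matrix (Big n) (Big n) ℝ) ∈ groupG n :=
    mem_connectedComponentIn one_mem_formGroup
  have hconn : IsPreconnected (groupG n) := isPreconnected_connectedComponentIn
  have hcG : Continuous fun g : Matrix (Big n) (Big n) ℝ => g * tauBasis n := by fun_prop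
  have hb : ∀ i j, Continuous fun g : Matrix (Big n) (Big n) ℝ => (g * tauBasis n) i j :=
    fun i j => hcG.matrix_elem i j
  have c11 : Continuous fun g : Matrix (Big n) (Big n) ℝ => (g * tauBasis n).toBlocks₁₁ :=
    continuous_matrix fun i j => hb _ _
  have c12 : Continuous fun g : Matrix (Big n) (Big n) ℝ => (g * tauBasis n).toBlocks₁₂ :=
    continuous_matrix fun i j => hb _ _
  have c21 : Continuous fun g : Matrix (Big n) (Big n) ℝ => (g * tauBasis n).toBlocks₂₁ :=
    continuous_matrix fun i j => hb _ _
  have c22 : Continuous fun g : Matrix (Big n) (Big n) ℝ => (g * tauBasis n).toBlocks₂₂ :=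
    continuous_matrix fun i j => hb _ _
  have cinv : ContinuousOn (fun g : Matrix (Big n) (Big n) ℝ => ((g * tauBasis n).toBlocks₁₁)⁻¹)
      (groupG n) := by
    have h := (contDiffOn_id (𝕜 := ℝ) (n := 0) (s := {A : Matrix (Fin 2) (Fin 2) ℝ | A.det ≠ 0})).matrix_inv
      fun A hA => hA
    refine h.continuousOn.comp c11.continuousOn fun g hg => ?_
    change (g * tauBasis n).toBlocks₁₁.det ≠ 0
    rw [toBlocks₁₁_mul_tauBasis]
    exact actDenom_det_ne_zero (hsub g hg)
  have cx : ContinuousOn (fun g : Matrix (Big n) (Big n) ℝ =>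
      (g * tauBasis n).toBlocks₂₁ * ((g * tauBasis n).toBlocks₁₁)⁻¹) (groupG n) :=
    (continuous_fst.matrix_mul continuous_snd).comp_continuousOn (c21.continuousOn.prodMk cinv)
  have cC : ContinuousOn (fun g : Matrix (Big n) (Big n) ℝ =>
      ((g * tauBasis n).toBlocks₂₂ - (g * tauBasis n).toBlocks₂₁ * ((g * tauBasis n).toBlocks₁₁)⁻¹ *
        (g * tauBasis n).toBlocks₁₂) * epsCol n) (groupG n) := by
    refine (continuous_fst.matrix_mul continuous_snd).comp_continuousOn
      (ContinuousOn.prodMk (c22.continuousOn.sub ?_) continuousOn_const)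
    exact (continuous_fst.matrix_mul continuous_snd).comp_continuousOn (cx.prodMk c12.continuousOn)
  refine ⟨h1, h2, h3, ?_, ?_⟩
  · refine hconn.pos_of_ne_zero (f := fun g => (frameMap g).2.1.det) ?_ ?_ hone ?_ g hg
    · simp only [frameMap_eq]
      exact (Continuous.matrix_det c11).continuousOn
    · exact fun g hg => actDenom_det_ne_zero (hsub g hg)
    · have : actDenom (1 : Matrix (Big n) (Big n) ℝ) (stiefelOrigin n) = 1 := by
        rw [← Matrix.fromBlocks_one, actDenom, Matrix.toBlocks_fromBlocks₁₁,
          Matrix.toBlocks_fromBlocks₁₂, Matrix.zero_mul, add_zero]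
      simp only [frameMap, this, Matrix.det_one, zero_lt_one]
  · refine hconn.pos_of_ne_zero (f := fun g => (Matrix.fromCols (frameMap g).1 (frameMap g).2.2).det)
      ?_ ?_ hone ?_ g hg
    · simp only [frameMap_eq]
      refine (Continuous.matrix_det continuous_id).comp_continuousOn ?_
      refine continuousOn_pi.2 fun i => continuousOn_pi.2 fun j => ?_
      rcases j with j | j
      · exact (continuous_id.matrix_elem i j).comp_continuousOn cx
      · exact (continuous_id.matrix_elem i j).comp_continuousOn cC
    · intro g hg
      obtain ⟨h1, h2, h3⟩ := frameMap_orthonormal (hsub g hg)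
      exact det_ne_zero_of_transpose_mul_self (transpose_mul_fromCols h1 h2 h3)
    · have : Matrix.fromCols (frameMap (1 : Matrix (Big n) (Big n) ℝ)).1
          (frameMap (1 : Matrix (Big n) (Big n) ℝ)).2.2 = 1 := by
        rw [← Matrix.fromBlocks_one]
        simp only [frameMap, gAct, actDenom, Matrix.toBlocks_fromBlocks₁₁,
          Matrix.toBlocks_fromBlocks₁₂, Matrix.toBlocks_fromBlocks₂₁, Matrix.toBlocks_fromBlocks₂₂]
        ext i j
        rcases i with i | i <;> rcases j with j | j <;> simp [stiefelOrigin, Matrix.one_apply]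
      simp only [this, Matrix.det_one, zero_lt_one]

end HomogeneousModel

section HomogeneousModel

variable {n : ℕ}

/-- The matrix of `leviElement a` in the isotropic basis. -/
noncomputable def leviTau (a : Matrix (Fin 2) (Fin 2) ℝ × Matrix (Fin n) (Fin n) ℝ) :
    Matrix (Big n) (Big n) ℝ :=
  Matrix.fromBlocks a.1 0 0 (Matrix.fromBlocks ((a.1⁻¹)ᵀ) 0 0 a.2)

theorem leviElement_mul_tauBasis (a : Matrix (Fin 2) (Fin 2) ℝ × Matrix (Fin n) (Fin n) ℝ) :
    leviElement a * tauBasis n = tauBasis n * leviTau a := by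
  rw [leviElement, Matrix.mul_assoc, Matrix.nonsing_inv_mul _ isUnit_tauBasis_det, Matrix.mul_one]
  rfl

theorem leviElement_mul (a b : Matrix (Fin 2) (Fin 2) ℝ × Matrix (Fin n) (Fin n) ℝ) :
    leviElement (a * b) = leviElement a * leviElement b := by
  have h : leviTau (a * b) = leviTau a * leviTau b := by
    simp only [leviTau, Matrix.fromBlocks_multiply, Prod.fst_mul, Prod.snd_mul, Matrix.mul_inv_rev,
      Matrix.transpose_mul, Matrix.mul_zero, Matrix.zero_mul, add_zero, zero_add]
  change tauBasis n * leviTau (a * b) * _ = tauBasis n * leviTau a * _ * (tauBasis n * leviTau b * _)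
  rw [h]
  simp only [Matrix.mul_assoc]
  rw [← Matrix.mul_assoc (tauBasis n)⁻¹ (tauBasis n),
    Matrix.nonsing_inv_mul _ isUnit_tauBasis_det, Matrix.one_mul]

theorem leviElement_one :
    leviElement (1 : Matrix (Fin 2) (Fin 2) ℝ × Matrix (Fin n) (Fin n) ℝ) = 1 := by
  simp only [leviElement, Prod.fst_one, Prod.snd_one, inv_one, Matrix.transpose_one,
    Matrix.fromBlocks_one, Matrix.mul_one]
  exact Matrix.mul_nonsing_inv _ isUnit_tauBasis_det

theorem leviElement_mem_formGroup {a : Matrix (Fin 2) (Fin 2) ℝ × Matrix (Fin n) (Fin n) ℝ}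
    (h1 : a.1.det ≠ 0) (h2 : a.2ᵀ * a.2 = 1) : leviElement a ∈ formGroup (formH n) := by
  have hu := isUnit_iff_ne_zero.2 h1
  have hT : IsUnit (a.1ᵀ).det := by rwa [Matrix.det_transpose]
  have hK : (leviTau a)ᵀ * formTau n * leviTau a = formTau n := by
    simp only [leviTau, formTau, Matrix.fromBlocks_transpose, Matrix.transpose_zero,
      Matrix.transpose_transpose]
    rw [Matrix.fromBlocks_multiply, Matrix.fromBlocks_multiply]
    congr 1
    · simp
    · simp only [Matrix.mul_fromCols, Matrix.fromCols_mul_fromBlocks, Matrix.zero_mul,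
        Matrix.mul_zero, Matrix.mul_one, add_zero, Matrix.transpose_nonsing_inv]
      rw [Matrix.mul_nonsing_inv _ hT]; simp
    · simp only [Matrix.fromBlocks_mul_fromRows, Matrix.fromRows_mul, Matrix.zero_mul,
        Matrix.mul_zero, Matrix.mul_one, add_zero, zero_add]
      rw [Matrix.nonsing_inv_mul _ hu]
    · simp [Matrix.fromBlocks_multiply, h2]
  have hG : (tauBasis n)ᵀ * ((leviElement a)ᵀ * formH n * leviElement a) * tauBasis n =
      (tauBasis n)ᵀ * formH n * tauBasis n := by
    calc _ = (leviElement a * tauBasis n)ᵀ * formH n * (leviElement a * tauBasis n) := by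
          rw [Matrix.transpose_mul]; simp only [Matrix.mul_assoc]
      _ = (leviTau a)ᵀ * ((tauBasis n)ᵀ * formH n * tauBasis n) * leviTau a := by
          rw [leviElement_mul_tauBasis, Matrix.transpose_mul]; simp only [Matrix.mul_assoc]
      _ = _ := by rw [transpose_tauBasis_mul_formH, hK]
  have hτ : IsUnit (tauBasis n) := (Matrix.isUnit_iff_isUnit_det _).2 isUnit_tauBasis_det
  have hτT : IsUnit (tauBasis n)ᵀ := (Matrix.isUnit_iff_isUnit_det _).2
    (by rw [Matrix.det_transpose]; exact isUnit_tauBasis_det)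
  have := hτ.mul_right_cancel hG
  exact hτT.mul_left_cancel this

/-- `SO(n+2)` is contained in the identity component of `O(h)`. -/
theorem fromBlocks_one_mem_groupG {k : Matrix (Idx n) (Idx n) ℝ} (hk : kᵀ * k = 1)
    (hdet : 0 < k.det) : Matrix.fromBlocks 1 0 0 k ∈ groupG n := by
  have : Nontrivial (Idx n) := ⟨Sum.inl 0, Sum.inl 1, by simp⟩
  have hc := isPreconnected_connectedComponentIn (x := (1 : Matrix (Idx n) (Idx n) ℝ))
    (F := formGroup (1 : Matrix (Idx n) (Idx n) ℝ))
  refine (hc.image (fun k => (Matrix.fromBlocks 1 0 0 k : Matrix (Big n) (Big n) ℝ))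
    (Continuous.matrix_fromBlocks continuous_const continuous_const continuous_const
      continuous_id).continuousOn).subset_connectedComponentIn
    ⟨1, mem_connectedComponentIn one_mem_formGroup, Matrix.fromBlocks_one⟩ ?_
    ⟨k, specialOrthogonal_subset_connectedComponentIn hk hdet, rfl⟩
  rintro _ ⟨m, hm, rfl⟩
  have hm' : mᵀ * 1 * m = 1 := by
    have : m ∈ formGroup 1 := connectedComponentIn_subset _ _ hm
    exact this
  change _ᵀ * _ * _ = _
  rw [formH, Matrix.fromBlocks_transpose, Matrix.fromBlocks_multiply, Matrix.fromBlocks_multiply]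
  rw [Matrix.mul_one] at hm'
  simp [hm']

theorem transpose_mul_self_of_mem_SO {ι : Type} [Fintype ι] [DecidableEq ι] {B : Matrix ι ι ℝ}
    (hB : B ∈ Matrix.specialOrthogonalGroup ι ℝ) : Bᵀ * B = 1 ∧ B * Bᵀ = 1 ∧ B.det = 1 := by
  rw [Matrix.mem_specialOrthogonalGroup_iff] at hB
  exact ⟨(Matrix.mem_orthogonalGroup_iff' _ _).1 hB.1, (Matrix.mem_orthogonalGroup_iff _ _).1 hB.1,
    hB.2⟩

theorem mem_SO_iff {ι : Type} [Fintype ι] [DecidableEq ι] {B : Matrix ι ι ℝ} :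
    B ∈ Matrix.specialOrthogonalGroup ι ℝ ↔ Bᵀ * B = 1 ∧ 0 < B.det := by
  constructor
  · intro h
    obtain ⟨h1, -, h2⟩ := transpose_mul_self_of_mem_SO h
    exact ⟨h1, h2 ▸ zero_lt_one⟩
  · rintro ⟨h1, h2⟩
    rw [Matrix.mem_specialOrthogonalGroup_iff]
    exact ⟨(Matrix.mem_orthogonalGroup_iff' _ _).2 h1, det_eq_one_of_pos h1 h2⟩

theorem continuousOn_leviElement {s : Set (Matrix (Fin 2) (Fin 2) ℝ)} (hs : ∀ A ∈ s, 0 < A.det) :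
    ContinuousOn (fun A : Matrix (Fin 2) (Fin 2) ℝ =>
      leviElement (A, (1 : Matrix (Fin n) (Fin n) ℝ))) s := by
  have hinv : ContinuousOn (fun A : Matrix (Fin 2) (Fin 2) ℝ => A⁻¹) s :=
    ((contDiffOn_id (𝕜 := ℝ) (n := 0)).matrix_inv fun A hA => (hs A hA).ne').continuousOn
  have h : ContinuousOn (fun A : Matrix (Fin 2) (Fin 2) ℝ =>
      leviTau (A, (1 : Matrix (Fin n) (Fin n) ℝ))) s := by
    refine continuousOn_pi.2 fun i => continuousOn_pi.2 fun j => ?_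
    rcases i with i | i | i <;> rcases j with j | j | j
    · exact (continuous_id.matrix_elem i j).continuousOn
    · exact continuousOn_const
    · exact continuousOn_const
    · exact continuousOn_const
    · exact (continuous_id.matrix_elem j i).comp_continuousOn hinv
    · exact continuousOn_const
    · exact continuousOn_const
    · exact continuousOn_const
    · exact continuousOn_const
  exact ((continuous_const.matrix_mul continuous_id).matrix_mul continuous_const).comp_continuousOn h

theorem leviElement_mem_groupG {a : Matrix (Fin 2) (Fin 2) ℝ × Matrix (Fin n) (Fin n) ℝ}
    (ha : a ∈ G0 n) : leviElement a ∈ groupG n := by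
  obtain ⟨h1, h2⟩ := ha
  obtain ⟨hB, -, hBd⟩ := transpose_mul_self_of_mem_SO h2
  have ha' : a = (a.1, 1) * (1, a.2) := by ext <;> simp
  rw [ha', leviElement_mul]
  refine mul_mem_connectedComponentIn_formGroup ?_ ?_
  · refine GLpos_two_induction (fun A => leviElement (A, (1 : Matrix (Fin n) (Fin n) ℝ)) ∈
      connectedComponentIn (formGroup (formH n)) 1) ?_ ?_ a.1 h1
    · intro s hs h1s hdet A hA
      have hcont := continuousOn_leviElement (n := n) hdet
      refine (hs.image _ hcont).subset_connectedComponentIn ⟨1, h1s, leviElement_one⟩ ?_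
        ⟨A, hA, rfl⟩
      rintro _ ⟨B, hB, rfl⟩
      exact leviElement_mem_formGroup (hdet B hB).ne' (by simp)
    · intro A B _ _ hA hB
      have h := mul_mem_connectedComponentIn_formGroup hA hB
      rw [← leviElement_mul] at h
      simpa using h
  · have h : leviElement ((1 : Matrix (Fin 2) (Fin 2) ℝ), a.2) =
        Matrix.fromBlocks 1 0 0 (Matrix.fromBlocks 1 0 0 a.2) := by
      have hτ : (Matrix.fromBlocks 1 0 0 (Matrix.fromBlocks 1 0 0 a.2)) * tauBasis n =
          tauBasis n * leviTau (1, a.2) := by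
        simp [tauBasis, leviTau, Matrix.fromBlocks_multiply, Matrix.fromCols_mul_fromBlocks,
          Matrix.fromBlocks_mul_fromRows]
      change tauBasis n * leviTau (1, a.2) * _ = _
      rw [← hτ, Matrix.mul_assoc, Matrix.mul_nonsing_inv _ isUnit_tauBasis_det, Matrix.mul_one]
    rw [h]
    refine fromBlocks_one_mem_groupG ?_ ?_
    · rw [Matrix.fromBlocks_transpose, Matrix.fromBlocks_multiply]
      simp [hB]
    · rw [Matrix.det_fromBlocks_zero₂₁, hBd]; simp

theorem frameMap_mul_leviElement {g : Matrix (Big n) (Big n) ℝ}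
    {a : Matrix (Fin 2) (Fin 2) ℝ × Matrix (Fin n) (Fin n) ℝ} (ha : a.1.det ≠ 0) :
    frameMap (g * leviElement a) = (homogeneousLieContact n).act (frameMap g) a := by
  change _ = ((frameMap g).1, (frameMap g).2.1 * a.1, (frameMap g).2.2 * a.2)
  have hu := isUnit_iff_ne_zero.2 ha
  rw [frameMap_eq, frameMap_eq, Matrix.mul_assoc, leviElement_mul_tauBasis, ← Matrix.mul_assoc]
  generalize g * tauBasis n = G
  have hG : G * leviTau a = Matrix.fromBlocks (G.toBlocks₁₁ * a.1)
      (G.toBlocks₁₂ * Matrix.fromBlocks ((a.1⁻¹)ᵀ) 0 0 a.2) (G.toBlocks₂₁ * a.1)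
      (G.toBlocks₂₂ * Matrix.fromBlocks ((a.1⁻¹)ᵀ) 0 0 a.2) := by
    conv_lhs => rw [← Matrix.fromBlocks_toBlocks G, leviTau, Matrix.fromBlocks_multiply]
    simp
  have hε : Matrix.fromBlocks ((a.1⁻¹)ᵀ) 0 0 a.2 * epsCol n = epsCol n * a.2 := by
    rw [epsCol, Matrix.fromBlocks_mul_fromRows, Matrix.fromRows_mul]; simp
  have hx : G.toBlocks₂₁ * a.1 * (G.toBlocks₁₁ * a.1)⁻¹ = G.toBlocks₂₁ * G.toBlocks₁₁⁻¹ := by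
    rw [Matrix.mul_inv_rev, Matrix.mul_assoc, ← Matrix.mul_assoc a.1, Matrix.mul_nonsing_inv _ hu,
      Matrix.one_mul]
  rw [hG]
  simp only [Matrix.toBlocks_fromBlocks₁₁, Matrix.toBlocks_fromBlocks₁₂,
    Matrix.toBlocks_fromBlocks₂₁, Matrix.toBlocks_fromBlocks₂₂, hx]
  refine Prod.ext rfl (Prod.ext rfl ?_)
  change _ = _ * epsCol n * a.2
  rw [Matrix.mul_assoc _ (epsCol n) a.2, ← hε, ← Matrix.mul_assoc _ _ (epsCol n)]
  simp only [Matrix.sub_mul, Matrix.mul_assoc]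

theorem frameMap_fromBlocks_one (x : Matrix (Idx n) (Fin 2) ℝ) (C : Matrix (Idx n) (Fin n) ℝ) :
    frameMap (Matrix.fromBlocks 1 0 0 (Matrix.fromCols x C)) = (x, 1, C) := by
  have h1 : Matrix.fromCols x C * stiefelOrigin n = x := by
    rw [stiefelOrigin, Matrix.fromCols_mul_fromRows]; simp
  have h2 : Matrix.fromCols x C * (Matrix.fromRows 0 1 : Matrix (Idx n) (Fin n) ℝ) = C := by
    rw [Matrix.fromCols_mul_fromRows]; simp
  simp only [frameMap, gAct, actDenom, Matrix.toBlocks_fromBlocks₁₁, Matrix.toBlocks_fromBlocks₁₂,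
    Matrix.toBlocks_fromBlocks₂₁, Matrix.toBlocks_fromBlocks₂₂, Matrix.zero_mul, add_zero, zero_add,
    h1, inv_one, Matrix.mul_one, Matrix.mul_zero, sub_zero, h2]

/-- `G / P₊` is the space of adapted frames. -/
theorem frameMap_image : frameMap '' groupG n = lieTotal n := by
  apply Set.Subset.antisymm
  · rintro _ ⟨g, hg, rfl⟩
    exact frameMap_mem_lieTotal hg
  · rintro ⟨x, A, C⟩ ⟨h1, h2, h3, h4, h5⟩
    have ha : (A, (1 : Matrix (Fin n) (Fin n) ℝ)) ∈ G0 n := ⟨h4, Submonoid.one_mem _⟩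
    refine ⟨_, mul_mem_connectedComponentIn_formGroup
      (fromBlocks_one_mem_groupG (transpose_mul_fromCols h1 h2 h3) h5) (leviElement_mem_groupG ha), ?_⟩
    rw [frameMap_mul_leviElement h4.ne', frameMap_fromBlocks_one]
    change (x, 1 * A, C * 1) = _
    simp

/-- An orthonormal pair can be completed to an oriented orthonormal basis. -/
theorem exists_completion (hn : 0 < n) {x : Matrix (Idx n) (Fin 2) ℝ} (hx : x ∈ stiefel n) :
    ∃ C : Matrix (Idx n) (Fin n) ℝ, xᵀ * C = 0 ∧ Cᵀ * C = 1 ∧ 0 < (Matrix.fromCols x C).det := by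
  have hx' : xᵀ * x = 1 := hx
  let v : Idx n → EuclideanSpace ℝ (Idx n) :=
    Sum.elim (fun j => WithLp.toLp 2 fun i => x i j) fun _ => 0
  have hv : Orthonormal ℝ ((Set.range (Sum.inl : Fin 2 → Idx n)).domRestrict v) := by
    rw [orthonormal_iff_ite]
    rintro ⟨_, i, rfl⟩ ⟨_, j, rfl⟩
    have := congrFun (congrFun hx' i) j
    simp only [Matrix.mul_apply, Matrix.transpose_apply, Matrix.one_apply] at this
    simp only [Set.domRestrict_apply, v, Sum.elim_inl, PiLp.inner_apply]
    refine Eq.trans ?_ (this.trans (if_congr (by simp [Subtype.ext_iff]) rfl rfl))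
    exact Finset.sum_congr rfl fun k _ => by simp [mul_comm]
  obtain ⟨b, hb⟩ := hv.exists_orthonormalBasis_extension_of_card_eq (by simp)
  let C : Matrix (Idx n) (Fin n) ℝ := Matrix.of fun i j => b (Sum.inr j) i
  have hk : (Matrix.fromCols x C)ᵀ * Matrix.fromCols x C = 1 := by
    have hcol : ∀ i j, Matrix.fromCols x C i j = b j i := by
      rintro i (j | j)
      · rw [hb _ ⟨j, rfl⟩]; rfl
      · rfl
    ext i j
    have := b.inner_eq_ite i j
    rw [PiLp.inner_apply] at this
    rw [Matrix.mul_apply, Matrix.one_apply, ← this]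
    exact Finset.sum_congr rfl fun k _ => by simp [hcol, mul_comm]
  have hk' := hk
  rw [Matrix.transpose_fromCols, Matrix.fromRows_mul_fromCols, ← Matrix.fromBlocks_one,
    Matrix.fromBlocks_inj] at hk'
  obtain ⟨-, h2, -, h3⟩ := hk'
  rcases lt_or_gt_of_ne (det_ne_zero_of_transpose_mul_self hk) with hneg | hpos
  · -- reverse the first vector of the frame `C`
    let D : Matrix (Fin n) (Fin n) ℝ := Matrix.diagonal fun j => if j = ⟨0, hn⟩ then -1 else 1
    have hD : Dᵀ * D = 1 := by
      rw [Matrix.diagonal_transpose, Matrix.diagonal_mul_diagonal, ← Matrix.diagonal_one]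
      congr 1; ext j; split_ifs <;> norm_num
    have hDd : D.det = -1 := by
      rw [Matrix.det_diagonal, Finset.prod_ite_eq']; simp
    refine ⟨C * D, by rw [← Matrix.mul_assoc, h2, Matrix.zero_mul], ?_, ?_⟩
    · rw [Matrix.transpose_mul, Matrix.mul_assoc, ← Matrix.mul_assoc Cᵀ, h3, Matrix.one_mul, hD]
    · have : Matrix.fromCols x (C * D) = Matrix.fromCols x C * Matrix.fromBlocks 1 0 0 D := by
        rw [Matrix.fromCols_mul_fromBlocks]; simp
      rw [this, Matrix.det_mul, Matrix.det_fromBlocks_zero₂₁, hDd, Matrix.det_one]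
      linarith
  · exact ⟨C, h2, h3, hpos⟩

theorem hasDerivAt_gAct_exp {g Z : Matrix (Big n) (Big n) ℝ} (hg : g ∈ formGroup (formH n)) :
    HasDerivAt (fun t : ℝ => gAct (g * NormedSpace.exp (t • Z)) (stiefelOrigin n))
      (((g * Z * tauBasis n).toBlocks₂₁ - (frameMap g).1 * (g * Z * tauBasis n).toBlocks₁₁) *
        (frameMap g).2.1⁻¹) 0 := by
  have h0 := actDenom_det_ne_zero hg
  rw [← toBlocks₁₁_mul_tauBasis] at h0
  have h1 : HasDerivAt (fun t : ℝ => g * NormedSpace.exp (t • Z) * tauBasis n)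
      (g * Z * tauBasis n) 0 := by
    have := (HasDerivAt.matrix_mul (hasDerivAt_const (0 : ℝ) g) (hasDerivAt_exp_smul_zero Z)).matrix_mul
      (hasDerivAt_const (0 : ℝ) (tauBasis n))
    simpa using this
  have h21 : HasDerivAt (fun t : ℝ => (g * NormedSpace.exp (t • Z) * tauBasis n).toBlocks₂₁)
      (g * Z * tauBasis n).toBlocks₂₁ 0 := .of_matrix_entry fun i j => h1.matrix_entry _ _
  have h11 : HasDerivAt (fun t : ℝ => (g * NormedSpace.exp (t • Z) * tauBasis n).toBlocks₁₁)
      (g * Z * tauBasis n).toBlocks₁₁ 0 := .of_matrix_entry fun i j => h1.matrix_entry _ _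
  have h := h21.matrix_mul_inv h11 (by simpa using h0)
  simp only [gAct_stiefelOrigin, frameMap_eq]
  simpa using h

theorem toBlocks_mul_lieNeg (g : Matrix (Big n) (Big n) ℝ) (Y : Matrix (Fin 2) (Fin 2) ℝ)
    (X : Matrix (Fin n) (Fin 2) ℝ) :
    (g * lieNeg Y X * tauBasis n).toBlocks₂₁ = (g * tauBasis n).toBlocks₂₂ * Matrix.fromRows Y X ∧
    (g * lieNeg Y X * tauBasis n).toBlocks₁₁ = (g * tauBasis n).toBlocks₁₂ * Matrix.fromRows Y X := by
  have h : g * lieNeg Y X * tauBasis n = g * tauBasis n *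
      Matrix.fromBlocks 0 0 (Matrix.fromRows Y X) (Matrix.fromBlocks 0 (-Xᵀ) 0 0) := by
    rw [lieNeg]
    simp only [Matrix.mul_assoc]
    rw [Matrix.nonsing_inv_mul _ isUnit_tauBasis_det, Matrix.mul_one]
  rw [h]
  generalize g * tauBasis n = G
  have h' := Matrix.fromBlocks_multiply G.toBlocks₁₁ G.toBlocks₁₂ G.toBlocks₂₁ G.toBlocks₂₂ 0
    (0 : Matrix (Fin 2) (Idx n) ℝ) (Matrix.fromRows Y X) (Matrix.fromBlocks 0 (-Xᵀ) 0 0)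
  rw [Matrix.fromBlocks_toBlocks] at h'
  rw [h']
  simp

theorem isHomogeneousModel (hn : 0 < n) : IsHomogeneousModel n where
  transitive x := by
    constructor
    · intro hx
      obtain ⟨C, h1, h2, h3⟩ := exists_completion hn hx
      refine ⟨_, fromBlocks_one_mem_groupG (transpose_mul_fromCols hx h1 h2) h3, ?_⟩
      exact congrArg Prod.fst (frameMap_fromBlocks_one x C)
    · rintro ⟨g, hg, rfl⟩
      exact (frameMap_mem_lieTotal hg).1
  levi_mem a ha := leviElement_mem_groupG ha
  act_eq g hg a ha := frameMap_mul_leviElement ha.1.ne'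
  frameOne_eq g hg X := by
    have h := hasDerivAt_gAct_exp (Z := lieNeg 0 X) (connectedComponentIn_subset _ _ hg)
    convert h using 1
    rw [(toBlocks_mul_lieNeg g 0 X).1, (toBlocks_mul_lieNeg g 0 X).2]
    change (frameMap g).2.2 * X * (frameMap g).2.1⁻¹ = _
    have hX : Matrix.fromRows 0 X = epsCol n * X := by
      rw [epsCol, Matrix.fromRows_mul]; simp
    rw [hX, frameMap_eq]
    simp only [Matrix.sub_mul, Matrix.mul_assoc]
  frameTwo_eq g hg Y := by
    have hg' : g ∈ formGroup (formH n) := connectedComponentIn_subset _ _ hg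
    refine ⟨_, hasDerivAt_gAct_exp (Z := lieNeg (Y : Matrix (Fin 2) (Fin 2) ℝ) 0) hg', ?_⟩
    change (frameMap g).1ᵀ * (_ - (frameMap g).1 * (((frameMap g).2.1⁻¹)ᵀ *
      (Y : Matrix (Fin 2) (Fin 2) ℝ) * (frameMap g).2.1⁻¹)) = 0
    rw [(toBlocks_mul_lieNeg g Y 0).1, (toBlocks_mul_lieNeg g Y 0).2, Matrix.mul_sub]
    have hxx := (frameMap_mem_lieTotal hg).1
    rw [← Matrix.mul_assoc _ (frameMap g).1 ((_ : Matrix (Fin 2) (Fin 2) ℝ) * _), hxx,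
      Matrix.one_mul, ← Matrix.mul_assoc, ← Matrix.sub_mul, Matrix.mul_sub,
      ← Matrix.mul_assoc _ _ (_ * _),
      hxx, Matrix.one_mul, ← Matrix.mul_assoc, ← Matrix.sub_mul]
    have h0 := actDenom_det_ne_zero hg'
    rw [← toBlocks₁₁_mul_tauBasis] at h0
    have hT : IsUnit ((g * tauBasis n).toBlocks₁₁ᵀ).det := by
      rw [Matrix.det_transpose]; exact isUnit_iff_ne_zero.2 h0
    have h2 := (toBlocks_of_mem_formGroup hg').2.1
    have h3 : (frameMap g).1ᵀ * (g * tauBasis n).toBlocks₂₂ - (g * tauBasis n).toBlocks₁₂ =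
        ((frameMap g).2.1⁻¹)ᵀ * (Matrix.fromCols 1 0 : Matrix (Fin 2) (Idx n) ℝ) := by
      have key : ∀ (A : Matrix (Fin 2) (Fin 2) ℝ) (B : Matrix (Idx n) (Fin 2) ℝ)
          (p : Matrix (Fin 2) (Idx n) ℝ) (r : Matrix (Idx n) (Idx n) ℝ), IsUnit Aᵀ.det →
          (B * A⁻¹)ᵀ * r - p = (A⁻¹)ᵀ * (Bᵀ * r - Aᵀ * p) := by
        intro A B p r hA
        rw [Matrix.mul_sub, ← Matrix.mul_assoc, ← Matrix.mul_assoc, Matrix.transpose_nonsing_inv,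
          Matrix.nonsing_inv_mul _ hA, Matrix.one_mul, Matrix.transpose_mul,
          Matrix.transpose_nonsing_inv]
      rw [frameMap_eq, ← h2]
      exact key _ _ _ _ hT
    have h4 : (Matrix.fromCols 1 0 : Matrix (Fin 2) (Idx n) ℝ) *
        Matrix.fromRows (Y : Matrix (Fin 2) (Fin 2) ℝ) (0 : Matrix (Fin n) (Fin 2) ℝ) = Y := by
      rw [Matrix.fromCols_mul_fromRows]; simp
    rw [h3]
    simp only [Matrix.mul_assoc, h4, sub_self, Matrix.zero_mul]

end HomogeneousModel

/-! ### The Stiefel manifold and the bundle of adapted frames as submanifolds -/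

section Constraints

/-- The space of symmetric matrices. -/
def symMat (m : Type) : Submodule ℝ (Matrix m m ℝ) where
  carrier := {S | Sᵀ = S}
  add_mem' := by
    intro a b ha hb
    change (a + b)ᵀ = a + b
    rw [Matrix.transpose_add, show aᵀ = a from ha, show bᵀ = b from hb]
  zero_mem' := Matrix.transpose_zero
  smul_mem' := by
    intro c a ha
    change (c • a)ᵀ = c • a
    rw [Matrix.transpose_smul, show aᵀ = a from ha]

/-- The projection onto the symmetric matrices. -/
noncomputable def symProj (m : Type) [Fintype m] : Matrix m m ℝ →L[ℝ] symMat m :=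
  LinearMap.toContinuousLinearMap
    { toFun := fun S => ⟨(1 / 2 : ℝ) • (S + Sᵀ), by
        change ((1 / 2 : ℝ) • (S + Sᵀ))ᵀ = _
        rw [Matrix.transpose_smul, Matrix.transpose_add, Matrix.transpose_transpose, add_comm]⟩
      map_add' := by
        intro S T
        apply Subtype.ext
        change (1 / 2 : ℝ) • (S + T + (S + T)ᵀ) = (1 / 2 : ℝ) • (S + Sᵀ) + (1 / 2 : ℝ) • (T + Tᵀ)
        rw [Matrix.transpose_add]; module
      map_smul' := by
        intro c S
        apply Subtype.ext
        change (1 / 2 : ℝ) • (c • S + (c • S)ᵀ) = c • (1 / 2 : ℝ) • (S + Sᵀ)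
        rw [Matrix.transpose_smul]; module }

theorem symProj_eq_self {m : Type} [Fintype m] {S : Matrix m m ℝ} (hS : Sᵀ = S) :
    (symProj m S : Matrix m m ℝ) = S := by
  change (1 / 2 : ℝ) • (S + Sᵀ) = S
  rw [hS]; module

theorem symProj_eq_zero_iff {m : Type} [Fintype m] {S : Matrix m m ℝ} (hS : Sᵀ = S) :
    symProj m S = 0 ↔ S = 0 := by
  rw [← Subtype.coe_inj, symProj_eq_self hS]
  rfl

theorem finrank_symMat_two : Module.finrank ℝ (symMat (Fin 2)) = 3 := by
  let L : symMat (Fin 2) ≃ₗ[ℝ] (Fin 3 → ℝ) :=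
    { toFun := fun S => ![(S : Matrix (Fin 2) (Fin 2) ℝ) 0 0, (S : Matrix (Fin 2) (Fin 2) ℝ) 0 1,
        (S : Matrix (Fin 2) (Fin 2) ℝ) 1 1]
      map_add' := by intro S T; ext i; fin_cases i <;> rfl
      map_smul' := by intro c S; ext i; fin_cases i <;> rfl
      invFun := fun v => ⟨!![v 0, v 1; v 1, v 2], by
        change (!![v 0, v 1; v 1, v 2] : Matrix (Fin 2) (Fin 2) ℝ)ᵀ = _
        ext i j; fin_cases i <;> fin_cases j <;> rfl⟩
      left_inv := by
        rintro ⟨S, hS⟩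
        apply Subtype.ext
        have h10 : S 1 0 = S 0 1 := congrFun (congrFun (show Sᵀ = S from hS) 0) 1
        ext i j; fin_cases i <;> fin_cases j <;> simp [h10]
      right_inv := by intro v; ext i; fin_cases i <;> rfl }
  rw [L.finrank_eq]; simp

section GramConstraint

variable {E : Type} [NormedAddCommGroup E] [NormedSpace ℝ E] {l m : Type} [Fintype l] [Fintype m]
  [DecidableEq m]

theorem contDiff_gram {f : E → Matrix l m ℝ} (hf : ContDiff ℝ ∞ f) :
    ContDiff ℝ ∞ fun y => symProj m ((f y)ᵀ * f y - 1) :=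
  (symProj m).contDiff.comp ((hf.matrix_transpose.matrix_mul hf).sub contDiff_const)

theorem HasFDerivAt.gram {f : E → Matrix l m ℝ} {f' : E →L[ℝ] Matrix l m ℝ} {x : E}
    (hf : HasFDerivAt f f' x) : HasFDerivAt (fun y => symProj m ((f y)ᵀ * f y - 1))
      ((symProj m) ∘L mulDeriv (f x)ᵀ (f x) (transposeDeriv f') f') x :=
  (symProj m).hasFDerivAt.comp x
    ((HasFDerivAt.matrix_mul hf.matrix_transpose hf).sub_const 1)

theorem gram_eq_zero_iff {x : Matrix l m ℝ} : symProj m (xᵀ * x - 1) = 0 ↔ xᵀ * x = 1 := by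
  rw [symProj_eq_zero_iff, sub_eq_zero]
  rw [Matrix.transpose_sub, Matrix.transpose_mul, Matrix.transpose_transpose, Matrix.transpose_one]

omit [DecidableEq m] in
theorem symProj_gramDeriv {x w : Matrix l m ℝ} :
    (symProj m (xᵀ * w + wᵀ * x) : Matrix m m ℝ) = xᵀ * w + wᵀ * x := by
  apply symProj_eq_self
  rw [Matrix.transpose_add, Matrix.transpose_mul, Matrix.transpose_mul, Matrix.transpose_transpose,
    Matrix.transpose_transpose, add_comm]

omit [DecidableEq m] in
theorem symProj_gramDeriv_eq_zero_iff {x w : Matrix l m ℝ} :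
    symProj m (xᵀ * w + wᵀ * x) = 0 ↔ xᵀ * w + wᵀ * x = 0 := by
  rw [← Subtype.coe_inj, symProj_gramDeriv]
  rfl

end GramConstraint

variable {n : ℕ}

theorem stiefel_regular {x : Matrix (Idx n) (Fin 2) ℝ} (hx : x ∈ stiefel n) :
    HasSmoothChart (EuclideanSpace ℝ (Fin (2 * n + 1))) (stiefel n) x ∧
      ∀ w, w ∈ tangentSpaceAt (stiefel n) x ↔ xᵀ * w + wᵀ * x = 0 := by
  have hx' : xᵀ * x = 1 := hx
  have hd : HasFDerivAt (fun y : Matrix (Idx n) (Fin 2) ℝ => symProj (Fin 2) (yᵀ * y - 1)) _ x :=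
    HasFDerivAt.gram (hasFDerivAt_id x)
  have hsurj : Function.Surjective ((symProj (Fin 2)) ∘L
      mulDeriv xᵀ x (transposeDeriv (ContinuousLinearMap.id ℝ (Matrix (Idx n) (Fin 2) ℝ)))
        (ContinuousLinearMap.id ℝ (Matrix (Idx n) (Fin 2) ℝ))) := by
    rintro ⟨S, hS⟩
    have hS' : Sᵀ = S := hS
    refine ⟨x * ((1 / 2 : ℝ) • S), Subtype.ext ?_⟩
    change (symProj (Fin 2) (xᵀ * (x * ((1 / 2 : ℝ) • S)) + (x * ((1 / 2 : ℝ) • S))ᵀ * x) :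
      Matrix (Fin 2) (Fin 2) ℝ) = S
    rw [symProj_gramDeriv, Matrix.transpose_mul, ← Matrix.mul_assoc, hx', Matrix.mul_assoc, hx',
      Matrix.one_mul, Matrix.mul_one, Matrix.transpose_smul, hS']
    module
  obtain ⟨h1, h2⟩ := hasSmoothChart_and_tangentSpaceAt_of_regular (S := stiefel n)
    (contDiff_gram contDiff_id) isOpen_univ (fun y _ => gram_eq_zero_iff.symm) (Set.mem_univ x) hx hd
    hsurj
  refine ⟨IsSubmanifold.of_hasSmoothChart ?_ h1, fun w => ?_⟩
  · have h := LinearMap.finrank_range_add_finrank_ker ((symProj (Fin 2)) ∘L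
      mulDeriv xᵀ x (transposeDeriv (ContinuousLinearMap.id ℝ (Matrix (Idx n) (Fin 2) ℝ)))
        (ContinuousLinearMap.id ℝ (Matrix (Idx n) (Fin 2) ℝ))).toLinearMap
    rw [LinearMap.range_eq_top.2 hsurj, finrank_top, finrank_symMat_two,
      Module.finrank_matrix] at h
    simp only [Fintype.card_sum, Fintype.card_fin, Module.finrank_self, mul_one] at h
    omega
  · rw [h2]
    exact symProj_gramDeriv_eq_zero_iff

theorem isSubmanifold_stiefel : IsSubmanifold (stiefel n) (2 * n + 1) :=
  fun _ hx => (stiefel_regular hx).1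

theorem mem_tangentSpaceAt_stiefel {x w : Matrix (Idx n) (Fin 2) ℝ} (hx : x ∈ stiefel n) :
    w ∈ tangentSpaceAt (stiefel n) x ↔ xᵀ * w + wᵀ * x = 0 :=
  (stiefel_regular hx).2 w

/-- The equations of the bundle of adapted frames. -/
noncomputable def lieConstraint (n : ℕ)
    (u : Matrix (Idx n) (Fin 2) ℝ × Matrix (Fin 2) (Fin 2) ℝ × Matrix (Idx n) (Fin n) ℝ) :
    symMat (Fin 2) × Matrix (Fin 2) (Fin n) ℝ × symMat (Fin n) :=
  (symProj (Fin 2) (u.1ᵀ * u.1 - 1), u.1ᵀ * u.2.2, symProj (Fin n) (u.2.2ᵀ * u.2.2 - 1))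

theorem contDiff_lieConstraint : ContDiff ℝ ∞ (lieConstraint n) :=
  (contDiff_gram contDiff_fst).prodMk
    ((contDiff_fst.matrix_transpose.matrix_mul contDiff_snd.snd).prodMk
      (contDiff_gram contDiff_snd.snd))

theorem fderiv_lieConstraint
    (u w : Matrix (Idx n) (Fin 2) ℝ × Matrix (Fin 2) (Fin 2) ℝ × Matrix (Idx n) (Fin n) ℝ) :
    fderiv ℝ (lieConstraint n) u w =
      (symProj (Fin 2) (u.1ᵀ * w.1 + w.1ᵀ * u.1), u.1ᵀ * w.2.2 + w.1ᵀ * u.2.2,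
        symProj (Fin n) (u.2.2ᵀ * w.2.2 + w.2.2ᵀ * u.2.2)) := by
  have h1 := hasFDerivAt_fst (𝕜 := ℝ) (p := u)
  have h2 := (hasFDerivAt_snd (𝕜 := ℝ) (p := u)).snd
  have h : HasFDerivAt (lieConstraint n) _ u :=
    (HasFDerivAt.gram h1).prodMk ((HasFDerivAt.matrix_mul (HasFDerivAt.matrix_transpose h1) h2).prodMk
      (HasFDerivAt.gram h2))
  rw [h.fderiv]
  rfl

theorem fderiv_lieConstraint_eq_zero_iff
    (u w : Matrix (Idx n) (Fin 2) ℝ × Matrix (Fin 2) (Fin 2) ℝ × Matrix (Idx n) (Fin n) ℝ) :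
    fderiv ℝ (lieConstraint n) u w = 0 ↔ u.1ᵀ * w.1 + w.1ᵀ * u.1 = 0 ∧
      u.1ᵀ * w.2.2 + w.1ᵀ * u.2.2 = 0 ∧ u.2.2ᵀ * w.2.2 + w.2.2ᵀ * u.2.2 = 0 := by
  rw [fderiv_lieConstraint, Prod.mk_eq_zero, Prod.mk_eq_zero, symProj_gramDeriv_eq_zero_iff,
    symProj_gramDeriv_eq_zero_iff]

/-- The open set on which the equations `lieConstraint` define the bundle of adapted frames. -/
def lieOpen (n : ℕ) :
    Set (Matrix (Idx n) (Fin 2) ℝ × Matrix (Fin 2) (Fin 2) ℝ × Matrix (Idx n) (Fin n) ℝ) :=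
  {u | 0 < u.2.1.det ∧ 0 < (Matrix.fromCols u.1 u.2.2).det}

theorem isOpen_lieOpen : IsOpen (lieOpen n) := by
  have h1 : ContDiff ℝ 0 fun u : Matrix (Idx n) (Fin 2) ℝ × Matrix (Fin 2) (Fin 2) ℝ ×
      Matrix (Idx n) (Fin n) ℝ => u.2.1.det := contDiff_snd.fst.matrix_det
  have h2 : ContDiff ℝ 0 fun u : Matrix (Idx n) (Fin 2) ℝ × Matrix (Fin 2) (Fin 2) ℝ ×
      Matrix (Idx n) (Fin n) ℝ => (Matrix.fromCols u.1 u.2.2).det :=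
    (contDiff_fst.matrix_fromCols contDiff_snd.snd).matrix_det
  exact (isOpen_lt continuous_const h1.continuous).inter (isOpen_lt continuous_const h2.continuous)

theorem mem_lieTotal_iff
    {u : Matrix (Idx n) (Fin 2) ℝ × Matrix (Fin 2) (Fin 2) ℝ × Matrix (Idx n) (Fin n) ℝ}
    (hu : u ∈ lieOpen n) : u ∈ lieTotal n ↔ lieConstraint n u = 0 := by
  rw [lieConstraint, Prod.mk_eq_zero, Prod.mk_eq_zero, gram_eq_zero_iff, gram_eq_zero_iff]
  constructor
  · rintro ⟨h1, h2, h3, -⟩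
    exact ⟨h1, h2, h3⟩
  · rintro ⟨h1, h2, h3⟩
    exact ⟨h1, h2, h3, hu⟩

theorem lieTotal_subset_lieOpen : lieTotal n ⊆ lieOpen n := fun _ hu => hu.2.2.2

theorem lieTotal_regular
    {u : Matrix (Idx n) (Fin 2) ℝ × Matrix (Fin 2) (Fin 2) ℝ × Matrix (Idx n) (Fin n) ℝ}
    (hu : u ∈ lieTotal n) :
    HasSmoothChart (fderiv ℝ (lieConstraint n) u).ker (lieTotal n) u ∧
      tangentSpaceAt (lieTotal n) u = (fderiv ℝ (lieConstraint n) u).ker ∧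
      Function.Surjective (fderiv ℝ (lieConstraint n) u) := by
  have hsurj : Function.Surjective (fderiv ℝ (lieConstraint n) u) := by
    rintro ⟨⟨S, hS⟩, M, ⟨T, hT⟩⟩
    have hS' : Sᵀ = S := hS
    have hT' : Tᵀ = T := hT
    obtain ⟨h1, h2, h3, -⟩ := hu
    have h2' : u.2.2ᵀ * u.1 = 0 := by
      have := congrArg Matrix.transpose h2
      rwa [Matrix.transpose_mul, Matrix.transpose_transpose, Matrix.transpose_zero] at this
    refine ⟨(u.1 * ((1 / 2 : ℝ) • S) + u.2.2 * Mᵀ, 0, u.2.2 * ((1 / 2 : ℝ) • T)), ?_⟩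
    rw [fderiv_lieConstraint]
    refine Prod.ext (Subtype.ext ?_) (Prod.ext ?_ (Subtype.ext ?_))
    · rw [symProj_gramDeriv]
      simp only [Matrix.transpose_add, Matrix.transpose_mul, Matrix.transpose_transpose,
        Matrix.mul_add, Matrix.add_mul, ← Matrix.mul_assoc, h1, h2, Matrix.one_mul, Matrix.zero_mul]
      simp only [Matrix.mul_assoc, h1, h2', Matrix.mul_one, Matrix.mul_zero, Matrix.transpose_smul,
        hS', add_zero]
      module
    · simp only [Matrix.transpose_add, Matrix.transpose_mul, Matrix.transpose_transpose,
        Matrix.add_mul, ← Matrix.mul_assoc, h2, Matrix.zero_mul]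
      simp only [Matrix.mul_assoc, h2, h3, Matrix.mul_one, Matrix.mul_zero, zero_add]
    · rw [symProj_gramDeriv]
      simp only [Matrix.transpose_mul, ← Matrix.mul_assoc, h3, Matrix.one_mul]
      simp only [Matrix.mul_assoc, h3, Matrix.mul_one, Matrix.transpose_smul, hT']
      module
  obtain ⟨h1, h2⟩ := hasSmoothChart_and_tangentSpaceAt_of_regular (S := lieTotal n)
    contDiff_lieConstraint isOpen_lieOpen (fun y hy => mem_lieTotal_iff hy)
    (lieTotal_subset_lieOpen hu) hu
    (contDiff_lieConstraint.differentiable (by simp) u).hasFDerivAt hsurj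
  exact ⟨h1, h2, hsurj⟩

theorem mem_tangentSpaceAt_lieTotal
    {u w : Matrix (Idx n) (Fin 2) ℝ × Matrix (Fin 2) (Fin 2) ℝ × Matrix (Idx n) (Fin n) ℝ}
    (hu : u ∈ lieTotal n) : w ∈ tangentSpaceAt (lieTotal n) u ↔
      u.1ᵀ * w.1 + w.1ᵀ * u.1 = 0 ∧ u.1ᵀ * w.2.2 + w.1ᵀ * u.2.2 = 0 ∧
        u.2.2ᵀ * w.2.2 + w.2.2ᵀ * u.2.2 = 0 := by
  rw [(lieTotal_regular hu).2.1]
  exact fderiv_lieConstraint_eq_zero_iff u w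

theorem isSubmanifold_lieTotal : ∃ d, IsSubmanifold (lieTotal n) d := by
  refine ⟨Module.finrank ℝ (Matrix (Idx n) (Fin 2) ℝ × Matrix (Fin 2) (Fin 2) ℝ ×
      Matrix (Idx n) (Fin n) ℝ) -
      Module.finrank ℝ (symMat (Fin 2) × Matrix (Fin 2) (Fin n) ℝ × symMat (Fin n)),
    fun u hu => IsSubmanifold.of_hasSmoothChart ?_ (lieTotal_regular hu).1⟩
  have h := LinearMap.finrank_range_add_finrank_ker (fderiv ℝ (lieConstraint n) u).toLinearMap
  rw [LinearMap.range_eq_top.2 (lieTotal_regular hu).2.2, finrank_top] at h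
  exact Nat.eq_sub_of_add_eq' h

/-- The bracket of vector fields on the bundle of adapted frames is tangent to it. -/
theorem lieBracketWithin_mem_tangentSpaceAt_lieTotal
    {u : Matrix (Idx n) (Fin 2) ℝ × Matrix (Fin 2) (Fin 2) ℝ × Matrix (Idx n) (Fin n) ℝ}
    (hu : u ∈ lieTotal n) {ξ η : _ → _} (hξ : IsVectorField (lieTotal n) ξ)
    (hη : IsVectorField (lieTotal n) η) :
    VectorField.lieBracketWithin ℝ ξ η (lieTotal n) u ∈ tangentSpaceAt (lieTotal n) u := by
  rw [(lieTotal_regular hu).2.1]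
  refine fderiv_lieBracketWithin_eq_zero contDiff_lieConstraint isOpen_univ (Set.mem_univ u) hu
    (fun y hy w hw => ?_) hξ hη
  rw [(lieTotal_regular hy.1).2.1] at hw
  exact hw

end Constraints

/-! ### The rotation by a right angle, bivectors and adapted frames -/

section AdaptedFrames

/-- The rotation of the plane by a right angle. -/
def eps : Matrix (Fin 2) (Fin 2) ℝ := !![0, -1; 1, 0]

theorem eps_mul_eps : eps * eps = -1 := by
  ext i j; fin_cases i <;> fin_cases j <;> simp [eps, Matrix.mul_apply]

theorem transpose_eps : epsᵀ = -eps := by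
  ext i j; fin_cases i <;> fin_cases j <;> simp [eps]

theorem mul_eps_mul_transpose (A : Matrix (Fin 2) (Fin 2) ℝ) : A * eps * Aᵀ = A.det • eps := by
  ext i j
  fin_cases i <;> fin_cases j <;>
    simp [eps, Matrix.mul_apply, Matrix.det_fin_two, Fin.sum_univ_two] <;> ring

theorem transpose_mul_eps_mul (A : Matrix (Fin 2) (Fin 2) ℝ) : Aᵀ * eps * A = A.det • eps := by
  ext i j
  fin_cases i <;> fin_cases j <;>
    simp [eps, Matrix.mul_apply, Matrix.det_fin_two, Fin.sum_univ_two] <;> ring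

theorem eq_smul_eps_of_transpose_eq_neg {S : Matrix (Fin 2) (Fin 2) ℝ} (hS : Sᵀ = -S) :
    S = S 1 0 • eps := by
  have h : ∀ i j, S j i = -S i j := fun i j => congrFun (congrFun hS i) j
  have h00 : S 0 0 = 0 := by linarith [h 0 0]
  have h11 : S 1 1 = 0 := by linarith [h 1 1]
  ext i j; fin_cases i <;> fin_cases j <;> simp [eps, h00, h11, h 1 0]

variable {n : ℕ}

theorem orientedSpan_eq (x : Matrix (Idx n) (Fin 2) ℝ) : orientedSpan x = x * eps * xᵀ := by
  ext i j
  simp [orientedSpan, bivec, eps, Matrix.mul_apply, Fin.sum_univ_two, Matrix.vecMulVec_apply]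
  ring

theorem orientedSpan_mul (x : Matrix (Idx n) (Fin 2) ℝ) (A : Matrix (Fin 2) (Fin 2) ℝ) :
    orientedSpan (x * A) = A.det • orientedSpan x := by
  rw [orientedSpan_eq, orientedSpan_eq, Matrix.transpose_mul, Matrix.mul_assoc x A,
    Matrix.mul_assoc x (A * eps), ← Matrix.mul_assoc (A * eps), mul_eps_mul_transpose,
    Matrix.smul_mul, Matrix.mul_smul, Matrix.mul_assoc]

theorem mul_transpose_add_mul_transpose {x : Matrix (Idx n) (Fin 2) ℝ} {C : Matrix (Idx n) (Fin n) ℝ}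
    (hx : xᵀ * x = 1) (hxC : xᵀ * C = 0) (hC : Cᵀ * C = 1) : x * xᵀ + C * Cᵀ = 1 := by
  have h := mul_eq_one_comm.1 (transpose_mul_fromCols hx hxC hC)
  rwa [Matrix.transpose_fromCols, Matrix.fromCols_mul_fromRows] at h

theorem mul_transpose_mul_eq {x : Matrix (Idx n) (Fin 2) ℝ} {C : Matrix (Idx n) (Fin n) ℝ}
    (hx : xᵀ * x = 1) (hxC : xᵀ * C = 0) (hC : Cᵀ * C = 1) {m : Type}
    {w : Matrix (Idx n) m ℝ} (hw : xᵀ * w = 0) : C * (Cᵀ * w) = w := by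
  have h := congrArg (· * w) (mul_transpose_add_mul_transpose hx hxC hC)
  simpa [Matrix.add_mul, Matrix.mul_assoc, hw] using h

theorem det_fromCols_mul (x : Matrix (Idx n) (Fin 2) ℝ) (C : Matrix (Idx n) (Fin n) ℝ)
    (A : Matrix (Fin 2) (Fin 2) ℝ) (B : Matrix (Fin n) (Fin n) ℝ) :
    (Matrix.fromCols (x * A) (C * B)).det = (Matrix.fromCols x C).det * (A.det * B.det) := by
  have h : (Matrix.fromCols (x * A) (C * B) : Matrix (Idx n) (Idx n) ℝ) =
      (Matrix.fromCols x C : Matrix (Idx n) (Idx n) ℝ) * Matrix.fromBlocks A 0 0 B := by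
    rw [Matrix.fromCols_mul_fromBlocks]
    simp
  rw [h, Matrix.det_mul, Matrix.det_fromBlocks_zero₂₁]

/-- Two adapted frames with the same plane differ by an element of `SO(n)`. -/
theorem transpose_mul_mem_SO {x : Matrix (Idx n) (Fin 2) ℝ} {C C' : Matrix (Idx n) (Fin n) ℝ}
    (hx : xᵀ * x = 1) (hxC : xᵀ * C = 0) (hC : Cᵀ * C = 1) (hd : 0 < (Matrix.fromCols x C).det)
    (hxC' : xᵀ * C' = 0) (hC' : C'ᵀ * C' = 1) (hd' : 0 < (Matrix.fromCols x C').det) :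
    C'ᵀ * C ∈ Matrix.specialOrthogonalGroup (Fin n) ℝ := by
  have h1 : C' * (C'ᵀ * C) = C := mul_transpose_mul_eq hx hxC' hC' hxC
  rw [mem_SO_iff, Matrix.transpose_mul, Matrix.transpose_transpose]
  refine ⟨by rw [Matrix.mul_assoc, h1, hC], ?_⟩
  have h2 := det_fromCols_mul x C' 1 (C'ᵀ * C)
  rw [h1, Matrix.mul_one, Matrix.det_one, one_mul] at h2
  rw [h2] at hd
  exact (mul_pos_iff_of_pos_left hd').1 hd

/-- A smooth local choice of an oriented orthonormal frame of the orthogonal complement. -/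
theorem exists_local_completion (hn : 0 < n) {x₀ : Matrix (Idx n) (Fin 2) ℝ} (hx₀ : x₀ ∈ stiefel n) :
    ∃ (O : Set (Matrix (Idx n) (Fin 2) ℝ)) (C : Matrix (Idx n) (Fin 2) ℝ → Matrix (Idx n) (Fin n) ℝ),
      IsOpen O ∧ x₀ ∈ O ∧ ContDiffOn ℝ ∞ C O ∧ ∀ y ∈ stiefel n ∩ O,
        yᵀ * C y = 0 ∧ (C y)ᵀ * C y = 1 ∧ 0 < (Matrix.fromCols y (C y)).det := by
  obtain ⟨C₀, h0, h1, h2⟩ := exists_completion hn hx₀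
  have hx : x₀ᵀ * x₀ = 1 := hx₀
  -- the image of `C₀` under the reflection type isometry that maps `x₀` to `y`
  let C : Matrix (Idx n) (Fin 2) ℝ → Matrix (Idx n) (Fin n) ℝ := fun y =>
    C₀ - (x₀ + y) * ((1 + yᵀ * x₀)⁻¹ * (yᵀ * C₀))
  let O₁ : Set (Matrix (Idx n) (Fin 2) ℝ) := {y | (1 + yᵀ * x₀).det ≠ 0}
  have hden : ContDiff ℝ ∞ fun y : Matrix (Idx n) (Fin 2) ℝ => 1 + yᵀ * x₀ :=
    contDiff_const.add (contDiff_id.matrix_transpose.matrix_mul contDiff_const)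
  have hO₁ : IsOpen O₁ := isOpen_ne_fun (hden.matrix_det.continuous) continuous_const
  have hC : ContDiffOn ℝ ∞ C O₁ := by
    refine contDiffOn_const.sub ((contDiffOn_const.add contDiffOn_id).matrix_mul
      ((hden.contDiffOn.matrix_inv fun y hy => hy).matrix_mul ?_))
    exact (contDiff_id.matrix_transpose.matrix_mul contDiff_const).contDiffOn
  have hdet : ContDiffOn ℝ ∞ (fun y => (Matrix.fromCols y (C y)).det) O₁ :=
    (contDiffOn_id.matrix_fromCols hC).matrix_det
  have hCx : C x₀ = C₀ := by
    simp [C, h0]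
  refine ⟨O₁ ∩ (fun y => (Matrix.fromCols y (C y)).det) ⁻¹' Set.Ioi 0, C,
    hdet.continuousOn.isOpen_inter_preimage hO₁ isOpen_Ioi, ⟨?_, ?_⟩,
    hC.mono Set.inter_subset_left, ?_⟩
  · change (1 + x₀ᵀ * x₀).det ≠ 0
    rw [hx, ← two_smul ℝ, Matrix.det_smul]
    norm_num
  · change 0 < (Matrix.fromCols x₀ (C x₀)).det
    rwa [hCx]
  · rintro y ⟨hy, hy1, hy2⟩
    have hy' : yᵀ * y = 1 := hy
    have hu : IsUnit (1 + yᵀ * x₀).det := isUnit_iff_ne_zero.2 hy1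
    have hS : (x₀ + y)ᵀ * C₀ = yᵀ * C₀ := by
      rw [Matrix.transpose_add, Matrix.add_mul, h0, zero_add]
    have hyS : yᵀ * (x₀ + y) = 1 + yᵀ * x₀ := by
      rw [Matrix.mul_add, hy', add_comm]
    have hSS : (x₀ + y)ᵀ * (x₀ + y) = (1 + yᵀ * x₀) + (1 + yᵀ * x₀)ᵀ := by
      simp only [Matrix.transpose_add, Matrix.transpose_mul, Matrix.transpose_transpose,
        Matrix.transpose_one, Matrix.add_mul, Matrix.mul_add, hx, hy']
      abel
    refine ⟨?_, ?_, hy2⟩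
    · rw [Matrix.mul_sub, ← Matrix.mul_assoc yᵀ, hyS, Matrix.mul_nonsing_inv_cancel_left _ _ hu,
        sub_self]
    · set D := 1 + yᵀ * x₀ with hD
      set N := yᵀ * C₀ with hN
      have hSt : C₀ᵀ * (x₀ + y) = Nᵀ := by
        rw [← hS, Matrix.transpose_mul, Matrix.transpose_transpose]
      have e1 : (C y)ᵀ = C₀ᵀ - Nᵀ * (D⁻¹)ᵀ * (x₀ + y)ᵀ := by
        change (C₀ - (x₀ + y) * (D⁻¹ * N))ᵀ = _
        rw [Matrix.transpose_sub, Matrix.transpose_mul, Matrix.transpose_mul]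
      have e2 : (D⁻¹)ᵀ * (D + Dᵀ) * D⁻¹ = (D⁻¹)ᵀ + D⁻¹ := by
        rw [Matrix.mul_add, Matrix.add_mul, Matrix.mul_assoc, Matrix.mul_nonsing_inv _ hu,
          ← Matrix.transpose_mul, Matrix.mul_nonsing_inv _ hu]
        simp
      have e3 : (C y)ᵀ * C y = C₀ᵀ * C₀ - C₀ᵀ * (x₀ + y) * D⁻¹ * N - Nᵀ * (D⁻¹)ᵀ * ((x₀ + y)ᵀ * C₀)
          + Nᵀ * ((D⁻¹)ᵀ * ((x₀ + y)ᵀ * (x₀ + y)) * D⁻¹) * N := by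
        rw [e1]
        change _ * (C₀ - (x₀ + y) * (D⁻¹ * N)) = _
        simp only [Matrix.sub_mul, Matrix.mul_sub, Matrix.mul_assoc]
        abel
      rw [e3, hSS, e2, hS, hSt, h1]
      simp only [Matrix.mul_add, Matrix.add_mul, Matrix.mul_assoc]
      abel

end AdaptedFrames

/-! ### The Lie contact structure on the Stiefel manifold -/

section LieContact

/-- The ambient vector space of the bundle `lieTotal n`. -/
abbrev FrameSpace (n : ℕ) : Type :=
  Matrix (Idx n) (Fin 2) ℝ × Matrix (Fin 2) (Fin 2) ℝ × Matrix (Idx n) (Fin n) ℝ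

/-- The projection onto the skew-symmetric matrices. -/
noncomputable def skewProj : Matrix (Fin 2) (Fin 2) ℝ →L[ℝ] gTwo :=
  LinearMap.toContinuousLinearMap
    { toFun := fun S => ⟨(1 / 2 : ℝ) • (S - Sᵀ), by
        change ((1 / 2 : ℝ) • (S - Sᵀ))ᵀ = -((1 / 2 : ℝ) • (S - Sᵀ))
        rw [Matrix.transpose_smul, Matrix.transpose_sub, Matrix.transpose_transpose]; module⟩
      map_add' := by
        intro S T
        apply Subtype.ext
        change (1 / 2 : ℝ) • (S + T - (S + T)ᵀ) = (1 / 2 : ℝ) • (S - Sᵀ) + (1 / 2 : ℝ) • (T - Tᵀ)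
        rw [Matrix.transpose_add]; module
      map_smul' := by
        intro c S
        apply Subtype.ext
        change (1 / 2 : ℝ) • (c • S - (c • S)ᵀ) = c • (1 / 2 : ℝ) • (S - Sᵀ)
        rw [Matrix.transpose_smul]; module }

theorem skewProj_eq_self {S : Matrix (Fin 2) (Fin 2) ℝ} (hS : Sᵀ = -S) :
    (skewProj S : Matrix (Fin 2) (Fin 2) ℝ) = S := by
  change (1 / 2 : ℝ) • (S - Sᵀ) = S
  rw [hS]; module

variable {n : ℕ}

theorem total_homogeneousLieContact : (homogeneousLieContact n).total = lieTotal n :=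
  frameMap_image

theorem mem_H_iff {x w : Matrix (Idx n) (Fin 2) ℝ} :
    w ∈ (homogeneousLieContact n).H x ↔ xᵀ * w = 0 := Iff.rfl

theorem frameOne_apply (u : FrameSpace n) (X : Matrix (Fin n) (Fin 2) ℝ) :
    (homogeneousLieContact n).frameOne u X = u.2.2 * X * u.2.1⁻¹ := rfl

theorem frameTwo_apply (u : FrameSpace n) (Y : gTwo) :
    (homogeneousLieContact n).frameTwo u Y =
      u.1 * ((u.2.1⁻¹)ᵀ * (Y : Matrix (Fin 2) (Fin 2) ℝ) * u.2.1⁻¹) := rfl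

theorem act_mem_lieTotal {u : FrameSpace n} (hu : u ∈ lieTotal n)
    {a : Matrix (Fin 2) (Fin 2) ℝ × Matrix (Fin n) (Fin n) ℝ} (ha : a ∈ G0 n) :
    (u.1, u.2.1 * a.1, u.2.2 * a.2) ∈ lieTotal n := by
  obtain ⟨h1, h2, h3, h4, h5⟩ := hu
  obtain ⟨ha1, ha2⟩ := ha
  obtain ⟨b1, -, b3⟩ := transpose_mul_self_of_mem_SO ha2
  refine ⟨h1, ?_, ?_, ?_, ?_⟩
  · change u.1ᵀ * (u.2.2 * a.2) = 0
    rw [← Matrix.mul_assoc, h2, Matrix.zero_mul]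
  · change (u.2.2 * a.2)ᵀ * (u.2.2 * a.2) = 1
    rw [Matrix.transpose_mul, Matrix.mul_assoc, ← Matrix.mul_assoc _ u.2.2, h3, Matrix.one_mul, b1]
  · change 0 < (u.2.1 * a.1).det
    rw [Matrix.det_mul]
    exact mul_pos h4 ha1
  · change 0 < (Matrix.fromCols u.1 (u.2.2 * a.2)).det
    have h := det_fromCols_mul u.1 u.2.2 1 a.2
    rw [Matrix.mul_one, Matrix.det_one, b3, one_mul, mul_one] at h
    rwa [h]

theorem isPrincipal_homogeneousLieContact (hn : 0 < n) :
    (homogeneousLieContact n).toG0BundleData.IsPrincipal (stiefel n) where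
  submanifold := by rw [total_homogeneousLieContact]; exact isSubmanifold_lieTotal
  proj_smooth := contDiff_fst.contDiffOn
  proj_mem u hu := by
    rw [total_homogeneousLieContact] at hu
    exact hu.1
  act_smooth :=
    (contDiff_fst.fst.prodMk ((contDiff_fst.snd.fst.matrix_mul contDiff_snd.fst).prodMk
      (contDiff_fst.snd.snd.matrix_mul contDiff_snd.snd))).contDiffOn
  act_mem u hu a ha := by
    rw [total_homogeneousLieContact] at hu ⊢
    exact act_mem_lieTotal hu ha
  act_one u _ := by
    change (u.1, u.2.1 * 1, u.2.2 * 1) = u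
    rw [Matrix.mul_one, Matrix.mul_one]
  act_mul u _ a _ b _ := by
    change (u.1, u.2.1 * (a.1 * b.1), u.2.2 * (a.2 * b.2)) =
      (u.1, u.2.1 * a.1 * b.1, u.2.2 * a.2 * b.2)
    rw [Matrix.mul_assoc, Matrix.mul_assoc]
  proj_act _ _ _ _ := rfl
  free u hu a ha h := by
    rw [total_homogeneousLieContact] at hu
    obtain ⟨-, -, h3, h4, -⟩ := hu
    have e1 : u.2.1 * a.1 = u.2.1 := congrArg (fun z : FrameSpace n => z.2.1) h
    have e2 : u.2.2 * a.2 = u.2.2 := congrArg (fun z : FrameSpace n => z.2.2) h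
    refine Prod.ext ?_ ?_
    · have := congrArg (u.2.1⁻¹ * ·) e1
      have hu' : IsUnit u.2.1.det := isUnit_iff_ne_zero.2 h4.ne'
      simpa [← Matrix.mul_assoc, Matrix.nonsing_inv_mul _ hu'] using this
    · have := congrArg (u.2.2ᵀ * ·) e2
      simpa [← Matrix.mul_assoc, h3] using this
  locally_trivial x hx := by
    obtain ⟨O, C, hO, hxO, hC, hCO⟩ := exists_local_completion hn hx
    have hproj : Set.MapsTo (fun u : FrameSpace n => u.1)
        (lieTotal n ∩ (fun u : FrameSpace n => u.1) ⁻¹' O) O := fun u hu => hu.2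
    refine ⟨O, fun y => (y, 1, C y), fun u => (u.2.1, (C u.1)ᵀ * u.2.2), hO, hxO, ?_, ?_, ?_, ?_⟩
    · exact contDiffOn_id.prodMk (contDiffOn_const.prodMk (hC.mono Set.inter_subset_right))
    · rw [total_homogeneousLieContact]
      refine contDiff_snd.fst.contDiffOn.prodMk (ContDiffOn.matrix_mul
        (ContDiffOn.matrix_transpose (hC.comp contDiff_fst.contDiffOn hproj))
        contDiff_snd.snd.contDiffOn)
    · intro y hy
      rw [total_homogeneousLieContact]
      obtain ⟨h1, h2, h3⟩ := hCO y hy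
      refine ⟨⟨hy.1, h1, h2, ?_, h3⟩, rfl⟩
      change 0 < (1 : Matrix (Fin 2) (Fin 2) ℝ).det
      simp
    · rw [total_homogeneousLieContact]
      rintro u ⟨⟨h1, h2, h3, h4, h5⟩, huO⟩
      obtain ⟨c1, c2, c3⟩ := hCO u.1 ⟨h1, huO⟩
      refine ⟨⟨h4, transpose_mul_mem_SO h1 h2 h3 h5 c1 c2 c3⟩, ?_⟩
      change (u.1, 1 * u.2.1, C u.1 * ((C u.1)ᵀ * u.2.2)) = u
      rw [mul_transpose_mul_eq h1 c1 c2 h2, Matrix.one_mul]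

theorem frameOne_transpose_mul {u : FrameSpace n} (hu : u ∈ lieTotal n)
    {w : Matrix (Idx n) (Fin 2) ℝ} (hw : u.1ᵀ * w = 0) :
    (homogeneousLieContact n).frameOne u (u.2.2ᵀ * w * u.2.1) = w := by
  obtain ⟨h1, h2, h3, h4, -⟩ := hu
  rw [frameOne_apply, ← Matrix.mul_assoc, mul_transpose_mul_eq h1 h2 h3 hw,
    Matrix.mul_nonsing_inv_cancel_right _ _ (isUnit_iff_ne_zero.2 h4.ne')]

theorem frameOne_injective {u : FrameSpace n} (hu : u ∈ lieTotal n) :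
    Function.Injective ((homogeneousLieContact n).frameOne u) := by
  obtain ⟨-, -, h3, h4, -⟩ := hu
  refine Function.LeftInverse.injective (g := fun w => u.2.2ᵀ * w * u.2.1) fun X => ?_
  change u.2.2ᵀ * (u.2.2 * X * u.2.1⁻¹) * u.2.1 = X
  rw [← Matrix.mul_assoc, ← Matrix.mul_assoc, h3, Matrix.one_mul,
    Matrix.nonsing_inv_mul_cancel_right _ _ (isUnit_iff_ne_zero.2 h4.ne')]

theorem transpose_mul_frameOne {u : FrameSpace n} (hu : u ∈ lieTotal n)
    (X : Matrix (Fin n) (Fin 2) ℝ) : u.1ᵀ * (homogeneousLieContact n).frameOne u X = 0 := by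
  rw [frameOne_apply, ← Matrix.mul_assoc, ← Matrix.mul_assoc, hu.2.1, Matrix.zero_mul,
    Matrix.zero_mul]

theorem transpose_mul_frameTwo {u : FrameSpace n} (hu : u ∈ lieTotal n) (Y : gTwo) :
    u.1ᵀ * (homogeneousLieContact n).frameTwo u Y =
      (u.2.1⁻¹)ᵀ * (Y : Matrix (Fin 2) (Fin 2) ℝ) * u.2.1⁻¹ := by
  rw [frameTwo_apply, ← Matrix.mul_assoc, hu.1, Matrix.one_mul]

theorem mkQ_eq_mkQ_iff {x w w' : Matrix (Idx n) (Fin 2) ℝ} :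
    ((homogeneousLieContact n).H x).mkQ w = ((homogeneousLieContact n).H x).mkQ w' ↔
      xᵀ * w = xᵀ * w' := by
  rw [Submodule.mkQ_apply, Submodule.mkQ_apply, Submodule.Quotient.eq, mem_H_iff, Matrix.mul_sub,
    sub_eq_zero]

theorem phiTwo_injective {u : FrameSpace n} (hu : u ∈ lieTotal n) :
    Function.Injective ((homogeneousLieContact n).phiTwo u) := by
  intro Y Y' h
  have h : u.1ᵀ * (homogeneousLieContact n).frameTwo u Y =
    u.1ᵀ * (homogeneousLieContact n).frameTwo u Y' := mkQ_eq_mkQ_iff.1 h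
  rw [transpose_mul_frameTwo hu, transpose_mul_frameTwo hu] at h
  have hA : IsUnit u.2.1.det := isUnit_iff_ne_zero.2 hu.2.2.2.1.ne'
  have key : ∀ Y : Matrix (Fin 2) (Fin 2) ℝ,
      u.2.1ᵀ * ((u.2.1⁻¹)ᵀ * Y * u.2.1⁻¹) * u.2.1 = Y := fun Y => by
    rw [Matrix.mul_assoc, Matrix.nonsing_inv_mul_cancel_right _ _ hA, ← Matrix.mul_assoc,
      ← Matrix.transpose_mul, Matrix.nonsing_inv_mul _ hA, Matrix.transpose_one, Matrix.one_mul]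
  apply Subtype.ext
  rw [← key Y, h, key]

theorem phiTwo_skewProj {u : FrameSpace n} (hu : u ∈ lieTotal n) {w : Matrix (Idx n) (Fin 2) ℝ}
    (hw : w ∈ tangentSpaceAt (stiefel n) u.1) :
    (homogeneousLieContact n).phiTwo u (skewProj (u.2.1ᵀ * (u.1ᵀ * w) * u.2.1)) =
      ((homogeneousLieContact n).H u.1).mkQ w := by
  rw [mem_tangentSpaceAt_stiefel hu.1] at hw
  have hA : IsUnit u.2.1.det := isUnit_iff_ne_zero.2 hu.2.2.2.1.ne'
  have hsk : (u.2.1ᵀ * (u.1ᵀ * w) * u.2.1)ᵀ = -(u.2.1ᵀ * (u.1ᵀ * w) * u.2.1) := by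
    simp only [Matrix.transpose_mul, Matrix.transpose_transpose]
    rw [← add_eq_zero_iff_neg_eq.1 hw]
    simp only [Matrix.mul_neg, Matrix.neg_mul, Matrix.mul_assoc]
  refine mkQ_eq_mkQ_iff.2 ?_
  change u.1ᵀ * (homogeneousLieContact n).frameTwo u _ = u.1ᵀ * w
  rw [transpose_mul_frameTwo hu, skewProj_eq_self hsk,
    ← Matrix.mul_assoc, Matrix.mul_nonsing_inv_cancel_right _ _ hA, ← Matrix.mul_assoc,
    ← Matrix.transpose_mul, Matrix.mul_nonsing_inv _ hA, Matrix.transpose_one, Matrix.one_mul]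

/-- The horizontal vector fields `ξ`, `η` satisfy `xᵀ[ξ, η] = ηᵀξ - ξᵀη`. -/
theorem transpose_mul_lieBracketWithin {ξ η : Matrix (Idx n) (Fin 2) ℝ → Matrix (Idx n) (Fin 2) ℝ}
    (hξ : IsVectorField (stiefel n) ξ) (hη : IsVectorField (stiefel n) η)
    (hξH : ∀ x ∈ stiefel n, xᵀ * ξ x = 0) (hηH : ∀ x ∈ stiefel n, xᵀ * η x = 0)
    {x : Matrix (Idx n) (Fin 2) ℝ} (hx : x ∈ stiefel n) :
    xᵀ * VectorField.lieBracketWithin ℝ ξ η (stiefel n) x = (η x)ᵀ * ξ x - (ξ x)ᵀ * η x := by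
  have key : ∀ ζ : Matrix (Idx n) (Fin 2) ℝ → Matrix (Idx n) (Fin 2) ℝ,
      IsVectorField (stiefel n) ζ → (∀ x ∈ stiefel n, xᵀ * ζ x = 0) →
      ∀ w ∈ tangentSpaceAt (stiefel n) x, xᵀ * fderivWithin ℝ ζ (stiefel n) x w = -(wᵀ * ζ x) := by
    intro ζ hζ hζH w hw
    have h1 : HasFDerivWithinAt ζ _ (stiefel n) x :=
      ((hζ.smooth x hx).differentiableWithinAt (by simp)).hasFDerivWithinAt
    have h2 := HasFDerivWithinAt.matrix_mul
      (HasFDerivWithinAt.matrix_transpose (hasFDerivWithinAt_id x (stiefel n))) h1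
    have h3 := h2.apply_eq_zero_of_eqOn isOpen_univ (Set.mem_univ x) hx
      (fun y hy => hζH y hy.1) hw
    exact eq_neg_of_add_eq_zero_left h3
  refine (Matrix.mul_sub _ _ _).trans ((congrArg₂ (· - ·) (key η hη hηH _ (hξ.tangent x hx))
    (key ξ hξ hξH _ (hη.tangent x hx))).trans ?_)
  abel

theorem isLieContact_homogeneousLieContact (hn : 0 < n) :
    (homogeneousLieContact n).IsLieContact (stiefel n) where
  submanifold := isSubmanifold_stiefel
  principal := isPrincipal_homogeneousLieContact hn
  H_le x hx w hw := by
    have hw' : xᵀ * w = 0 := hw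
    rw [mem_tangentSpaceAt_stiefel hx, hw', zero_add]
    simpa using congrArg Matrix.transpose hw'
  frameOne_smooth X := by
    rw [total_homogeneousLieContact]
    refine ContDiffOn.matrix_mul (ContDiffOn.matrix_mul contDiff_snd.snd.contDiffOn contDiffOn_const)
      (ContDiffOn.matrix_inv contDiff_snd.fst.contDiffOn fun u hu => hu.2.2.2.1.ne')
  frameOne_injective u hu := by
    rw [total_homogeneousLieContact] at hu
    exact frameOne_injective hu
  frameOne_range u hu := by
    rw [total_homogeneousLieContact] at hu
    ext w
    refine ⟨?_, fun hw => ⟨_, frameOne_transpose_mul hu hw⟩⟩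
    rintro ⟨X, rfl⟩
    exact transpose_mul_frameOne hu X
  frameOne_act u _ a _ X := by
    change u.2.2 * a.2 * X * (u.2.1 * a.1)⁻¹ = u.2.2 * (a.2 * X * a.1⁻¹) * u.2.1⁻¹
    rw [Matrix.mul_inv_rev]
    simp only [Matrix.mul_assoc]
  frameTwo_smooth Y := by
    rw [total_homogeneousLieContact]
    have h : ContDiffOn ℝ ∞ (fun u : FrameSpace n => u.2.1⁻¹) (lieTotal n) :=
      ContDiffOn.matrix_inv contDiff_snd.fst.contDiffOn fun u hu => hu.2.2.2.1.ne'
    exact contDiff_fst.contDiffOn.matrix_mul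
      ((h.matrix_transpose.matrix_mul contDiffOn_const).matrix_mul h)
  phiTwo_injective u hu := by
    rw [total_homogeneousLieContact] at hu
    exact phiTwo_injective hu
  phiTwo_range u hu := by
    rw [total_homogeneousLieContact] at hu
    refine le_antisymm ?_ ?_
    · rintro _ ⟨Y, rfl⟩
      refine ⟨_, ?_, rfl⟩
      change (homogeneousLieContact n).frameTwo u Y ∈ tangentSpaceAt (stiefel n) u.1
      have h := transpose_mul_frameTwo hu Y
      have hY : (Y : Matrix (Fin 2) (Fin 2) ℝ)ᵀ = -(Y : Matrix (Fin 2) (Fin 2) ℝ) := Y.2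
      rw [mem_tangentSpaceAt_stiefel hu.1, ← Matrix.transpose_transpose (_ * u.1),
        Matrix.transpose_mul, Matrix.transpose_transpose, h]
      simp only [Matrix.transpose_mul, Matrix.transpose_transpose, hY, Matrix.mul_neg,
        Matrix.neg_mul, Matrix.mul_assoc]
      exact add_neg_cancel _
    · rintro _ ⟨w, hw, rfl⟩
      exact ⟨_, phiTwo_skewProj hu hw⟩
  frameTwo_act u hu a ha Y := by
    have : (homogeneousLieContact n).frameTwo ((homogeneousLieContact n).act u a) Y =
        (homogeneousLieContact n).frameTwo u (adTwo a Y) := by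
      change u.1 * (((u.2.1 * a.1)⁻¹)ᵀ * (Y : Matrix (Fin 2) (Fin 2) ℝ) * (u.2.1 * a.1)⁻¹) =
        u.1 * ((u.2.1⁻¹)ᵀ * ((a.1⁻¹)ᵀ * (Y : Matrix (Fin 2) (Fin 2) ℝ) * a.1⁻¹) * u.2.1⁻¹)
      rw [Matrix.mul_inv_rev, Matrix.transpose_mul]
      simp only [Matrix.mul_assoc]
    rw [this, sub_self]
    exact Submodule.zero_mem _
  levi ξ η hξ hη hξH hηH u hu X₁ X₂ h₁ h₂ := by
    rw [total_homogeneousLieContact] at hu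
    have h3 := hu.2.2.1
    refine mkQ_eq_mkQ_iff.2 ?_
    refine (transpose_mul_frameTwo hu _).trans ?_
    refine Eq.trans ?_ (transpose_mul_lieBracketWithin hξ hη hξH hηH hu.1).symm
    change u.2.2 * X₁ * u.2.1⁻¹ = ξ u.1 at h₁
    change u.2.2 * X₂ * u.2.1⁻¹ = η u.1 at h₂
    change (u.2.1⁻¹)ᵀ * (X₂ᵀ * X₁ - X₁ᵀ * X₂) * u.2.1⁻¹ = _
    have key : ∀ X X' : Matrix (Fin n) (Fin 2) ℝ, (u.2.2 * X * u.2.1⁻¹)ᵀ * (u.2.2 * X' * u.2.1⁻¹) =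
        (u.2.1⁻¹)ᵀ * (Xᵀ * X') * u.2.1⁻¹ := fun X X' => by
      calc _ = (u.2.1⁻¹)ᵀ * (Xᵀ * ((u.2.2ᵀ * u.2.2) * X')) * u.2.1⁻¹ := by
            simp only [Matrix.transpose_mul, Matrix.mul_assoc]
        _ = _ := by rw [h3, Matrix.one_mul]
    rw [← h₁, ← h₂, key, key, Matrix.mul_sub, Matrix.sub_mul]

theorem fderivWithin_fst_apply {u w : FrameSpace n} (hw : w ∈ tangentSpaceAt (lieTotal n) u) :
    fderivWithin ℝ (homogeneousLieContact n).proj (lieTotal n) u w = w.1 :=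
  fderivWithin_continuousLinearMap_apply (ContinuousLinearMap.fst ℝ _ _) hw

theorem fderivWithin_proj_apply {u w : FrameSpace n} (hw : w ∈ tangentSpaceAt (lieTotal n) u) :
    fderivWithin ℝ (homogeneousLieContact n).proj (homogeneousLieContact n).total u w = w.1 := by
  rw [total_homogeneousLieContact]
  exact fderivWithin_fst_apply hw

theorem fst_mem_tangentSpaceAt_stiefel {u w : FrameSpace n} (hu : u ∈ lieTotal n)
    (hw : w ∈ tangentSpaceAt (lieTotal n) u) : w.1 ∈ tangentSpaceAt (stiefel n) u.1 :=
  (mem_tangentSpaceAt_stiefel hu.1).2 ((mem_tangentSpaceAt_lieTotal hu).1 hw).1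

theorem thetaOne_eq {u w : FrameSpace n} (hu : u ∈ lieTotal n)
    (hw : w ∈ tangentSpaceAt (lieTotal n) u) (hH : u.1ᵀ * w.1 = 0) :
    (homogeneousLieContact n).thetaOne u w = u.2.2ᵀ * w.1 * u.2.1 := by
  refine Eq.trans (congrArg (Function.invFun ((homogeneousLieContact n).frameOne u)) ?_)
    (Function.leftInverse_invFun (frameOne_injective hu) _)
  exact (fderivWithin_proj_apply hw).trans (frameOne_transpose_mul hu hH).symm

theorem thetaTwo_eq {u w : FrameSpace n} (hu : u ∈ lieTotal n)
    (hw : w ∈ tangentSpaceAt (lieTotal n) u) :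
    (homogeneousLieContact n).thetaTwo u w = skewProj (u.2.1ᵀ * (u.1ᵀ * w.1) * u.2.1) := by
  refine Eq.trans (congrArg (Function.invFun ((homogeneousLieContact n).phiTwo u)) ?_)
    (Function.leftInverse_invFun (phiTwo_injective hu) _)
  refine (congrArg ((homogeneousLieContact n).H u.1).mkQ (fderivWithin_proj_apply hw)).trans ?_
  exact (phiTwo_skewProj hu (fst_mem_tangentSpaceAt_stiefel hu hw)).symm

end LieContact

/-! ### The center of `K♯` and the symmetry that it generates -/

section CenterSymmetry

variable {n : ℕ}

theorem sign_mem_SO {m : Type} [Fintype m] [DecidableEq m] {j l : m} (hjl : j ≠ l) :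
    Matrix.diagonal (fun i => if i = j ∨ i = l then (-1 : ℝ) else 1) ∈
      Matrix.specialOrthogonalGroup m ℝ := by
  rw [mem_SO_iff, Matrix.diagonal_transpose, Matrix.diagonal_mul_diagonal, Matrix.det_diagonal]
  constructor
  · rw [← Matrix.diagonal_one]
    congr 1; ext i; split_ifs <;> norm_num
  · rw [Finset.prod_ite, Finset.prod_const_one, mul_one, Finset.prod_const]
    have : (Finset.univ.filter fun i => i = j ∨ i = l) = {j, l} := by
      ext i; simp
    rw [this, Finset.card_pair hjl]
    norm_num

/-- A skew-symmetric matrix of size at least three that commutes with the special orthogonal group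
vanishes. -/
theorem eq_zero_of_commute_SO {m : Type} [Fintype m] [DecidableEq m] (hm : 2 < Fintype.card m)
    {S : Matrix m m ℝ} (hS : Sᵀ = -S)
    (hcomm : ∀ B ∈ Matrix.specialOrthogonalGroup m ℝ, S * B = B * S) : S = 0 := by
  ext i j
  by_cases hij : i = j
  · subst hij
    have : S i i = -S i i := congrFun (congrFun hS i) i
    change S i i = 0
    linarith
  · -- the diagonal matrix with entries `-1` at `j` and at a third index `l` changes the sign of `S i j`
    obtain ⟨l, hl⟩ := Finset.exists_mem_notMem_of_card_lt_card (s := {i, j}) (t := Finset.univ)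
      (by rw [Finset.card_pair hij]; exact hm)
    simp only [Finset.mem_univ, Finset.mem_insert, Finset.mem_singleton, not_or, true_and] at hl
    have h := congrFun (congrFun (hcomm _ (sign_mem_SO (Ne.symm hl.2))) i) j
    rw [Matrix.mul_diagonal, Matrix.diagonal_mul] at h
    simp only [true_or, if_true, hij, Ne.symm hl.1, or_self, if_false] at h
    change S i j = 0
    linarith

/-- The Lie algebra of `Z(K♯)` is that of the factor `SO(2)`: differentiating at `t = 0` the facts that
`exp (t Z)` is block diagonal, orthogonal and central shows that `Z` is block diagonal,
skew-symmetric and commutes with `K♯`. -/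
theorem exists_eq_of_mem_lieCenterKsharp (hn : 0 < n) {Z : Matrix (Big n) (Big n) ℝ}
    (hZ : Z ∈ lieCenterKsharp n) (hZ0 : Z ≠ 0) :
    ∃ c : ℝ, c ≠ 0 ∧ Z = Matrix.fromBlocks (c • eps) 0 0 0 := by
  have hd := hasDerivAt_exp_smul_zero Z
  have hoff : ∀ i j, (∀ t : ℝ, NormedSpace.exp (t • Z) i j = 0) → Z i j = 0 := by
    intro i j h
    have h1 := hd.matrix_entry i j
    simp only [h] at h1
    exact (hasDerivAt_const (0 : ℝ) (0 : ℝ)).unique h1 |>.symm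
  have h12 : Z.toBlocks₁₂ = 0 := by
    ext i j
    refine hoff _ _ fun t => ?_
    obtain ⟨⟨A, -, B, -, h⟩, -⟩ := hZ t
    rw [h]; rfl
  have h21 : Z.toBlocks₂₁ = 0 := by
    ext i j
    refine hoff _ _ fun t => ?_
    obtain ⟨⟨A, -, B, -, h⟩, -⟩ := hZ t
    rw [h]; rfl
  have hskew : Zᵀ = -Z := by
    have h1 : HasDerivAt (fun t : ℝ => (NormedSpace.exp (t • Z))ᵀ * NormedSpace.exp (t • Z))
        ((NormedSpace.exp ((0 : ℝ) • Z))ᵀ * Z + Zᵀ * NormedSpace.exp ((0 : ℝ) • Z)) 0 :=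
      HasDerivAt.matrix_mul (.of_matrix_entry fun i j => hd.matrix_entry j i) hd
    have h2 : (fun t : ℝ => (NormedSpace.exp (t • Z))ᵀ * NormedSpace.exp (t • Z)) = fun _ => 1 := by
      funext t
      obtain ⟨⟨A, hA, B, hB, h⟩, -⟩ := hZ t
      rw [h, Matrix.fromBlocks_transpose, Matrix.fromBlocks_multiply]
      simp [(transpose_mul_self_of_mem_SO hA).1, (transpose_mul_self_of_mem_SO hB).1,
        Matrix.fromBlocks_one]
    rw [h2] at h1
    have h3 := h1.unique (hasDerivAt_const (0 : ℝ) (1 : Matrix (Big n) (Big n) ℝ))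
    simp only [zero_smul, NormedSpace.exp_zero, Matrix.transpose_one, Matrix.one_mul,
      Matrix.mul_one] at h3
    exact eq_neg_of_add_eq_zero_right h3
  have hcomm : ∀ k ∈ groupKsharp n, Z * k = k * Z := by
    intro k hk
    have h1 := hd.matrix_mul (hasDerivAt_const (0 : ℝ) k)
    have h2 := HasDerivAt.matrix_mul (hasDerivAt_const (0 : ℝ) k) hd
    have h3 : (fun t : ℝ => NormedSpace.exp (t • Z) * k) = fun t : ℝ => k * NormedSpace.exp (t • Z) :=
      funext fun t => (hZ t).2 k hk
    rw [h3] at h1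
    simpa using h1.unique h2
  have hZb := Matrix.fromBlocks_toBlocks Z
  rw [h12, h21] at hZb
  have hskew' := hskew
  rw [← hZb, Matrix.fromBlocks_transpose, Matrix.fromBlocks_neg, Matrix.fromBlocks_inj] at hskew'
  have h22 : Z.toBlocks₂₂ = 0 := by
    refine eq_zero_of_commute_SO (by simp; omega) hskew'.2.2.2 fun B hB => ?_
    have h := hcomm (Matrix.fromBlocks 1 0 0 B) ⟨1, one_mem _, B, hB, rfl⟩
    rw [← hZb, Matrix.fromBlocks_multiply, Matrix.fromBlocks_multiply, Matrix.fromBlocks_inj] at h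
    simpa using h.2.2.2
  have h11 := eq_smul_eps_of_transpose_eq_neg hskew'.1
  rw [h22, h11] at hZb
  refine ⟨_, fun h0 => hZ0 ?_, hZb.symm⟩
  rw [← hZb, h0, zero_smul, Matrix.fromBlocks_zero]

theorem actionGenerator_eq (c : ℝ) (x : Matrix (Idx n) (Fin 2) ℝ) :
    actionGenerator (Matrix.fromBlocks (c • eps) 0 0 0) x = -(c • (x * eps)) := by
  set Z : Matrix (Big n) (Big n) ℝ := Matrix.fromBlocks (c • eps) 0 0 0 with hZ
  have hd := hasDerivAt_exp_smul_zero Z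
  have h11 : HasDerivAt (fun t : ℝ => (NormedSpace.exp (t • Z)).toBlocks₁₁) Z.toBlocks₁₁ 0 :=
    .of_matrix_entry fun i j => hd.matrix_entry _ _
  have h12 : HasDerivAt (fun t : ℝ => (NormedSpace.exp (t • Z)).toBlocks₁₂) Z.toBlocks₁₂ 0 :=
    .of_matrix_entry fun i j => hd.matrix_entry _ _
  have h21 : HasDerivAt (fun t : ℝ => (NormedSpace.exp (t • Z)).toBlocks₂₁) Z.toBlocks₂₁ 0 :=
    .of_matrix_entry fun i j => hd.matrix_entry _ _
  have h22 : HasDerivAt (fun t : ℝ => (NormedSpace.exp (t • Z)).toBlocks₂₂) Z.toBlocks₂₂ 0 :=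
    .of_matrix_entry fun i j => hd.matrix_entry _ _
  have e0 : NormedSpace.exp ((0 : ℝ) • Z) = Matrix.fromBlocks 1 0 0 1 := by
    rw [zero_smul, NormedSpace.exp_zero, Matrix.fromBlocks_one]
  have hx := hasDerivAt_const (0 : ℝ) x
  have h := (h21.fun_add (h22.matrix_mul hx)).matrix_mul_inv (h11.fun_add (h12.matrix_mul hx)) (by
    simp only [e0, Matrix.toBlocks_fromBlocks₁₁, Matrix.toBlocks_fromBlocks₁₂]; simp)
  refine h.deriv.trans ?_
  simp only [e0, Matrix.toBlocks_fromBlocks₁₁, Matrix.toBlocks_fromBlocks₁₂,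
    Matrix.toBlocks_fromBlocks₂₁, Matrix.toBlocks_fromBlocks₂₂]
  simp [hZ]

theorem neg_smul_mul_eps_transpose_mul (c : ℝ) (x : Matrix (Idx n) (Fin 2) ℝ) {m : Type}
    (w : Matrix (Idx n) m ℝ) : (-(c • (x * eps)))ᵀ * w = c • (eps * (xᵀ * w)) := by
  rw [Matrix.transpose_neg, Matrix.transpose_smul, Matrix.transpose_mul, transpose_eps,
    Matrix.neg_mul, Matrix.smul_mul, Matrix.neg_mul, Matrix.neg_mul, smul_neg, neg_neg,
    Matrix.mul_assoc]

theorem transpose_mul_neg_smul_mul_eps (c : ℝ) {x : Matrix (Idx n) (Fin 2) ℝ} (hx : xᵀ * x = 1) :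
    xᵀ * -(c • (x * eps)) = -(c • eps) := by
  rw [Matrix.mul_neg, Matrix.mul_smul, ← Matrix.mul_assoc, hx, Matrix.one_mul]

/-- The lift of the vector field `x ↦ -c x ε` (with `ε` the rotation `eps`) to the bundle of adapted
frames: the plane spanned by `x` is unchanged, so `A` has to rotate in the opposite sense. -/
noncomputable def liftField (n : ℕ) (c : ℝ) : FrameSpace n →L[ℝ] FrameSpace n :=
  LinearMap.toContinuousLinearMap
    { toFun := fun u => (-(c • (u.1 * eps)), c • (eps * u.2.1), 0)
      map_add' := by
        intro u v
        simp only [Prod.fst_add, Prod.snd_add, Matrix.add_mul, Matrix.mul_add, smul_add, neg_add,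
          Prod.mk_add_mk, add_zero]
      map_smul' := by
        intro r u
        simp only [Prod.smul_fst, Prod.smul_snd, Matrix.smul_mul, Matrix.mul_smul, RingHom.id_apply,
          Prod.smul_mk, smul_zero, smul_neg, smul_comm c r] }

theorem liftField_apply (c : ℝ) (u : FrameSpace n) :
    liftField n c u = (-(c • (u.1 * eps)), c • (eps * u.2.1), 0) := rfl

theorem isVectorField_liftField (c : ℝ) : IsVectorField (lieTotal n) (liftField n c) where
  smooth := (liftField n c).contDiff.contDiffOn
  tangent u hu := by
    rw [mem_tangentSpaceAt_lieTotal hu, liftField_apply]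
    obtain ⟨h1, h2, h3, -⟩ := hu
    refine ⟨?_, ?_, ?_⟩
    · rw [transpose_mul_neg_smul_mul_eps c h1, neg_smul_mul_eps_transpose_mul,
        show u.1ᵀ * u.1 = 1 from h1, Matrix.mul_one]
      exact neg_add_cancel _
    · rw [neg_smul_mul_eps_transpose_mul, h2]
      simp
    · simp

/-- The lift preserves `θ₋₁` and `θ₋₂`.  For a linear vector field the bracket with `η` is
`D η - L η`, so that both sides of the two identities are explicit matrix expressions. -/
theorem isLift_liftField (c : ℝ) :
    (homogeneousLieContact n).IsLift (fun x => -(c • (x * eps))) (liftField n c) := by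
  have hbr : ∀ {η : FrameSpace n → FrameSpace n}, IsVectorField (lieTotal n) η →
      ∀ u ∈ lieTotal n, VectorField.lieBracketWithin ℝ (liftField n c) η (lieTotal n) u =
        fderivWithin ℝ η (lieTotal n) u (liftField n c u) - liftField n c (η u) := by
    intro η hη u hu
    exact congrArg₂ (· - ·) rfl (fderivWithin_continuousLinearMap_apply _ (hη.tangent u hu))
  have hξ := isVectorField_liftField (n := n) c
  have hdx : ∀ u : FrameSpace n, HasFDerivWithinAt (fun v : FrameSpace n => v.1)
      (ContinuousLinearMap.fst ℝ _ _) (lieTotal n) u := fun u => hasFDerivWithinAt_fst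
  have hdA : ∀ u : FrameSpace n, HasFDerivWithinAt (fun v : FrameSpace n => v.2.1)
      ((ContinuousLinearMap.fst ℝ _ _) ∘L (ContinuousLinearMap.snd ℝ _ _)) (lieTotal n) u :=
    fun u => hasFDerivWithinAt_snd.fst
  have hdC : ∀ u : FrameSpace n, HasFDerivWithinAt (fun v : FrameSpace n => v.2.2)
      ((ContinuousLinearMap.snd ℝ _ _) ∘L (ContinuousLinearMap.snd ℝ _ _)) (lieTotal n) u :=
    fun u => hasFDerivWithinAt_snd.snd
  have hdη : ∀ {η : FrameSpace n → FrameSpace n}, IsVectorField (lieTotal n) η → ∀ u ∈ lieTotal n,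
      HasFDerivWithinAt (fun v => (η v).1) ((ContinuousLinearMap.fst ℝ _ _) ∘L
        fderivWithin ℝ η (lieTotal n) u) (lieTotal n) u := fun hη u hu =>
    (((hη.smooth u hu).differentiableWithinAt (by simp)).hasFDerivWithinAt).fst
  constructor
  · rw [total_homogeneousLieContact]; exact hξ
  · intro u hu
    rw [total_homogeneousLieContact] at hu
    exact (fderivWithin_proj_apply (hξ.tangent u hu)).trans rfl
  · rw [total_homogeneousLieContact]
    intro u hu a ha
    have h : HasFDerivWithinAt (fun v : FrameSpace n => (v.1, v.2.1 * a.1, v.2.2 * a.2)) _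
        (lieTotal n) u :=
      (hdx u).prodMk ((HasFDerivWithinAt.matrix_mul (hdA u)
        (hasFDerivWithinAt_const a.1 u (lieTotal n))).prodMk
        (HasFDerivWithinAt.matrix_mul (hdC u) (hasFDerivWithinAt_const a.2 u (lieTotal n))))
    refine (h.fderivWithin_apply (hξ.tangent u hu)).trans ?_
    change (-(c • (u.1 * eps)), u.2.1 * (0 : Matrix (Fin 2) (Fin 2) ℝ) + c • (eps * u.2.1) * a.1,
      u.2.2 * (0 : Matrix (Fin n) (Fin n) ℝ) + (0 : Matrix (Idx n) (Fin n) ℝ) * a.2) =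
      (-(c • (u.1 * eps)), c • (eps * (u.2.1 * a.1)), 0)
    simp only [Matrix.mul_zero, Matrix.zero_mul, add_zero, zero_add, Matrix.smul_mul, Matrix.mul_assoc]
  · rw [total_homogeneousLieContact]
    intro η hη u hu
    have hbt := lieBracketWithin_mem_tangentSpaceAt_lieTotal hu hξ hη
    rw [thetaTwo_eq hu hbt, hbr hη u hu]
    have h : HasFDerivWithinAt (fun v : FrameSpace n =>
        skewProj (v.2.1ᵀ * (v.1ᵀ * (η v).1) * v.2.1)) _ (lieTotal n) u :=
      skewProj.hasFDerivAt.comp_hasFDerivWithinAt u (HasFDerivWithinAt.matrix_mul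
        (HasFDerivWithinAt.matrix_mul (HasFDerivWithinAt.matrix_transpose (hdA u))
          (HasFDerivWithinAt.matrix_mul (HasFDerivWithinAt.matrix_transpose (hdx u)) (hdη hη u hu)))
        (hdA u))
    refine (h.fderivWithin_apply_of_eqOn (fun v hv => thetaTwo_eq hv (hη.tangent v hv)) hu
      (hξ.tangent u hu)).trans ?_
    set D := fderivWithin ℝ η (lieTotal n) u (liftField n c u) with hD
    refine congrArg skewProj ?_
    change u.2.1ᵀ * (u.1ᵀ * (η u).1) * (c • (eps * u.2.1)) +
      (u.2.1ᵀ * (u.1ᵀ * D.1 + (-(c • (u.1 * eps)))ᵀ * (η u).1) +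
        (c • (eps * u.2.1))ᵀ * (u.1ᵀ * (η u).1)) * u.2.1 =
      u.2.1ᵀ * (u.1ᵀ * (D.1 - -(c • ((η u).1 * eps)))) * u.2.1
    simp only [Matrix.transpose_neg, Matrix.transpose_smul, Matrix.transpose_mul, transpose_eps,
      Matrix.mul_neg, Matrix.neg_mul, Matrix.mul_smul, Matrix.smul_mul, Matrix.mul_add,
      Matrix.add_mul, Matrix.mul_assoc, sub_neg_eq_add, smul_neg, neg_neg]
    abel
  · rw [total_homogeneousLieContact]
    intro η hη hηH u hu
    have hηH' : ∀ v ∈ lieTotal n, v.1ᵀ * (η v).1 = 0 := by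
      intro v hv
      exact (congrArg (v.1ᵀ * ·) (fderivWithin_fst_apply (hη.tangent v hv))).symm.trans (hηH v hv)
    have hbt := lieBracketWithin_mem_tangentSpaceAt_lieTotal hu hξ hη
    have hH : u.1ᵀ * (VectorField.lieBracketWithin ℝ (liftField n c) η (lieTotal n) u).1 = 0 := by
      rw [hbr hη u hu]
      -- `xᵀ η` vanishes identically, hence so does its derivative along the lift
      have h := (HasFDerivWithinAt.matrix_mul (HasFDerivWithinAt.matrix_transpose (hdx u))
        (hdη hη u hu)).apply_eq_zero_of_eqOn isOpen_univ (Set.mem_univ u) hu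
          (fun v hv => hηH' v hv.1) (hξ.tangent u hu)
      set D := fderivWithin ℝ η (lieTotal n) u (liftField n c u) with hD
      have h' : u.1ᵀ * D.1 + (-(c • (u.1 * eps)))ᵀ * (η u).1 = 0 := h
      change u.1ᵀ * (D.1 - -(c • ((η u).1 * eps))) = 0
      have e1 := hηH' u hu
      simp only [Matrix.transpose_neg, Matrix.transpose_smul, Matrix.transpose_mul, Matrix.neg_mul,
        Matrix.smul_mul, Matrix.mul_assoc, e1, Matrix.mul_zero, smul_zero, neg_zero, add_zero] at h'
      rw [Matrix.mul_sub, h', Matrix.mul_neg, Matrix.mul_smul, ← Matrix.mul_assoc, e1,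
        Matrix.zero_mul, smul_zero, neg_zero, sub_zero]
    refine ⟨?_, ?_⟩
    · exact (congrArg (u.1ᵀ * ·) (fderivWithin_fst_apply hbt)).trans hH
    · rw [thetaOne_eq hu hbt hH, hbr hη u hu]
      have h : HasFDerivWithinAt (fun v : FrameSpace n => v.2.2ᵀ * (η v).1 * v.2.1) _
          (lieTotal n) u :=
        HasFDerivWithinAt.matrix_mul
          (HasFDerivWithinAt.matrix_mul (HasFDerivWithinAt.matrix_transpose (hdC u)) (hdη hη u hu))
          (hdA u)
      refine (h.fderivWithin_apply_of_eqOn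
        (fun v hv => thetaOne_eq hv (hη.tangent v hv) (hηH' v hv)) hu
        (hξ.tangent u hu)).trans ?_
      set D := fderivWithin ℝ η (lieTotal n) u (liftField n c u) with hD
      change u.2.2ᵀ * (η u).1 * (c • (eps * u.2.1)) +
        (u.2.2ᵀ * D.1 + (0 : Matrix (Idx n) (Fin n) ℝ)ᵀ * (η u).1) * u.2.1 =
        u.2.2ᵀ * (D.1 - -(c • ((η u).1 * eps))) * u.2.1
      simp only [Matrix.transpose_zero, Matrix.zero_mul, Matrix.mul_smul, Matrix.smul_mul,
        Matrix.mul_add, Matrix.add_mul, Matrix.mul_assoc, sub_neg_eq_add, add_zero]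
      abel

theorem eps_ne_zero : eps ≠ 0 := fun h => by
  have := congrFun (congrFun h 1) 0
  simp [eps] at this

theorem isTransversalSymmetry {c : ℝ} (hc : c ≠ 0) :
    (homogeneousLieContact n).IsTransversalSymmetry (stiefel n) (fun x => -(c • (x * eps))) where
  vectorField :=
    { smooth := ((contDiffOn_id.matrix_mul contDiffOn_const).const_smul c).neg
      tangent := fun x hx => by
        have hx' : xᵀ * x = 1 := hx
        rw [mem_tangentSpaceAt_stiefel hx]
        rw [transpose_mul_neg_smul_mul_eps c hx', neg_smul_mul_eps_transpose_mul, hx',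
          Matrix.mul_one]
        exact neg_add_cancel _ }
  symmetry := ⟨_, isLift_liftField c⟩
  transversal x hx h := by
    have hx' : xᵀ * x = 1 := hx
    have h' : xᵀ * -(c • (x * eps)) = 0 := h
    rw [transpose_mul_neg_smul_mul_eps c hx', neg_eq_zero] at h'
    exact (smul_ne_zero hc eps_ne_zero) h'

end CenterSymmetry

/-! ### The Grassmannian of oriented planes -/

section Grassmannian

variable {n : ℕ}

theorem transpose_mul_self_of_commute_eps {M : Matrix (Fin 2) (Fin 2) ℝ} (h : eps * M = M * eps) :
    Mᵀ * M = M.det • 1 := by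
  have h1 := transpose_mul_eps_mul M
  rw [Matrix.mul_assoc, h, ← Matrix.mul_assoc] at h1
  have h2 := congrArg (· * -eps) h1
  simpa [Matrix.mul_assoc, eps_mul_eps] using h2

theorem mul_mem_stiefel {x : Matrix (Idx n) (Fin 2) ℝ} (hx : x ∈ stiefel n)
    {R : Matrix (Fin 2) (Fin 2) ℝ} (hR : Rᵀ * R = 1) : x * R ∈ stiefel n := by
  have hx' : xᵀ * x = 1 := hx
  change (x * R)ᵀ * (x * R) = 1
  rw [Matrix.transpose_mul, Matrix.mul_assoc, ← Matrix.mul_assoc xᵀ, hx', Matrix.one_mul, hR]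

theorem contDiff_orientedSpan {k : WithTop ℕ∞} : ContDiff ℝ k (orientedSpan (n := n)) := by
  have h : orientedSpan (n := n) = fun x => x * eps * xᵀ := funext orientedSpan_eq
  rw [h]
  exact (contDiff_id.matrix_mul contDiff_const).matrix_mul contDiff_id.matrix_transpose

/-- The local section `J ↦ y(J)` of the bundle of orthonormal frames over the Grassmannian: the
complex linear part of `x₀` with respect to `J`, up to a positive factor. -/
theorem exists_local_section {x₀ : Matrix (Idx n) (Fin 2) ℝ} (hx₀ : x₀ ∈ stiefel n) :
    ∃ (O : Set (Matrix (Idx n) (Idx n) ℝ)) (y : Matrix (Idx n) (Idx n) ℝ → Matrix (Idx n) (Fin 2) ℝ),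
      IsOpen O ∧ orientedSpan x₀ ∈ O ∧ ContDiffOn ℝ ∞ y O ∧ y (orientedSpan x₀) = x₀ ∧
      ∀ J ∈ orientedGrassmannian n ∩ O, y J ∈ stiefel n ∧ orientedSpan (y J) = J := by
  let N : Matrix (Idx n) (Idx n) ℝ → Matrix (Idx n) (Fin 2) ℝ := fun J =>
    -(J * (J * x₀)) - J * (x₀ * eps)
  let r : Matrix (Idx n) (Idx n) ℝ → ℝ := fun J => ((N J)ᵀ * N J) 0 0
  have hN : ContDiff ℝ ∞ N :=
    (contDiff_id.matrix_mul (contDiff_id.matrix_mul contDiff_const)).neg.sub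
      (contDiff_id.matrix_mul contDiff_const)
  have hr : ContDiff ℝ ∞ r := (hN.matrix_transpose.matrix_mul hN).matrix_entry 0 0
  have hNx : ∀ x ∈ stiefel n, ∃ M : Matrix (Fin 2) (Fin 2) ℝ, N (orientedSpan x) = x * M ∧
      Mᵀ * M = M.det • 1 ∧ r (orientedSpan x) = M.det ∧
      M = xᵀ * x₀ - eps * (xᵀ * x₀) * eps := by
    intro x hx
    have hx' : xᵀ * x = 1 := hx
    have h1 : N (orientedSpan x) = x * (xᵀ * x₀ - eps * (xᵀ * x₀) * eps) := by
      change -(orientedSpan x * (orientedSpan x * x₀)) - orientedSpan x * (x₀ * eps) = _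
      have h2 : orientedSpan x * (orientedSpan x * x₀) = -(x * (xᵀ * x₀)) := by
        calc orientedSpan x * (orientedSpan x * x₀) = x * (eps * (xᵀ * x) * eps) * (xᵀ * x₀) := by
              rw [orientedSpan_eq]; simp only [Matrix.mul_assoc]
          _ = _ := by
              rw [hx', Matrix.mul_one, eps_mul_eps]; simp
      rw [h2, neg_neg, orientedSpan_eq, Matrix.mul_sub]
      simp only [Matrix.mul_assoc]
    have h2 : eps * (xᵀ * x₀ - eps * (xᵀ * x₀) * eps) =
        (xᵀ * x₀ - eps * (xᵀ * x₀) * eps) * eps := by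
      generalize xᵀ * x₀ = B
      rw [Matrix.mul_sub, Matrix.sub_mul, Matrix.mul_assoc _ eps eps, eps_mul_eps,
        Matrix.mul_assoc eps B, ← Matrix.mul_assoc eps eps, eps_mul_eps]
      simp only [Matrix.neg_mul, Matrix.mul_neg, Matrix.one_mul, Matrix.mul_one]
      abel
    have h3 := transpose_mul_self_of_commute_eps h2
    refine ⟨_, h1, h3, ?_, rfl⟩
    change ((N (orientedSpan x))ᵀ * N (orientedSpan x)) 0 0 = _
    rw [h1, Matrix.transpose_mul, Matrix.mul_assoc, ← Matrix.mul_assoc xᵀ x, hx', Matrix.one_mul, h3]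
    simp
  have h0 : N (orientedSpan x₀) = (2 : ℝ) • x₀ ∧ r (orientedSpan x₀) = 4 := by
    have hx' : x₀ᵀ * x₀ = 1 := hx₀
    obtain ⟨M, h1, -, h3, h4⟩ := hNx x₀ hx₀
    rw [hx', Matrix.mul_one, eps_mul_eps, sub_neg_eq_add, ← two_smul ℝ] at h4
    rw [h3, h1, h4, Matrix.mul_smul, Matrix.mul_one, Matrix.det_smul]
    norm_num
  refine ⟨{J | 0 < r J}, fun J => (Real.sqrt (r J))⁻¹ • N J,
    isOpen_lt continuous_const hr.continuous, ?_, ?_, ?_, ?_⟩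
  · change 0 < r (orientedSpan x₀)
    rw [h0.2]; norm_num
  · exact ((hr.contDiffOn.sqrt fun J (hJ : 0 < r J) => hJ.ne').inv
      fun J (hJ : 0 < r J) => (Real.sqrt_pos.2 hJ).ne').smul hN.contDiffOn
  · change (Real.sqrt (r (orientedSpan x₀)))⁻¹ • N (orientedSpan x₀) = x₀
    rw [h0.1, h0.2, show (4 : ℝ) = 2 ^ 2 by norm_num, Real.sqrt_sq (by norm_num), smul_smul]
    norm_num
  · rintro _ ⟨⟨x, hx, rfl⟩, hJ⟩
    have hJ' : 0 < r (orientedSpan x) := hJ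
    obtain ⟨M, h1, h2, h3, -⟩ := hNx x hx
    have e : (Real.sqrt (r (orientedSpan x)))⁻¹ * (Real.sqrt (r (orientedSpan x)))⁻¹ * M.det = 1 := by
      rw [← mul_inv, Real.mul_self_sqrt hJ'.le, h3, inv_mul_cancel₀]
      rw [← h3]; exact hJ'.ne'
    have h4 : (Real.sqrt (r (orientedSpan x)))⁻¹ • N (orientedSpan x) =
        x * ((Real.sqrt (r (orientedSpan x)))⁻¹ • M) := by rw [h1, Matrix.mul_smul]
    simp only [h4]
    refine ⟨mul_mem_stiefel hx ?_, ?_⟩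
    · rw [Matrix.transpose_smul, Matrix.smul_mul, Matrix.mul_smul, h2, smul_smul, smul_smul,
        e, one_smul]
    · rw [orientedSpan_mul, Matrix.det_smul]
      simp only [Fintype.card_fin, pow_two]
      rw [e, one_smul]

/-- The derivative of `orientedSpan` at `x` in the direction `w`. -/
def spanDeriv (x w : Matrix (Idx n) (Fin 2) ℝ) : Matrix (Idx n) (Idx n) ℝ :=
  w * eps * xᵀ + x * eps * wᵀ

theorem hasFDerivAt_orientedSpan (x : Matrix (Idx n) (Fin 2) ℝ) :
    ∃ D : Matrix (Idx n) (Fin 2) ℝ →L[ℝ] Matrix (Idx n) (Idx n) ℝ,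
      HasFDerivAt orientedSpan D x ∧ ∀ w, D w = spanDeriv x w := by
  have h : orientedSpan (n := n) = fun x => x * eps * xᵀ := funext orientedSpan_eq
  have hid := hasFDerivAt_id (𝕜 := ℝ) x
  refine ⟨_, h ▸ HasFDerivAt.matrix_mul (HasFDerivAt.matrix_mul hid (hasFDerivAt_const eps x))
    (HasFDerivAt.matrix_transpose hid), fun w => ?_⟩
  change x * eps * wᵀ + (x * (0 : Matrix (Fin 2) (Fin 2) ℝ) + w * eps) * xᵀ = _
  rw [Matrix.mul_zero, zero_add, add_comm, spanDeriv]

/-- A change of the frame `x` by an infinitesimal rotation does not change the oriented plane. -/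
theorem spanDeriv_horizontal {x w : Matrix (Idx n) (Fin 2) ℝ} (hw : xᵀ * w + wᵀ * x = 0) :
    spanDeriv x (w - x * (xᵀ * w)) = spanDeriv x w := by
  have hS : (xᵀ * w)ᵀ = -(xᵀ * w) := by
    rw [Matrix.transpose_mul, Matrix.transpose_transpose]
    exact eq_neg_of_add_eq_zero_right hw
  have h : x * (xᵀ * w) * eps * xᵀ + x * eps * (x * (xᵀ * w))ᵀ = 0 := by
    rw [Matrix.transpose_mul, hS, eq_smul_eps_of_transpose_eq_neg hS]
    simp only [Matrix.mul_smul, Matrix.smul_mul, Matrix.neg_mul, Matrix.mul_neg, Matrix.mul_assoc]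
    exact add_neg_cancel _
  have h' : spanDeriv x (w - x * (xᵀ * w)) = spanDeriv x w -
      (x * (xᵀ * w) * eps * xᵀ + x * eps * (x * (xᵀ * w))ᵀ) := by
    simp only [spanDeriv, Matrix.transpose_sub, Matrix.sub_mul, Matrix.mul_sub]
    abel
  rw [h', h, sub_zero]

theorem spanDeriv_mul {x w : Matrix (Idx n) (Fin 2) ℝ} (hx : xᵀ * x = 1) (hw : xᵀ * w = 0) :
    spanDeriv x w * x = w * eps := by
  have hw' : wᵀ * x = 0 := by simpa using congrArg Matrix.transpose hw
  rw [spanDeriv, Matrix.add_mul, Matrix.mul_assoc, hx, Matrix.mul_assoc _ wᵀ, hw', Matrix.mul_one,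
    Matrix.mul_zero, add_zero]

theorem spanDeriv_injOn {x w w' : Matrix (Idx n) (Fin 2) ℝ} (hx : xᵀ * x = 1) (hw : xᵀ * w = 0)
    (hw' : xᵀ * w' = 0) (h : spanDeriv x w = spanDeriv x w') : w = w' := by
  have h1 := congrArg (fun v : Matrix (Idx n) (Idx n) ℝ => v * x * -eps) h
  simpa [spanDeriv_mul hx hw, spanDeriv_mul hx hw', Matrix.mul_assoc, eps_mul_eps] using h1

theorem mem_tangentSpaceAt_grassmannian {x : Matrix (Idx n) (Fin 2) ℝ} (hx : x ∈ stiefel n)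
    {v : Matrix (Idx n) (Idx n) ℝ} :
    v ∈ tangentSpaceAt (orientedGrassmannian n) (orientedSpan x) ↔
      ∃ w : Matrix (Idx n) (Fin 2) ℝ, xᵀ * w = 0 ∧ spanDeriv x w = v := by
  have hx' : xᵀ * x = 1 := hx
  obtain ⟨D, hD, hDw⟩ := hasFDerivAt_orientedSpan x
  constructor
  · intro hv
    obtain ⟨O, y, hO, hxO, hy, hyx, hyO⟩ := exists_local_section hx
    have hmem : orientedSpan x ∈ orientedGrassmannian n := ⟨x, hx, rfl⟩
    have h1 : HasFDerivWithinAt y (fderiv ℝ y (orientedSpan x)) (orientedGrassmannian n ∩ O)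
        (orientedSpan x) :=
      (((hy.contDiffAt (hO.mem_nhds hxO)).differentiableAt (by simp)).hasFDerivAt).hasFDerivWithinAt
    rw [← tangentSpaceAt_inter_of_isOpen hO hxO] at hv
    have hw := h1.map_mem_tangentSpaceAt (T := stiefel n) (fun J hJ => (hyO J hJ).1) hv
    rw [hyx, mem_tangentSpaceAt_stiefel hx] at hw
    have h2 : HasFDerivWithinAt (fun J => orientedSpan (y J)) (D ∘L fderiv ℝ y (orientedSpan x))
        (orientedGrassmannian n ∩ O) (orientedSpan x) :=
      HasFDerivAt.comp_hasFDerivWithinAt (g := orientedSpan) (f := y) (orientedSpan x)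
        (by rw [hyx]; exact hD) h1
    have h3 : HasFDerivWithinAt (fun J => orientedSpan (y J)) (ContinuousLinearMap.id ℝ _)
        (orientedGrassmannian n ∩ O) (orientedSpan x) :=
      (hasFDerivWithinAt_id _ _).congr (fun J hJ => (hyO J hJ).2) (hyO _ ⟨hmem, hxO⟩).2
    have h4 := h2.eq_of_mem_tangentSpaceAt h3 hv
    obtain ⟨w, hw, h5⟩ : ∃ w : Matrix (Idx n) (Fin 2) ℝ, xᵀ * w + wᵀ * x = 0 ∧ spanDeriv x w = v :=
      ⟨_, hw, (hDw _).symm.trans h4⟩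
    refine ⟨w - x * (xᵀ * w), ?_, (spanDeriv_horizontal hw).trans h5⟩
    rw [Matrix.mul_sub, ← Matrix.mul_assoc, hx', Matrix.one_mul, sub_self]
  · rintro ⟨w, hw, rfl⟩
    have h : xᵀ * w + wᵀ * x = 0 := by
      rw [hw, zero_add]
      simpa using congrArg Matrix.transpose hw
    rw [← hDw]
    exact (hD.hasFDerivWithinAt (s := stiefel n)).map_mem_tangentSpaceAt
      (fun y hy => ⟨y, hy, rfl⟩) ((mem_tangentSpaceAt_stiefel hx).2 h)

/-- Gram-Schmidt process. -/
theorem exists_stiefel_mul_eq {b : Matrix (Idx n) (Fin 2) ℝ} (hb : 0 < (bᵀ * b).det) :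
    ∃ x ∈ stiefel n, ∃ A : Matrix (Fin 2) (Fin 2) ℝ, 0 < A.det ∧ b = x * A := by
  set S := bᵀ * b with hS
  have hsym : S 1 0 = S 0 1 := by
    have : Sᵀ = S := by rw [hS, Matrix.transpose_mul, Matrix.transpose_transpose]
    exact congrFun (congrFun this 0) 1
  have h00 : 0 ≤ S 0 0 := by
    rw [hS, Matrix.mul_apply]
    exact Finset.sum_nonneg fun i _ => mul_self_nonneg _
  rw [Matrix.det_fin_two, hsym] at hb
  have h00' : 0 < S 0 0 := by
    rcases h00.lt_or_eq with h | h
    · exact h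
    · rw [← h] at hb; nlinarith [mul_self_nonneg (S 0 1)]
  -- the Cholesky factor of the Gram matrix
  let s := Real.sqrt (S 0 0)
  let d := Real.sqrt (S 0 0 * S 1 1 - S 0 1 * S 0 1)
  have hs : 0 < s := Real.sqrt_pos.2 h00'
  have hd : 0 < d := Real.sqrt_pos.2 hb
  have hs2 : s * s = S 0 0 := Real.mul_self_sqrt h00
  have hd2 : d * d = S 0 0 * S 1 1 - S 0 1 * S 0 1 := Real.mul_self_sqrt hb.le
  let A : Matrix (Fin 2) (Fin 2) ℝ := !![s, S 0 1 / s; 0, d / s]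
  have hA : 0 < A.det := by
    rw [Matrix.det_fin_two]
    simp only [A, Matrix.of_apply, Matrix.cons_val', Matrix.cons_val_zero, Matrix.cons_val_one,
      Matrix.cons_val_fin_one, mul_zero, sub_zero]
    positivity
  have hAA : Aᵀ * A = S := by
    ext i j
    fin_cases i <;> fin_cases j <;>
      simp [A, Matrix.mul_apply, Fin.sum_univ_two] <;> field_simp
    · linarith
    · exact hsym.symm
    · nlinarith
  have hu : IsUnit A.det := isUnit_iff_ne_zero.2 hA.ne'
  refine ⟨b * A⁻¹, ?_, A, hA, by rw [Matrix.nonsing_inv_mul_cancel_right _ _ hu]⟩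
  change (b * A⁻¹)ᵀ * (b * A⁻¹) = 1
  rw [Matrix.transpose_mul, Matrix.mul_assoc, ← Matrix.mul_assoc bᵀ, ← hS, ← hAA,
    Matrix.mul_assoc Aᵀ, Matrix.mul_nonsing_inv _ hu, Matrix.mul_one, ← Matrix.transpose_mul,
    Matrix.mul_nonsing_inv _ hu, Matrix.transpose_one]

theorem isSubmanifold_orientedGrassmannian (hn : 0 < n) :
    IsSubmanifold (orientedGrassmannian n) (2 * n) := by
  rintro _ ⟨x₀, hx₀, rfl⟩
  obtain ⟨C₀, h0, h1, -⟩ := exists_completion hn hx₀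
  have hx₀' : x₀ᵀ * x₀ = 1 := hx₀
  have h0' : C₀ᵀ * x₀ = 0 := by simpa using congrArg Matrix.transpose h0
  have hpos : ∀ X : Matrix (Fin n) (Fin 2) ℝ, 0 < (1 + Xᵀ * X).det := fun X =>
    (Matrix.PosDef.one.add_posSemidef (Matrix.posSemidef_conjTranspose_mul_self X)).det_pos
  have hgram : ∀ X : Matrix (Fin n) (Fin 2) ℝ, (x₀ + C₀ * X)ᵀ * (x₀ + C₀ * X) = 1 + Xᵀ * X := by
    intro X
    rw [Matrix.transpose_add, Matrix.transpose_mul, Matrix.add_mul, Matrix.mul_add, Matrix.mul_add,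
      hx₀', ← Matrix.mul_assoc x₀ᵀ, h0, Matrix.mul_assoc Xᵀ, h0', Matrix.mul_assoc Xᵀ,
      ← Matrix.mul_assoc C₀ᵀ, h1]
    simp
  have hden : ∀ y : Matrix (Idx n) (Fin 2) ℝ, x₀ᵀ * orientedSpan y * x₀ = (x₀ᵀ * y).det • eps := by
    intro y
    rw [← mul_eps_mul_transpose, orientedSpan_eq, Matrix.transpose_mul, Matrix.transpose_transpose]
    simp only [Matrix.mul_assoc]
  have hψ : ∀ y : Matrix (Idx n) (Fin 2) ℝ, (x₀ᵀ * y).det ≠ 0 →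
      -((x₀ᵀ * orientedSpan y * x₀) 1 0)⁻¹ • (C₀ᵀ * orientedSpan y * x₀ * eps) =
        C₀ᵀ * y * (x₀ᵀ * y)⁻¹ := by
    intro y hy
    have hB : IsUnit (x₀ᵀ * y).det := isUnit_iff_ne_zero.2 hy
    have h2 : eps * (yᵀ * x₀) * eps = -((x₀ᵀ * y).det • (x₀ᵀ * y)⁻¹) := by
      have h3 := congrArg (fun z => (x₀ᵀ * y)⁻¹ * z * eps) (mul_eps_mul_transpose (x₀ᵀ * y))
      simp only [Matrix.mul_smul, Matrix.smul_mul, Matrix.mul_assoc, eps_mul_eps] at h3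
      rw [← Matrix.mul_assoc x₀ᵀ, Matrix.nonsing_inv_mul_cancel_left _ _ hB, Matrix.transpose_mul,
        Matrix.transpose_transpose, Matrix.mul_neg, Matrix.mul_one, smul_neg] at h3
      rw [← h3]
      simp only [Matrix.mul_assoc]
    have h3 : C₀ᵀ * orientedSpan y * x₀ * eps = C₀ᵀ * y * (eps * (yᵀ * x₀) * eps) := by
      rw [orientedSpan_eq]; simp only [Matrix.mul_assoc]
    have h4 : (x₀ᵀ * orientedSpan y * x₀) 1 0 = (x₀ᵀ * y).det := by
      rw [hden]; simp [eps]
    rw [h3, h2, h4, Matrix.mul_neg, Matrix.mul_smul, neg_smul, smul_neg, neg_neg, smul_smul,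
      inv_mul_cancel₀ hy, one_smul]
  -- the affine chart: planes that are graphs over the plane of `x₀`
  refine IsSubmanifold.of_hasSmoothChart (G := Matrix (Fin n) (Fin 2) ℝ)
    (by rw [Module.finrank_matrix]; simp [mul_comm]) ⟨{J | 0 < (x₀ᵀ * J * x₀) 1 0}, Set.univ,
      fun J => -((x₀ᵀ * J * x₀) 1 0)⁻¹ • (C₀ᵀ * J * x₀ * eps),
      fun X => (Real.sqrt (1 + Xᵀ * X).det)⁻¹ • orientedSpan (x₀ + C₀ * X), ?_, ?_, isOpen_univ,
      ?_, ?_, fun _ _ => Set.mem_univ _, ?_, ?_, ?_⟩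
  · refine isOpen_lt continuous_const (ContDiff.continuous (n := ∞) (𝕜 := ℝ) ?_)
    exact ((contDiff_const.matrix_mul contDiff_id).matrix_mul contDiff_const).matrix_entry 1 0
  · change 0 < (x₀ᵀ * orientedSpan x₀ * x₀) 1 0
    rw [hden, hx₀', Matrix.det_one, one_smul]
    simp [eps]
  · have h2 : ContDiffOn ℝ ∞ (fun J : Matrix (Idx n) (Idx n) ℝ => x₀ᵀ * J * x₀)
        {J | 0 < (x₀ᵀ * J * x₀) 1 0} :=
      (contDiffOn_const.matrix_mul contDiffOn_id).matrix_mul contDiffOn_const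
    exact ((h2.matrix_entry 1 0).inv fun J hJ => ne_of_gt hJ).neg.smul
      (((contDiffOn_const.matrix_mul contDiffOn_id).matrix_mul contDiffOn_const).matrix_mul
        contDiffOn_const)
  · have h2 : ContDiff ℝ ∞ fun X : Matrix (Fin n) (Fin 2) ℝ => (1 + Xᵀ * X).det :=
      (contDiff_const.add (contDiff_id.matrix_transpose.matrix_mul contDiff_id)).matrix_det
    exact (((h2.sqrt fun X => (hpos X).ne').inv fun X => (Real.sqrt_pos.2 (hpos X)).ne').smul
      (contDiff_orientedSpan.comp (contDiff_const.add
        (contDiff_const.matrix_mul contDiff_id)))).contDiffOn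
  · intro X _
    have hb := hgram X
    obtain ⟨x, hx, A, hA, hbA⟩ := exists_stiefel_mul_eq (b := x₀ + C₀ * X) (by rw [hb]; exact hpos X)
    have hx' : xᵀ * x = 1 := hx
    have hdet : (1 + Xᵀ * X).det = A.det * A.det := by
      rw [← hb, hbA, Matrix.transpose_mul, Matrix.mul_assoc, ← Matrix.mul_assoc xᵀ, hx',
        Matrix.one_mul, Matrix.det_mul, Matrix.det_transpose]
    have hσ : (Real.sqrt (1 + Xᵀ * X).det)⁻¹ • orientedSpan (x₀ + C₀ * X) = orientedSpan x := by
      rw [hdet, Real.sqrt_mul_self hA.le, hbA, orientedSpan_mul, smul_smul,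
        inv_mul_cancel₀ hA.ne', one_smul]
    refine ⟨⟨x, hx, hσ.symm⟩, ?_⟩
    change 0 < (x₀ᵀ * ((Real.sqrt (1 + Xᵀ * X).det)⁻¹ • orientedSpan (x₀ + C₀ * X)) * x₀) 1 0
    rw [Matrix.mul_smul, Matrix.smul_mul, hden, Matrix.mul_add, hx₀', ← Matrix.mul_assoc, h0,
      Matrix.zero_mul, add_zero, Matrix.det_one, one_smul]
    simpa [eps] using hpos X
  · rintro _ ⟨⟨x, hx, rfl⟩, hJ⟩
    have hx' : xᵀ * x = 1 := hx
    have hJ' : 0 < (x₀ᵀ * orientedSpan x * x₀) 1 0 := hJ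
    have hB : 0 < (x₀ᵀ * x).det := by
      rw [hden] at hJ'
      simpa [eps] using hJ'
    have hu : IsUnit (x₀ᵀ * x).det := isUnit_iff_ne_zero.2 hB.ne'
    have hb : x₀ + C₀ * (C₀ᵀ * x * (x₀ᵀ * x)⁻¹) = x * (x₀ᵀ * x)⁻¹ := by
      have h2 := congrArg (fun z : Matrix (Idx n) (Idx n) ℝ => z * x * (x₀ᵀ * x)⁻¹)
        (mul_transpose_add_mul_transpose hx₀' h0 h1)
      simp only [Matrix.add_mul, Matrix.one_mul] at h2
      rw [Matrix.mul_assoc x₀, Matrix.mul_nonsing_inv_cancel_right _ _ hu] at h2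
      rw [← h2]
      simp only [Matrix.mul_assoc]
    have hg : (1 + (C₀ᵀ * x * (x₀ᵀ * x)⁻¹)ᵀ * (C₀ᵀ * x * (x₀ᵀ * x)⁻¹)).det =
        (x₀ᵀ * x)⁻¹.det * (x₀ᵀ * x)⁻¹.det := by
      rw [← hgram, hb, Matrix.transpose_mul, Matrix.mul_assoc, ← Matrix.mul_assoc xᵀ, hx',
        Matrix.one_mul, Matrix.det_mul, Matrix.det_transpose]
    have hinv : 0 < (x₀ᵀ * x)⁻¹.det := by
      rw [Matrix.det_nonsing_inv, Ring.inverse_eq_inv']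
      exact inv_pos.2 hB
    simp only [hψ x hB.ne']
    rw [hg, Real.sqrt_mul_self hinv.le, hb, orientedSpan_mul, smul_smul,
        inv_mul_cancel₀ hinv.ne', one_smul]
  · intro X _
    have h2 : x₀ᵀ * (x₀ + C₀ * X) = 1 := by
      rw [Matrix.mul_add, hx₀', ← Matrix.mul_assoc, h0, Matrix.zero_mul, add_zero]
    have h3 : C₀ᵀ * (x₀ + C₀ * X) = X := by
      rw [Matrix.mul_add, h0', ← Matrix.mul_assoc, h1, Matrix.one_mul, zero_add]
    have h4 := hψ (x₀ + C₀ * X) (by rw [h2]; simp)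
    rw [h2, h3, inv_one, Matrix.mul_one] at h4
    have hs : (Real.sqrt (1 + Xᵀ * X).det)⁻¹ ≠ 0 := inv_ne_zero (Real.sqrt_pos.2 (hpos X)).ne'
    simp only [Matrix.mul_smul, Matrix.smul_mul, Matrix.smul_apply, smul_eq_mul, mul_inv, smul_smul]
    refine Eq.trans ?_ h4
    rw [neg_mul, mul_right_comm, inv_mul_cancel₀ hs, one_mul]

end Grassmannian

/-! ### The `G₀`-structure on the Grassmannian -/

section GrassmannG0Structure

/-- The ambient vector space of the total space of the `G₀`-structure on the Grassmannian. -/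
abbrev QuotSpace (n : ℕ) : Type :=
  Matrix (Idx n) (Idx n) ℝ × Matrix (Idx n) (Fin 2) ℝ × Matrix (Idx n) (Fin n) ℝ

/-- The `G₀`-structure of the PCS-structure on the Grassmannian.  The total space consists of the
triples `(J, e, f)` of an oriented plane `J`, an oriented frame `e` of this plane and an oriented
orthonormal frame `f` of its orthogonal complement.  For `e = x A` with an orthonormal frame `x` of
`J`, the determinant of `(e | f)` is `det A`, which explains the scale factors. -/
noncomputable def grassmannG0Structure (n : ℕ) :
    G0StructureData n (Matrix (Idx n) (Idx n) ℝ) (QuotSpace n) where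
  total := {p | (p.2.1ᵀ * p.2.2 = 0 ∧ p.2.2ᵀ * p.2.2 = 1 ∧ 0 < (Matrix.fromCols p.2.1 p.2.2).det) ∧
    p.1 = (Matrix.fromCols p.2.1 p.2.2).det⁻¹ • orientedSpan p.2.1}
  proj p := p.1
  act p a := (p.1, p.2.1 * a.1, p.2.2 * a.2)
  frame p :=
    { toFun := fun X => (Matrix.fromCols p.2.1 p.2.2).det⁻¹ •
        (p.2.2 * (X * eps * p.2.1ᵀ) + p.2.1 * eps * Xᵀ * p.2.2ᵀ)
      map_add' := by
        intro X Y
        rw [← smul_add]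
        simp only [Matrix.transpose_add, Matrix.mul_add, Matrix.add_mul]
        congr 1
        abel
      map_smul' := by
        intro c X
        rw [RingHom.id_apply, smul_comm]
        simp only [Matrix.transpose_smul, Matrix.mul_smul, Matrix.smul_mul, smul_add] }

variable {n : ℕ}

theorem det_fromCols_eq_one {x : Matrix (Idx n) (Fin 2) ℝ} {C : Matrix (Idx n) (Fin n) ℝ}
    (hx : xᵀ * x = 1) (hxC : xᵀ * C = 0) (hC : Cᵀ * C = 1) (hd : 0 < (Matrix.fromCols x C).det) :
    (Matrix.fromCols x C).det = 1 :=
  det_eq_one_of_pos (transpose_mul_fromCols hx hxC hC) hd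

theorem det_fromCols_mul_left {u : FrameSpace n} (hu : u ∈ lieTotal n) :
    (Matrix.fromCols (u.1 * u.2.1) u.2.2).det = u.2.1.det := by
  obtain ⟨h1, h2, h3, h4, h5⟩ := hu
  have h := det_fromCols_mul u.1 u.2.2 u.2.1 1
  rwa [Matrix.mul_one, det_fromCols_eq_one h1 h2 h3 h5, Matrix.det_one, mul_one, one_mul] at h

/-- The map `q₀` of total spaces that covers `(v₁, v₂) ↦ [v₁, v₂]⁺`. -/
def quotMap (u : FrameSpace n) : QuotSpace n := (orientedSpan u.1, u.1 * u.2.1, u.2.2)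

theorem quotMap_mem {u : FrameSpace n} (hu : u ∈ lieTotal n) :
    quotMap u ∈ (grassmannG0Structure n).total := by
  have hd := det_fromCols_mul_left hu
  obtain ⟨h1, h2, h3, h4, h5⟩ := hu
  refine ⟨⟨?_, h3, ?_⟩, ?_⟩
  · change (u.1 * u.2.1)ᵀ * u.2.2 = 0
    rw [Matrix.transpose_mul, Matrix.mul_assoc, h2, Matrix.mul_zero]
  · change 0 < (Matrix.fromCols (u.1 * u.2.1) u.2.2).det
    rwa [hd]
  · change orientedSpan u.1 =
      (Matrix.fromCols (u.1 * u.2.1) u.2.2).det⁻¹ • orientedSpan (u.1 * u.2.1)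
    rw [hd, orientedSpan_mul, smul_smul, inv_mul_cancel₀ h4.ne', one_smul]

theorem exists_quotMap_eq {p : QuotSpace n} (hp : p ∈ (grassmannG0Structure n).total) :
    ∃ u ∈ lieTotal n, quotMap u = p := by
  obtain ⟨J, e, f⟩ := p
  obtain ⟨⟨h1, h2, h3⟩, h4⟩ := hp
  simp only at h1 h2 h3 h4
  have h1' : fᵀ * e = 0 := by simpa using congrArg Matrix.transpose h1
  have hg : 0 < (eᵀ * e).det := by
    have h5 : ((Matrix.fromCols e f)ᵀ * Matrix.fromCols e f : Matrix (Idx n) (Idx n) ℝ) =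
        Matrix.fromBlocks (eᵀ * e) 0 0 1 := by
      rw [Matrix.transpose_fromCols, Matrix.fromRows_mul_fromCols, h1, h2, h1']
    have h6 := congrArg Matrix.det h5
    rw [Matrix.det_mul, Matrix.det_transpose, Matrix.det_fromBlocks_zero₂₁, Matrix.det_one,
      mul_one] at h6
    rw [← h6]
    exact mul_pos h3 h3
  obtain ⟨x, hx, A, hA, rfl⟩ := exists_stiefel_mul_eq hg
  have hu : IsUnit Aᵀ.det := by rw [Matrix.det_transpose]; exact isUnit_iff_ne_zero.2 hA.ne'
  have hxf : xᵀ * f = 0 := by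
    rw [Matrix.transpose_mul, Matrix.mul_assoc] at h1
    have := congrArg ((Aᵀ)⁻¹ * ·) h1
    simpa [Matrix.nonsing_inv_mul_cancel_left _ _ hu] using this
  have hd := det_fromCols_mul x f A 1
  rw [Matrix.mul_one, Matrix.det_one, mul_one] at hd
  have hpos : 0 < (Matrix.fromCols x f).det := by
    rw [hd] at h3
    exact (mul_pos_iff_of_pos_right hA).1 h3
  refine ⟨(x, A, f), ⟨hx, hxf, h2, hA, hpos⟩, ?_⟩
  rw [h4, hd, det_fromCols_eq_one hx hxf h2 hpos, one_mul, orientedSpan_mul, smul_smul,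
    inv_mul_cancel₀ hA.ne', one_smul]
  rfl

theorem frame_quotMap {u : FrameSpace n} (hu : u ∈ lieTotal n) (X : Matrix (Fin n) (Fin 2) ℝ) :
    (grassmannG0Structure n).frame (quotMap u) X = spanDeriv u.1 (u.2.2 * X * u.2.1⁻¹) := by
  have hd := det_fromCols_mul_left hu
  have hA : IsUnit u.2.1.det := isUnit_iff_ne_zero.2 hu.2.2.2.1.ne'
  have h1 : eps * u.2.1ᵀ = u.2.1.det • (u.2.1⁻¹ * eps) := by
    rw [← Matrix.mul_smul, ← mul_eps_mul_transpose, Matrix.mul_assoc,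
      Matrix.nonsing_inv_mul_cancel_left _ _ hA]
  have h2 : u.2.1 * eps = u.2.1.det • (eps * (u.2.1⁻¹)ᵀ) := by
    have := congrArg Matrix.transpose h1
    simpa [transpose_eps] using this
  change (Matrix.fromCols (u.1 * u.2.1) u.2.2).det⁻¹ • (u.2.2 * (X * eps * (u.1 * u.2.1)ᵀ) +
    u.1 * u.2.1 * eps * Xᵀ * u.2.2ᵀ) = _
  rw [hd, Matrix.transpose_mul, Matrix.mul_assoc X, ← Matrix.mul_assoc eps, h1, Matrix.mul_assoc u.1,
    h2, spanDeriv]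
  simp only [Matrix.smul_mul, Matrix.mul_smul, ← smul_add, Matrix.transpose_mul]
  rw [smul_smul, inv_mul_cancel₀ hu.2.2.2.1.ne', one_smul]
  simp only [Matrix.mul_assoc]

theorem frame_quotMap_injective {u : FrameSpace n} (hu : u ∈ lieTotal n) :
    Function.Injective ((grassmannG0Structure n).frame (quotMap u)) := by
  intro X Y h
  rw [frame_quotMap hu, frame_quotMap hu] at h
  exact frameOne_injective hu (spanDeriv_injOn hu.1 (transpose_mul_frameOne hu X)
    (transpose_mul_frameOne hu Y) h)

theorem contDiff_det_fromCols {k : WithTop ℕ∞} : ContDiff ℝ k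
    fun p : Matrix (Idx n) (Fin 2) ℝ × Matrix (Idx n) (Fin n) ℝ => (Matrix.fromCols p.1 p.2).det :=
  (contDiff_fst.matrix_fromCols contDiff_snd).matrix_det

/-- The equations for `(e | f)` to consist of an orthonormal frame `f` and of vectors `e` orthogonal
to it. -/
noncomputable def coframeConstraint (n : ℕ)
    (p : Matrix (Idx n) (Fin 2) ℝ × Matrix (Idx n) (Fin n) ℝ) :
    Matrix (Fin 2) (Fin n) ℝ × symMat (Fin n) :=
  (p.1ᵀ * p.2, symProj (Fin n) (p.2ᵀ * p.2 - 1))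

/-- The total space of `grassmannG0Structure n` is a graph over the manifold of the pairs `(e, f)`. -/
theorem isSubmanifold_grassmannG0Structure :
    ∃ d, IsSubmanifold (grassmannG0Structure n).total d := by
  let S : Set (Matrix (Idx n) (Fin 2) ℝ × Matrix (Idx n) (Fin n) ℝ) :=
    {p | p.1ᵀ * p.2 = 0 ∧ p.2ᵀ * p.2 = 1 ∧ 0 < (Matrix.fromCols p.1 p.2).det}
  let O : Set (Matrix (Idx n) (Fin 2) ℝ × Matrix (Idx n) (Fin n) ℝ) :=
    {p | 0 < (Matrix.fromCols p.1 p.2).det}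
  have hO : IsOpen O :=
    isOpen_lt continuous_const (contDiff_det_fromCols (k := 0)).continuous
  have hΦ : ContDiff ℝ ∞ (coframeConstraint n) :=
    (contDiff_fst.matrix_transpose.matrix_mul contDiff_snd).prodMk (contDiff_gram contDiff_snd)
  have hreg : ∀ p ∈ S, HasSmoothChart (fderiv ℝ (coframeConstraint n) p).ker S p ∧
      Function.Surjective (fderiv ℝ (coframeConstraint n) p) := by
    rintro p hp
    obtain ⟨h1, h2, h3⟩ := hp
    have hd : HasFDerivAt (coframeConstraint n) _ p :=
      (HasFDerivAt.matrix_mul (HasFDerivAt.matrix_transpose hasFDerivAt_fst) hasFDerivAt_snd).prodMk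
        (HasFDerivAt.gram hasFDerivAt_snd)
    have hsurj : Function.Surjective (fderiv ℝ (coframeConstraint n) p) := by
      rintro ⟨M, ⟨T, hT⟩⟩
      have hT' : Tᵀ = T := hT
      refine ⟨(p.2 * Mᵀ, p.2 * ((1 / 2 : ℝ) • T)), ?_⟩
      rw [hd.fderiv]
      refine Prod.ext ?_ (Subtype.ext ?_)
      · change p.1ᵀ * (p.2 * ((1 / 2 : ℝ) • T)) + (p.2 * Mᵀ)ᵀ * p.2 = M
        rw [← Matrix.mul_assoc, h1, Matrix.zero_mul, zero_add, Matrix.transpose_mul,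
          Matrix.transpose_transpose, Matrix.mul_assoc, h2, Matrix.mul_one]
      · refine symProj_gramDeriv.trans ?_
        change p.2ᵀ * (p.2 * ((1 / 2 : ℝ) • T)) + (p.2 * ((1 / 2 : ℝ) • T))ᵀ * p.2 = T
        rw [← Matrix.mul_assoc, h2, Matrix.one_mul, Matrix.transpose_mul, Matrix.mul_assoc, h2,
          Matrix.mul_one, Matrix.transpose_smul, hT']
        module
    refine ⟨(hasSmoothChart_and_tangentSpaceAt_of_regular (S := S) hΦ hO (fun y hy => ?_) h3
      ⟨h1, h2, h3⟩ (hΦ.differentiable (by simp) p).hasFDerivAt hsurj).1, hsurj⟩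
    rw [coframeConstraint, Prod.mk_eq_zero, gram_eq_zero_iff]
    exact ⟨fun h => ⟨h.1, h.2.1⟩, fun h => ⟨h.1, h.2, hy⟩⟩
  refine ⟨Module.finrank ℝ (Matrix (Idx n) (Fin 2) ℝ × Matrix (Idx n) (Fin n) ℝ) -
    Module.finrank ℝ (Matrix (Fin 2) (Fin n) ℝ × symMat (Fin n)), ?_⟩
  rintro ⟨J, p⟩ ⟨hp, hJ⟩
  have hp' : p ∈ S := hp
  obtain ⟨hc, hsurj⟩ := hreg p hp'
  have hsm : ContDiffOn ℝ ∞ (fun p : Matrix (Idx n) (Fin 2) ℝ × Matrix (Idx n) (Fin n) ℝ =>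
      (Matrix.fromCols p.1 p.2).det⁻¹ • orientedSpan p.1) O :=
    (contDiff_det_fromCols.contDiffOn.inv fun p (hp : 0 < _) => hp.ne').smul
      (contDiff_orientedSpan.comp contDiff_fst).contDiffOn
  have hJ' : J = (Matrix.fromCols p.1 p.2).det⁻¹ • orientedSpan p.1 := hJ
  subst hJ'
  refine IsSubmanifold.of_hasSmoothChart ?_ (hc.graph _ hO hp'.2.2 hsm)
  have h := LinearMap.finrank_range_add_finrank_ker (fderiv ℝ (coframeConstraint n) p).toLinearMap
  rw [LinearMap.range_eq_top.2 hsurj, finrank_top] at h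
  exact Nat.eq_sub_of_add_eq' h

/-- Two orthonormal frames of the same oriented plane differ by a rotation. -/
theorem exists_rotation_of_orientedSpan_eq {x y : Matrix (Idx n) (Fin 2) ℝ} (hx : x ∈ stiefel n)
    (hy : y ∈ stiefel n) (h : orientedSpan x = orientedSpan y) :
    ∃ R : Matrix (Fin 2) (Fin 2) ℝ, Rᵀ * R = 1 ∧ R.det = 1 ∧ y = x * R := by
  have hx' : xᵀ * x = 1 := hx
  have hy' : yᵀ * y = 1 := hy
  have hsq : ∀ z : Matrix (Idx n) (Fin 2) ℝ, zᵀ * z = 1 →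
      orientedSpan z * orientedSpan z = -(z * zᵀ) := by
    intro z hz
    calc orientedSpan z * orientedSpan z = z * (eps * (zᵀ * z) * eps) * zᵀ := by
          rw [orientedSpan_eq]; simp only [Matrix.mul_assoc]
      _ = _ := by rw [hz, Matrix.mul_one, eps_mul_eps]; simp
  have hP : x * xᵀ = y * yᵀ := by
    rw [← neg_inj, ← hsq x hx', ← hsq y hy', h]
  have hxy : y = x * (xᵀ * y) := by
    rw [← Matrix.mul_assoc, hP, Matrix.mul_assoc, hy', Matrix.mul_one]
  refine ⟨xᵀ * y, ?_, ?_, hxy⟩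
  · rw [Matrix.transpose_mul, Matrix.transpose_transpose, Matrix.mul_assoc, ← hxy, hy']
  · rw [hxy, orientedSpan_mul] at h
    have h2 := congrArg (fun z => xᵀ * z * x) h
    have h3 : xᵀ * orientedSpan x * x = eps := by
      rw [orientedSpan_eq, Matrix.mul_assoc _ _ x, Matrix.mul_assoc _ _ x, hx', Matrix.mul_one,
        ← Matrix.mul_assoc, hx', Matrix.one_mul]
    simp only [Matrix.mul_smul, Matrix.smul_mul, h3] at h2
    have h4 := congrFun (congrFun h2 1) 0
    simpa [eps] using h4.symm

theorem isPrincipal_grassmannG0Structure (hn : 0 < n) :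
    (grassmannG0Structure n).toG0BundleData.IsPrincipal (orientedGrassmannian n) where
  submanifold := isSubmanifold_grassmannG0Structure
  proj_smooth := contDiff_fst.contDiffOn
  proj_mem p hp := by
    obtain ⟨u, hu, rfl⟩ := exists_quotMap_eq hp
    exact ⟨u.1, hu.1, rfl⟩
  act_smooth :=
    (contDiff_fst.fst.prodMk ((contDiff_fst.snd.fst.matrix_mul contDiff_snd.fst).prodMk
      (contDiff_fst.snd.snd.matrix_mul contDiff_snd.snd))).contDiffOn
  act_mem p hp a ha := by
    obtain ⟨u, hu, rfl⟩ := exists_quotMap_eq hp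
    have h := quotMap_mem (act_mem_lieTotal hu ha)
    rwa [quotMap, ← Matrix.mul_assoc] at h
  act_one p _ := by
    change (p.1, p.2.1 * 1, p.2.2 * 1) = p
    rw [Matrix.mul_one, Matrix.mul_one]
  act_mul p _ a _ b _ := by
    change (p.1, p.2.1 * (a.1 * b.1), p.2.2 * (a.2 * b.2)) =
      (p.1, p.2.1 * a.1 * b.1, p.2.2 * a.2 * b.2)
    rw [Matrix.mul_assoc, Matrix.mul_assoc]
  proj_act _ _ _ _ := rfl
  free p hp a ha h := by
    obtain ⟨u, ⟨h1, -, h3, h4, -⟩, rfl⟩ := exists_quotMap_eq hp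
    have h1' : u.1ᵀ * u.1 = 1 := h1
    have e1 : u.1 * u.2.1 * a.1 = u.1 * u.2.1 := congrArg (fun z : QuotSpace n => z.2.1) h
    have e2 : u.2.2 * a.2 = u.2.2 := congrArg (fun z : QuotSpace n => z.2.2) h
    refine Prod.ext ?_ ?_
    · have hu' : IsUnit u.2.1.det := isUnit_iff_ne_zero.2 h4.ne'
      have := congrArg (fun z => u.2.1⁻¹ * (u.1ᵀ * z)) e1
      simp only [← Matrix.mul_assoc, h1', Matrix.one_mul,
        Matrix.nonsing_inv_mul _ hu'] at this
      exact this
    · have := congrArg (u.2.2ᵀ * ·) e2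
      simpa [← Matrix.mul_assoc, h3] using this
  locally_trivial J hJ := by
    obtain ⟨x₀, hx₀, rfl⟩ := hJ
    obtain ⟨O₁, y, hO₁, hxO₁, hy, hyx, hyO⟩ := exists_local_section hx₀
    obtain ⟨O₂, C, hO₂, hxO₂, hC, hCO⟩ := exists_local_completion hn hx₀
    have hO : IsOpen (O₁ ∩ y ⁻¹' O₂) := hy.continuousOn.isOpen_inter_preimage hO₁ hO₂
    have hyO' : ContDiffOn ℝ ∞ y (O₁ ∩ y ⁻¹' O₂) := hy.mono Set.inter_subset_left
    have hCy : ContDiffOn ℝ ∞ (fun J => C (y J)) (O₁ ∩ y ⁻¹' O₂) :=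
      hC.comp hyO' fun J hJ => hJ.2
    have hmap : Set.MapsTo (fun p : QuotSpace n => p.1) ((grassmannG0Structure n).total ∩
        (fun p : QuotSpace n => p.1) ⁻¹' (O₁ ∩ y ⁻¹' O₂)) (O₁ ∩ y ⁻¹' O₂) := fun p hp => hp.2
    refine ⟨O₁ ∩ y ⁻¹' O₂, fun J => (J, y J, C (y J)),
      fun p => ((y p.1)ᵀ * p.2.1, (C (y p.1))ᵀ * p.2.2), hO, ⟨hxO₁, ?_⟩, ?_, ?_, ?_, ?_⟩
    · change y (orientedSpan x₀) ∈ O₂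
      rwa [hyx]
    · exact (contDiffOn_id.prodMk (hyO'.prodMk hCy)).mono Set.inter_subset_right
    · exact ((hyO'.comp contDiff_fst.contDiffOn hmap).matrix_transpose.matrix_mul
        contDiff_snd.fst.contDiffOn).prodMk
        ((hCy.comp contDiff_fst.contDiffOn hmap).matrix_transpose.matrix_mul
        contDiff_snd.snd.contDiffOn)
    · rintro J ⟨hJ, hJ1, hJ2⟩
      obtain ⟨h1, h2⟩ := hyO J ⟨hJ, hJ1⟩
      obtain ⟨c1, c2, c3⟩ := hCO (y J) ⟨h1, hJ2⟩
      have h := quotMap_mem (u := (y J, 1, C (y J))) ⟨h1, c1, c2, by simp, c3⟩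
      simp only [quotMap, Matrix.mul_one, h2] at h
      exact ⟨h, rfl⟩
    · rintro p ⟨hp, hJ1, hJ2⟩
      obtain ⟨⟨x, A, f⟩, hu, rfl⟩ := exists_quotMap_eq hp
      obtain ⟨h1, h2, h3, h4, h5⟩ := hu
      simp only at h1 h2 h3 h4 h5
      have h1' : xᵀ * x = 1 := h1
      obtain ⟨k1, k2⟩ := hyO (orientedSpan x) ⟨⟨x, h1, rfl⟩, hJ1⟩
      obtain ⟨c1, c2, c3⟩ := hCO (y (orientedSpan x)) ⟨k1, hJ2⟩
      obtain ⟨R, hR, hR1, hyR⟩ := exists_rotation_of_orientedSpan_eq h1 k1 k2.symm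
      have hyf : (y (orientedSpan x))ᵀ * f = 0 := by
        rw [hyR, Matrix.transpose_mul, Matrix.mul_assoc, h2, Matrix.mul_zero]
      have hyd : 0 < (Matrix.fromCols (y (orientedSpan x)) f).det := by
        have h := det_fromCols_mul x f R 1
        rw [Matrix.mul_one, hR1, Matrix.det_one, mul_one, mul_one, ← hyR] at h
        rwa [h]
      have hyA : (y (orientedSpan x))ᵀ * (x * A) = Rᵀ * A := by
        rw [hyR, Matrix.transpose_mul, Matrix.mul_assoc, ← Matrix.mul_assoc xᵀ, h1', Matrix.one_mul]
      refine ⟨⟨?_, transpose_mul_mem_SO k1 hyf h3 hyd c1 c2 c3⟩, ?_⟩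
      · change 0 < ((y (orientedSpan x))ᵀ * (x * A)).det
        rw [hyA, Matrix.det_mul, Matrix.det_transpose, hR1, one_mul]
        exact h4
      · change (orientedSpan x, y (orientedSpan x) * ((y (orientedSpan x))ᵀ * (x * A)),
          C (y (orientedSpan x)) * ((C (y (orientedSpan x)))ᵀ * f)) = (orientedSpan x, x * A, f)
        rw [mul_transpose_mul_eq k1 c1 c2 hyf, hyA]
        have : y (orientedSpan x) * (Rᵀ * A) = x * A := by
          rw [hyR, Matrix.mul_assoc, ← Matrix.mul_assoc R, mul_eq_one_comm.1 hR, Matrix.one_mul]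
        rw [this]

theorem isG0Structure_grassmannG0Structure (hn : 0 < n) :
    (grassmannG0Structure n).IsG0Structure (orientedGrassmannian n) where
  principal := isPrincipal_grassmannG0Structure hn
  frame_smooth X := by
    have hd : ContDiff ℝ ∞ fun p : QuotSpace n => (Matrix.fromCols p.2.1 p.2.2).det :=
      contDiff_det_fromCols.comp contDiff_snd
    refine (hd.contDiffOn.inv fun p hp => hp.1.2.2.ne').smul (ContDiff.contDiffOn ?_)
    exact (contDiff_snd.snd.matrix_mul (contDiff_const.matrix_mul
      contDiff_snd.fst.matrix_transpose)).add (((contDiff_snd.fst.matrix_mul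
      contDiff_const).matrix_mul contDiff_const).matrix_mul contDiff_snd.snd.matrix_transpose)
  frame_injective p hp := by
    obtain ⟨u, hu, rfl⟩ := exists_quotMap_eq hp
    exact frame_quotMap_injective hu
  frame_range p hp := by
    obtain ⟨u, hu, rfl⟩ := exists_quotMap_eq hp
    ext v
    refine Iff.trans ?_ (mem_tangentSpaceAt_grassmannian hu.1).symm
    constructor
    · rintro ⟨X, rfl⟩
      exact ⟨_, transpose_mul_frameOne hu X, (frame_quotMap hu X).symm⟩
    · rintro ⟨w, hw, rfl⟩
      refine ⟨u.2.2ᵀ * w * u.2.1, ?_⟩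
      rw [frame_quotMap hu]
      exact congrArg (spanDeriv u.1) (frameOne_transpose_mul hu hw)
  frame_act p hp a ha X := by
    obtain ⟨u, hu, rfl⟩ := exists_quotMap_eq hp
    have h : (grassmannG0Structure n).act (quotMap u) a =
        quotMap (u.1, u.2.1 * a.1, u.2.2 * a.2) := by
      rw [quotMap, quotMap]
      change (orientedSpan u.1, u.1 * u.2.1 * a.1, u.2.2 * a.2) = _
      rw [Matrix.mul_assoc]
    rw [h, frame_quotMap (act_mem_lieTotal hu ha), frame_quotMap hu, adOne, Matrix.mul_inv_rev]
    simp only [Matrix.mul_assoc]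

end GrassmannG0Structure

/-! ### The quotient map and the action of `SO(n + 2)` -/

section Quotient

variable {n : ℕ}

theorem quotMap_hasFDerivAt (u : FrameSpace n) :
    ∃ D : FrameSpace n →L[ℝ] QuotSpace n, HasFDerivAt quotMap D u ∧
      ∀ w, D w = (spanDeriv u.1 w.1, u.1 * w.2.1 + w.1 * u.2.1, w.2.2) := by
  obtain ⟨D, hD, hDw⟩ := hasFDerivAt_orientedSpan u.1
  have h1 : HasFDerivAt (fun v : FrameSpace n => v.1) (ContinuousLinearMap.fst ℝ _ _) u :=
    hasFDerivAt_fst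
  have h2 : HasFDerivAt (fun v : FrameSpace n => v.2.1)
      ((ContinuousLinearMap.fst ℝ _ _) ∘L (ContinuousLinearMap.snd ℝ _ _)) u := hasFDerivAt_snd.fst
  have h3 : HasFDerivAt (fun v : FrameSpace n => v.2.2)
      ((ContinuousLinearMap.snd ℝ _ _) ∘L (ContinuousLinearMap.snd ℝ _ _)) u := hasFDerivAt_snd.snd
  refine ⟨_, (HasFDerivAt.comp (g := orientedSpan) u hD h1).prodMk
    ((HasFDerivAt.matrix_mul h1 h2).prodMk h3), fun w => ?_⟩
  exact Prod.ext (hDw w.1) rfl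

/-- The rotation by the angle `t`. -/
noncomputable def rotTwo (t : ℝ) : Matrix (Fin 2) (Fin 2) ℝ := Real.cos t • 1 + Real.sin t • eps

theorem rotTwo_orthogonal (t : ℝ) : (rotTwo t)ᵀ * rotTwo t = 1 ∧ (rotTwo t).det = 1 := by
  have h := Real.cos_sq_add_sin_sq t
  constructor
  · ext i j
    fin_cases i <;> fin_cases j <;>
      simp [rotTwo, eps, Matrix.mul_apply, Fin.sum_univ_two] <;> nlinarith
  · simp [rotTwo, eps, Matrix.det_fin_two]; nlinarith

theorem exists_eq_rotTwo {R : Matrix (Fin 2) (Fin 2) ℝ} (hR : Rᵀ * R = 1) (hd : R.det = 1) :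
    ∃ t, R = rotTwo t := by
  have h1 : Rᵀ = R.adjugate := by
    have h := congrArg (· * R.adjugate) hR
    simpa [Matrix.mul_assoc, Matrix.mul_adjugate, hd] using h
  rw [Matrix.adjugate_fin_two] at h1
  have h00 : R 0 0 = R 1 1 := by simpa using congrFun (congrFun h1 0) 0
  have h01 : R 1 0 = -R 0 1 := by simpa using congrFun (congrFun h1 0) 1
  rw [Matrix.det_fin_two] at hd
  let z : ℂ := ⟨R 0 0, R 1 0⟩
  have hz : ‖z‖ = 1 := by
    have : Complex.normSq z = 1 := by
      rw [Complex.normSq_apply]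
      change R 0 0 * R 0 0 + R 1 0 * R 1 0 = 1
      rw [← h00] at hd
      rw [h01] at hd ⊢
      linarith
    rw [Complex.norm_def, this, Real.sqrt_one]
  have hz0 : z ≠ 0 := fun h => by rw [h, norm_zero] at hz; exact zero_ne_one hz
  have hc := Complex.cos_arg hz0
  have hs := Complex.sin_arg z
  rw [hz, div_one] at hc hs
  refine ⟨z.arg, ?_⟩
  rw [rotTwo, hc, hs]
  ext i j
  fin_cases i <;> fin_cases j <;> simp [eps, z, h00, h01]

/-- The fibres of `quotMap` are the circles of the points `(x R, R⁻¹ A, C)` with a rotation `R`. -/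
theorem isConnected_quotMap_fiber {u : FrameSpace n} (hu : u ∈ lieTotal n) :
    IsConnected {v | v ∈ lieTotal n ∧ quotMap v = quotMap u} := by
  have hu' := hu
  obtain ⟨h1, h2, h3, h4, h5⟩ := hu'
  have h1' : u.1ᵀ * u.1 = 1 := h1
  have hset : {v | v ∈ lieTotal n ∧ quotMap v = quotMap u} =
      Set.range fun t : ℝ => ((u.1 * rotTwo t, (rotTwo t)ᵀ * u.2.1, u.2.2) : FrameSpace n) := by
    ext v
    constructor
    · rintro ⟨hv, hvu⟩
      have e1 : orientedSpan v.1 = orientedSpan u.1 := congrArg (fun p : QuotSpace n => p.1) hvu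
      have e2 : v.1 * v.2.1 = u.1 * u.2.1 := congrArg (fun p : QuotSpace n => p.2.1) hvu
      have e3 : v.2.2 = u.2.2 := congrArg (fun p : QuotSpace n => p.2.2) hvu
      obtain ⟨R, hR, hR1, hvR⟩ := exists_rotation_of_orientedSpan_eq h1 hv.1 e1.symm
      obtain ⟨t, rfl⟩ := exists_eq_rotTwo hR hR1
      refine ⟨t, Prod.ext hvR.symm (Prod.ext ?_ e3.symm)⟩
      change (rotTwo t)ᵀ * u.2.1 = v.2.1
      have := congrArg (u.1ᵀ * ·) e2
      simp only [hvR, ← Matrix.mul_assoc, h1', Matrix.one_mul] at this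
      rw [← this, ← Matrix.mul_assoc, hR, Matrix.one_mul]
    · rintro ⟨t, rfl⟩
      obtain ⟨hR, hR1⟩ := rotTwo_orthogonal t
      refine ⟨⟨mul_mem_stiefel h1 hR, ?_, h3, ?_, ?_⟩, Prod.ext ?_ (Prod.ext ?_ rfl)⟩
      · change (u.1 * rotTwo t)ᵀ * u.2.2 = 0
        rw [Matrix.transpose_mul, Matrix.mul_assoc, h2, Matrix.mul_zero]
      · change 0 < ((rotTwo t)ᵀ * u.2.1).det
        rwa [Matrix.det_mul, Matrix.det_transpose, hR1, one_mul]
      · change 0 < (Matrix.fromCols (u.1 * rotTwo t) u.2.2).det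
        have h := det_fromCols_mul u.1 u.2.2 (rotTwo t) 1
        rw [Matrix.mul_one, hR1, Matrix.det_one, mul_one, mul_one] at h
        rwa [h]
      · change orientedSpan (u.1 * rotTwo t) = orientedSpan u.1
        rw [orientedSpan_mul, hR1, one_smul]
      · change u.1 * rotTwo t * ((rotTwo t)ᵀ * u.2.1) = u.1 * u.2.1
        rw [Matrix.mul_assoc, ← Matrix.mul_assoc (rotTwo t), mul_eq_one_comm.1 hR, Matrix.one_mul]
  rw [hset]
  have hrot : Continuous rotTwo :=
    (Real.continuous_cos.smul continuous_const).add (Real.continuous_sin.smul continuous_const)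
  exact isConnected_range ((continuous_const.matrix_mul hrot).prodMk
    ((hrot.matrix_transpose.matrix_mul continuous_const).prodMk continuous_const))

theorem isPCSQuotient_quotMap {c : ℝ} (hc : c ≠ 0) :
    IsPCSQuotient (homogeneousLieContact n) (grassmannG0Structure n)
      (fun x => -(c • (x * eps))) orientedSpan quotMap where
  smooth := ((contDiff_orientedSpan.comp contDiff_fst).prodMk
    ((contDiff_fst.matrix_mul contDiff_snd.fst).prodMk contDiff_snd.snd)).contDiffOn
  mapsTo u hu := by
    rw [total_homogeneousLieContact] at hu
    exact quotMap_mem hu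
  equivariant u _ a _ := by
    change (orientedSpan u.1, u.1 * (u.2.1 * a.1), u.2.2 * a.2) =
      (orientedSpan u.1, u.1 * u.2.1 * a.1, u.2.2 * a.2)
    rw [Matrix.mul_assoc]
  covers _ _ := rfl
  surjective p hp := by
    rw [total_homogeneousLieContact]
    exact exists_quotMap_eq hp
  connected_fibers p hp := by
    rw [total_homogeneousLieContact]
    obtain ⟨u, hu, rfl⟩ := exists_quotMap_eq hp
    exact isConnected_quotMap_fiber hu
  kernel := by
    refine ⟨_, isLift_liftField c, ?_⟩
    rw [total_homogeneousLieContact]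
    intro u hu w hw
    obtain ⟨D, hD, hDw⟩ := quotMap_hasFDerivAt u
    have e : fderivWithin ℝ quotMap (lieTotal n) u w =
        (spanDeriv u.1 w.1, u.1 * w.2.1 + w.1 * u.2.1, w.2.2) :=
      (hD.hasFDerivWithinAt.fderivWithin_apply hw).trans (hDw w)
    have hx' : u.1ᵀ * u.1 = 1 := hu.1
    refine (Eq.congr_left e).trans ?_
    rw [Submodule.mem_span_singleton, Prod.mk_eq_zero, Prod.mk_eq_zero]
    constructor
    · rintro ⟨h1, h2, h3⟩
      have hw1 := ((mem_tangentSpaceAt_lieTotal hu).1 hw).1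
      have hsk : (u.1ᵀ * w.1)ᵀ = -(u.1ᵀ * w.1) := by
        rw [Matrix.transpose_mul, Matrix.transpose_transpose]
        exact eq_neg_of_add_eq_zero_right hw1
      -- the plane does not move, so that `w.1` is an infinitesimal rotation of the frame in the plane
      have hz : w.1 - u.1 * (u.1ᵀ * w.1) = 0 := by
        refine spanDeriv_injOn hx' ?_ (Matrix.mul_zero _) ?_
        · rw [Matrix.mul_sub, ← Matrix.mul_assoc, hx', Matrix.one_mul, sub_self]
        · rw [spanDeriv_horizontal hw1, h1]
          simp [spanDeriv]
      rw [sub_eq_zero, eq_smul_eps_of_transpose_eq_neg hsk] at hz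
      set s := (u.1ᵀ * w.1) 1 0
      -- the frame `x A` does not move, which determines the variation of `A`
      have hw2 : w.2.1 = -(s • (eps * u.2.1)) := by
        have h := congrArg (u.1ᵀ * ·) h2
        simp only [hz, Matrix.mul_add, ← Matrix.mul_assoc, hx', Matrix.one_mul, Matrix.mul_smul,
          Matrix.smul_mul, Matrix.mul_zero] at h
        exact eq_neg_of_add_eq_zero_left h
      refine ⟨-(s / c), ?_⟩
      rw [liftField_apply]
      refine Prod.ext ?_ (Prod.ext ?_ ?_)
      · change -(s / c) • -(c • (u.1 * eps)) = w.1
        rw [hz, neg_smul, smul_neg, neg_neg, smul_smul, div_mul_cancel₀ s hc, Matrix.mul_smul]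
      · change -(s / c) • c • (eps * u.2.1) = w.2.1
        rw [hw2, neg_smul, smul_smul, div_mul_cancel₀ s hc]
      · change -(s / c) • (0 : Matrix (Idx n) (Fin n) ℝ) = w.2.2
        rw [h3, smul_zero]
    · rintro ⟨r, rfl⟩
      rw [liftField_apply]
      refine ⟨?_, ?_, ?_⟩
      · have hw1 : u.1ᵀ * (r • -(c • (u.1 * eps))) + (r • -(c • (u.1 * eps)))ᵀ * u.1 = 0 :=
          ((mem_tangentSpaceAt_lieTotal hu).1 hw).1
        change spanDeriv u.1 (r • -(c • (u.1 * eps))) = 0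
        rw [← spanDeriv_horizontal hw1, Matrix.mul_smul _ r,
          transpose_mul_neg_smul_mul_eps c hx']
        simp [spanDeriv]
      · change u.1 * (r • c • (eps * u.2.1)) + (r • -(c • (u.1 * eps))) * u.2.1 = 0
        simp [Matrix.mul_assoc]
      · exact smul_zero r
  pullback_theta := by
    rw [total_homogeneousLieContact]
    intro u hu w hw hH
    have hH' : u.1ᵀ * w.1 = 0 :=
      (congrArg (u.1ᵀ * ·) (fderivWithin_fst_apply hw)).symm.trans hH
    obtain ⟨D, hD, hDw⟩ := quotMap_hasFDerivAt u
    have e : fderivWithin ℝ quotMap (lieTotal n) u w = D w :=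
      hD.hasFDerivWithinAt.fderivWithin_apply hw
    have ht : D w ∈ tangentSpaceAt (grassmannG0Structure n).total (quotMap u) :=
      hD.hasFDerivWithinAt.map_mem_tangentSpaceAt (fun v hv => quotMap_mem hv) hw
    rw [thetaOne_eq hu hw hH']
    refine (congrArg ((grassmannG0Structure n).theta (quotMap u)) e).trans ?_
    have e2 : fderivWithin ℝ (grassmannG0Structure n).proj (grassmannG0Structure n).total (quotMap u)
        (D w) = (grassmannG0Structure n).frame (quotMap u) (u.2.2ᵀ * w.1 * u.2.1) := by
      rw [frame_quotMap hu]
      refine (fderivWithin_continuousLinearMap_apply (ContinuousLinearMap.fst ℝ _ _) ht).trans ?_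
      refine (congrArg Prod.fst (hDw w)).trans ?_
      exact congrArg (spanDeriv u.1) (frameOne_transpose_mul hu hH').symm
    exact (congrArg (Function.invFun _) e2).trans
      (Function.leftInverse_invFun (frame_quotMap_injective hu) _)

theorem mul_mem_lieTotal {k : Matrix (Idx n) (Idx n) ℝ}
    (hk : k ∈ Matrix.specialOrthogonalGroup (Idx n) ℝ) {u : FrameSpace n} (hu : u ∈ lieTotal n) :
    (k * u.1, u.2.1, k * u.2.2) ∈ lieTotal n := by
  obtain ⟨k1, -, k3⟩ := transpose_mul_self_of_mem_SO hk
  obtain ⟨h1, h2, h3, h4, h5⟩ := hu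
  have key : ∀ {l m : Type} (a : Matrix (Idx n) l ℝ) (b : Matrix (Idx n) m ℝ),
      (k * a)ᵀ * (k * b) = aᵀ * b := fun a b => by
    rw [Matrix.transpose_mul, Matrix.mul_assoc, ← Matrix.mul_assoc kᵀ, k1, Matrix.one_mul]
  refine ⟨(key _ _).trans h1, (key _ _).trans h2, (key _ _).trans h3, h4, ?_⟩
  change 0 < (Matrix.fromCols (k * u.1) (k * u.2.2)).det
  rw [← Matrix.mul_fromCols, Matrix.det_mul, k3, one_mul]
  exact h5

theorem orientedSpan_mul_left (k : Matrix (Idx n) (Idx n) ℝ) (x : Matrix (Idx n) (Fin 2) ℝ) :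
    orientedSpan (k * x) = k * orientedSpan x * kᵀ := by
  rw [orientedSpan_eq, orientedSpan_eq, Matrix.transpose_mul]
  simp only [Matrix.mul_assoc]

/-- `k ∈ SO(n + 2)` acts by left multiplication on frames.  The action on the total space is the one
induced by the action `(x, A, C) ↦ (k x, A, k C)` through `quotMap`. -/
theorem isKInvariant_grassmannG0Structure (hn : 0 < n) : IsKInvariant (grassmannG0Structure n) := by
  have hquot : ∀ (k : Matrix (Idx n) (Idx n) ℝ) (u : FrameSpace n),
      quotMap (k * u.1, u.2.1, k * u.2.2) =
        (k * (quotMap u).1 * kᵀ, k * (quotMap u).2.1, k * (quotMap u).2.2) := fun k u => by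
    rw [quotMap, quotMap, orientedSpan_mul_left]
    simp only [Matrix.mul_assoc]
  refine ⟨?_, ?_, fun k p => (k * p.1 * kᵀ, k * p.2.1, k * p.2.2), ?_, ?_, ?_⟩
  · rintro k hk _ ⟨x, hx, rfl⟩
    obtain ⟨C, c1, c2, c3⟩ := exists_completion hn hx
    have h := mul_mem_lieTotal hk (u := (x, 1, C)) ⟨hx, c1, c2, by simp, c3⟩
    exact ⟨k * x, h.1, orientedSpan_mul_left k x⟩
  · rintro _ ⟨x, hx, rfl⟩ _ ⟨y, hy, rfl⟩
    obtain ⟨C, c1, c2, c3⟩ := exists_completion hn hx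
    obtain ⟨B, b1, b2, b3⟩ := exists_completion hn hy
    have hC := transpose_mul_fromCols hx c1 c2
    have hB := transpose_mul_fromCols hy b1 b2
    have hx' : xᵀ * x = 1 := hx
    have c1' : Cᵀ * x = 0 := by simpa using congrArg Matrix.transpose c1
    refine ⟨Matrix.fromCols y B * (Matrix.fromCols x C)ᵀ, ?_, ?_⟩
    · rw [mem_SO_iff, Matrix.det_mul, Matrix.det_transpose]
      refine ⟨?_, mul_pos b3 c3⟩
      rw [Matrix.transpose_mul, Matrix.mul_assoc, ← Matrix.mul_assoc _ (Matrix.fromCols y B), hB,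
        Matrix.one_mul, Matrix.transpose_transpose]
      exact mul_eq_one_comm.1 hC
    · rw [← orientedSpan_mul_left, Matrix.transpose_fromCols, Matrix.fromCols_mul_fromRows,
        Matrix.add_mul, Matrix.mul_assoc, hx', Matrix.mul_assoc B, c1', Matrix.mul_one,
        Matrix.mul_zero, add_zero]
  · exact (((contDiff_fst.matrix_mul contDiff_snd.fst).matrix_mul
      contDiff_fst.matrix_transpose).prodMk ((contDiff_fst.matrix_mul contDiff_snd.snd.fst).prodMk
      (contDiff_fst.matrix_mul contDiff_snd.snd.snd))).contDiffOn
  · intro p _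
    simp
  · intro k hk p hp
    obtain ⟨u, hu, rfl⟩ := exists_quotMap_eq hp
    refine ⟨?_, ?_, ?_, rfl, ?_⟩
    · beta_reduce
      rw [← hquot]
      exact quotMap_mem (mul_mem_lieTotal hk hu)
    · intro k' _
      simp only [Matrix.mul_assoc, Matrix.transpose_mul]
    · intro a _
      refine Prod.ext rfl (Prod.ext ?_ ?_)
      · exact (Matrix.mul_assoc _ _ _).symm
      · exact (Matrix.mul_assoc _ _ _).symm
    · intro X
      beta_reduce
      rw [← hquot, frame_quotMap (mul_mem_lieTotal hk hu), frame_quotMap hu, spanDeriv, spanDeriv]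
      simp only [Matrix.transpose_mul, Matrix.mul_add, Matrix.add_mul, Matrix.mul_assoc]

end Quotient

/-! ### The standard Grassmannian structure -/

section StandardGrassmannian

/-- The matrix with the given columns. -/
def colMat {n : ℕ} {ι : Type} (v : ι → Idx n → ℝ) : Matrix (Idx n) ι ℝ := Matrix.of fun k i => v i k

/-- The basis of a subspace that consists of the columns of a matrix. -/
noncomputable def colBasis {n : ℕ} {ι : Type} [Fintype ι] [DecidableEq ι] (e : Matrix (Idx n) ι ℝ)
    {K : Submodule ℝ (Idx n → ℝ)} (hinj : Function.Injective e.mulVecLin)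
    (hK : LinearMap.range e.mulVecLin = K) : Module.Basis ι ℝ K :=
  Module.Basis.ofEquivFun
    ((LinearEquiv.ofInjective e.mulVecLin hinj).trans (LinearEquiv.ofEq _ _ hK)).symm

variable {n : ℕ}

theorem colBasis_apply {ι : Type} [Fintype ι] [DecidableEq ι] (e : Matrix (Idx n) ι ℝ)
    {K : Submodule ℝ (Idx n → ℝ)} (hinj : Function.Injective e.mulVecLin)
    (hK : LinearMap.range e.mulVecLin = K) (i : ι) :
    (colBasis e hinj hK i : Idx n → ℝ) = fun k => e k i := by
  rw [colBasis, Module.Basis.coe_ofEquivFun]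
  change e *ᵥ Pi.single i 1 = _
  rw [Matrix.mulVec_single_one]
  rfl

theorem colMat_colBasis {ι : Type} [Fintype ι] [DecidableEq ι] (e : Matrix (Idx n) ι ℝ)
    {K : Submodule ℝ (Idx n → ℝ)} (hinj : Function.Injective e.mulVecLin)
    (hK : LinearMap.range e.mulVecLin = K) :
    colMat (fun i => (colBasis e hinj hK i : Idx n → ℝ)) = e := by
  ext k i
  exact congrFun (colBasis_apply e hinj hK i) k

/-- The columns of a family of vectors in terms of those of a basis. -/
theorem colMat_eq_mul {ι ι' : Type} [Fintype ι] {K : Submodule ℝ (Idx n → ℝ)}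
    (b : Module.Basis ι ℝ K) (v : ι' → K) :
    colMat (fun i => (v i : Idx n → ℝ)) = colMat (fun i => (b i : Idx n → ℝ)) * b.toMatrix v := by
  ext k i
  have h := congrArg (fun w : K => (w : Idx n → ℝ) k) (b.sum_toMatrix_smul_self v i)
  simp only [Submodule.coe_sum, Submodule.coe_smul, Finset.sum_apply, Pi.smul_apply,
    smul_eq_mul] at h
  rw [Matrix.mul_apply]
  change (v i : Idx n → ℝ) k = ∑ j, (b j : Idx n → ℝ) k * b.toMatrix v j i
  rw [← h]
  exact Finset.sum_congr rfl fun j _ => mul_comm _ _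

theorem injective_mulVecLin_of_mul_eq_one {l m : Type} [Fintype l] [Fintype m] [DecidableEq m]
    {e : Matrix l m ℝ} {d : Matrix m l ℝ} (h : d * e = 1) : Function.Injective e.mulVecLin := by
  refine Function.LeftInverse.injective (g := d.mulVec) fun a => ?_
  rw [Matrix.mulVecLin_apply, Matrix.mulVec_mulVec, h, Matrix.one_mulVec]

theorem range_mulVecLin_mul_le {l m p : Type} [Fintype m] [Fintype p]
    (A : Matrix l m ℝ) (B : Matrix m p ℝ) :
    LinearMap.range (A * B).mulVecLin ≤ LinearMap.range A.mulVecLin := by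
  rw [Matrix.mulVecLin_mul]
  exact LinearMap.range_comp_le_range _ _

theorem range_mulVecLin_mul {l m p : Type} [Fintype m] [Fintype p] [DecidableEq m]
    (A : Matrix l m ℝ) {B : Matrix m p ℝ} {D : Matrix p m ℝ} (h : B * D = 1) :
    LinearMap.range (A * B).mulVecLin = LinearMap.range A.mulVecLin := by
  refine le_antisymm (range_mulVecLin_mul_le A B) ?_
  have h2 := range_mulVecLin_mul_le (A * B) D
  rwa [Matrix.mul_assoc, h, Matrix.mul_one] at h2

theorem range_orientedSpan {x : Matrix (Idx n) (Fin 2) ℝ} (hx : x ∈ stiefel n) :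
    LinearMap.range (orientedSpan x).mulVecLin = LinearMap.range x.mulVecLin := by
  have hx' : xᵀ * x = 1 := hx
  rw [orientedSpan_eq, Matrix.mul_assoc]
  refine range_mulVecLin_mul x (D := -(x * eps)) ?_
  rw [Matrix.mul_neg, Matrix.mul_assoc, ← Matrix.mul_assoc xᵀ, hx', Matrix.one_mul, eps_mul_eps,
    neg_neg]

theorem mulVec_orientedSpan_eq_zero_iff {x : Matrix (Idx n) (Fin 2) ℝ} (hx : x ∈ stiefel n)
    {w : Idx n → ℝ} : orientedSpan x *ᵥ w = 0 ↔ xᵀ *ᵥ w = 0 := by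
  have hx' : xᵀ * x = 1 := hx
  constructor
  · intro h
    have h2 : -(eps * xᵀ) * orientedSpan x = xᵀ := by
      rw [orientedSpan_eq, Matrix.neg_mul, ← Matrix.mul_assoc, ← Matrix.mul_assoc,
        Matrix.mul_assoc eps, hx', Matrix.mul_one, eps_mul_eps, Matrix.neg_mul, neg_neg,
        Matrix.one_mul]
    rw [← h2, ← Matrix.mulVec_mulVec, h, Matrix.mulVec_zero]
  · intro h
    rw [orientedSpan_eq, ← Matrix.mulVec_mulVec, h, Matrix.mulVec_zero]

theorem range_mulVecLin_eq_ker_orientedSpan {x : Matrix (Idx n) (Fin 2) ℝ}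
    {C : Matrix (Idx n) (Fin n) ℝ}
    (hx : x ∈ stiefel n) (hxC : xᵀ * C = 0) (hC : Cᵀ * C = 1) :
    LinearMap.range C.mulVecLin = LinearMap.ker (orientedSpan x).mulVecLin := by
  ext w
  rw [LinearMap.mem_ker, Matrix.mulVecLin_apply, mulVec_orientedSpan_eq_zero_iff hx]
  constructor
  · rintro ⟨a, rfl⟩
    rw [Matrix.mulVecLin_apply, Matrix.mulVec_mulVec, hxC, Matrix.zero_mulVec]
  · intro h
    refine ⟨Cᵀ *ᵥ w, ?_⟩
    have h2 := congrArg (· *ᵥ w) (mul_transpose_add_mul_transpose hx hxC hC)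
    simp only [Matrix.add_mulVec, ← Matrix.mulVec_mulVec, h, Matrix.mulVec_zero, zero_add,
      Matrix.one_mulVec] at h2
    exact h2

theorem exists_adaptedFrame (hn : 0 < n) (J : orientedGrassmannian n) :
    ∃ u ∈ lieTotal n, u.2.1 = 1 ∧ orientedSpan u.1 = (J : Matrix (Idx n) (Idx n) ℝ) := by
  obtain ⟨x, hx, hJ⟩ := J.2
  obtain ⟨C, c1, c2, c3⟩ := exists_completion hn hx
  exact ⟨(x, 1, C), ⟨hx, c1, c2, by simp, c3⟩, rfl, hJ⟩

/-- A choice of an orthonormal adapted frame of an oriented plane and of its orthogonal complement. -/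
noncomputable def adaptedFrame (hn : 0 < n) (J : orientedGrassmannian n) : FrameSpace n :=
  (exists_adaptedFrame hn J).choose

theorem adaptedFrame_mem (hn : 0 < n) (J : orientedGrassmannian n) :
    adaptedFrame hn J ∈ lieTotal n := (exists_adaptedFrame hn J).choose_spec.1

theorem adaptedFrame_snd (hn : 0 < n) (J : orientedGrassmannian n) :
    (adaptedFrame hn J).2.1 = 1 := (exists_adaptedFrame hn J).choose_spec.2.1

theorem orientedSpan_adaptedFrame (hn : 0 < n) (J : orientedGrassmannian n) :
    orientedSpan (adaptedFrame hn J).1 = (J : Matrix (Idx n) (Idx n) ℝ) :=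
  (exists_adaptedFrame hn J).choose_spec.2.2

/-- The tautological plane. -/
def planeOf (J : orientedGrassmannian n) : Submodule ℝ (Idx n → ℝ) :=
  LinearMap.range (J : Matrix (Idx n) (Idx n) ℝ).mulVecLin

/-- The orthogonal complement of the tautological plane. -/
def normalOf (J : orientedGrassmannian n) : Submodule ℝ (Idx n → ℝ) :=
  LinearMap.ker (J : Matrix (Idx n) (Idx n) ℝ).mulVecLin

/-- The basis of the tautological plane given by the chosen adapted frame. -/
noncomputable def planeBasis (hn : 0 < n) (J : orientedGrassmannian n) :
    Module.Basis (Fin 2) ℝ (planeOf J) :=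
  colBasis (adaptedFrame hn J).1
    (injective_mulVecLin_of_mul_eq_one (d := (adaptedFrame hn J).1ᵀ) (adaptedFrame_mem hn J).1) (by
      rw [planeOf, ← orientedSpan_adaptedFrame hn J, range_orientedSpan (adaptedFrame_mem hn J).1])

/-- The basis of the orthogonal complement given by the chosen adapted frame. -/
noncomputable def normalBasis (hn : 0 < n) (J : orientedGrassmannian n) :
    Module.Basis (Fin n) ℝ (normalOf J) :=
  colBasis (adaptedFrame hn J).2.2
    (injective_mulVecLin_of_mul_eq_one (d := (adaptedFrame hn J).2.2ᵀ)
      (adaptedFrame_mem hn J).2.2.1) (by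
      rw [normalOf, ← orientedSpan_adaptedFrame hn J]
      exact range_mulVecLin_eq_ker_orientedSpan (adaptedFrame_mem hn J).1
        (adaptedFrame_mem hn J).2.1 (adaptedFrame_mem hn J).2.2.1)

/-- The isomorphism `Hom(E, F) ≅ T G₂⁺`, in the chosen adapted frame. -/
noncomputable def grassmannIso (hn : 0 < n) (J : orientedGrassmannian n) :
    (planeOf J →ₗ[ℝ] normalOf J) ≃ₗ[ℝ]
      tangentSpaceAt (orientedGrassmannian n) (J : Matrix (Idx n) (Idx n) ℝ) :=
  ((LinearMap.toMatrix (planeBasis hn J) (normalBasis hn J)).trans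
    (LinearEquiv.ofInjective ((grassmannG0Structure n).frame (quotMap (adaptedFrame hn J)))
      (frame_quotMap_injective (adaptedFrame_mem hn J)))).trans
    (LinearEquiv.ofEq _ _ (by
      rw [(isG0Structure_grassmannG0Structure hn).frame_range _
        (quotMap_mem (adaptedFrame_mem hn J)), ← orientedSpan_adaptedFrame hn J]
      rfl))

/-- The isomorphism does not depend on the choice of a frame: an infinitesimal displacement `φ` of
the plane moves a frame `e` of the plane with the velocity `φ ∘ e`. -/
theorem spanDeriv_colMat (hn : 0 < n) (J : orientedGrassmannian n) (φ : planeOf J →ₗ[ℝ] normalOf J)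
    (e : Fin 2 → planeOf J) :
    orientedSpan (colMat fun i => (e i : Idx n → ℝ)) =
      (planeBasis hn J).det e • (J : Matrix (Idx n) (Idx n) ℝ) ∧
    spanDeriv (colMat fun i => (e i : Idx n → ℝ)) (colMat fun i => (φ (e i) : Idx n → ℝ)) =
      (planeBasis hn J).det e • (grassmannIso hn J φ : Matrix (Idx n) (Idx n) ℝ) := by
  set x := (adaptedFrame hn J).1 with hx
  set C := (adaptedFrame hn J).2.2 with hC
  set A := (planeBasis hn J).toMatrix e with hA
  have he : colMat (fun i => (e i : Idx n → ℝ)) = x * A := by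
    have h1 : colMat (fun i => (planeBasis hn J i : Idx n → ℝ)) = x := colMat_colBasis _ _ _
    rw [colMat_eq_mul (planeBasis hn J) e, h1]
  have hφ : colMat (fun i => (φ (e i) : Idx n → ℝ)) =
      C * LinearMap.toMatrix (planeBasis hn J) (normalBasis hn J) φ * A := by
    rw [colMat_eq_mul (normalBasis hn J) fun i => φ (e i)]
    have h1 : colMat (fun i => (normalBasis hn J i : Idx n → ℝ)) = C :=
      colMat_colBasis _ _ _
    have h2 : (normalBasis hn J).toMatrix (fun i => φ (e i)) =
        LinearMap.toMatrix (planeBasis hn J) (normalBasis hn J) φ * A := by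
      ext j i
      exact (congrFun (LinearMap.toMatrix_mulVec_repr (planeBasis hn J) (normalBasis hn J) φ
        (e i)) j).symm
    rw [h1, h2, Matrix.mul_assoc]
  have hiso : (grassmannIso hn J φ : Matrix (Idx n) (Idx n) ℝ) =
      spanDeriv x (C * LinearMap.toMatrix (planeBasis hn J) (normalBasis hn J) φ) := by
    refine (frame_quotMap (adaptedFrame_mem hn J) _).trans ?_
    rw [adaptedFrame_snd, inv_one, Matrix.mul_one]
    rfl
  rw [Module.Basis.det_apply, ← hA, he, hφ, hiso, orientedSpan_mul, orientedSpan_adaptedFrame]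
  refine ⟨rfl, ?_⟩
  have hAA := mul_eps_mul_transpose A
  have key : ∀ a b : Matrix (Idx n) (Fin 2) ℝ, a * A * eps * (b * A)ᵀ = A.det • (a * eps * bᵀ) := by
    intro a b
    rw [Matrix.transpose_mul]
    calc a * A * eps * (Aᵀ * bᵀ) = a * (A * eps * Aᵀ) * bᵀ := by simp only [Matrix.mul_assoc]
      _ = _ := by rw [hAA, Matrix.mul_smul, Matrix.smul_mul]
  rw [spanDeriv, spanDeriv, key, key, smul_add]

end StandardGrassmannian

/-! ### The invariant symplectic form of the Grassmannian -/

section SymplecticForm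

variable {V : Type} [NormedAddCommGroup V] [NormedSpace ℝ V] [FiniteDimensional ℝ V]

/-- The `2`-form `J ↦ T J` with linear coefficients that is given by a trilinear map `T` which is
alternating in the last two variables. -/
noncomputable def linearTwoForm (T : V →ₗ[ℝ] V →ₗ[ℝ] V →ₗ[ℝ] ℝ) (hT : ∀ J v, T J v v = 0) :
    V →L[ℝ] V [⋀^Fin 2]→L[ℝ] ℝ :=
  LinearMap.toContinuousLinearMap
    { toFun := fun J =>
        { toFun := fun v => T J (v 0) (v 1)
          map_update_add' := by
            intro _ v i a b
            fin_cases i <;> simp [Function.update]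
          map_update_smul' := by
            intro _ v i c a
            fin_cases i <;> simp [Function.update]
          map_eq_zero_of_eq' := by
            intro v i j h hij
            fin_cases i <;> fin_cases j <;> simp_all
          cont := by
            have h : Continuous fun p : V × V => (LinearMap.toContinuousLinearMap
                (LinearMap.toContinuousLinearMap.toLinearMap ∘ₗ T J)) p.1 p.2 := by
              fun_prop
            exact h.comp (f := fun v : Fin 2 → V => (v 0, v 1)) (by fun_prop) }
      map_add' := by
        intro J J'
        ext v
        change T (J + J') (v 0) (v 1) = T J (v 0) (v 1) + T J' (v 0) (v 1)
        rw [map_add, LinearMap.add_apply, LinearMap.add_apply]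
      map_smul' := by
        intro c J
        ext v
        change T (c • J) (v 0) (v 1) = c • T J (v 0) (v 1)
        rw [map_smul, LinearMap.smul_apply, LinearMap.smul_apply] }

theorem linearTwoForm_apply (T : V →ₗ[ℝ] V →ₗ[ℝ] V →ₗ[ℝ] ℝ) (hT : ∀ J v, T J v v = 0) (J : V)
    (v : Fin 2 → V) : linearTwoForm T hT J v = T J (v 0) (v 1) := rfl

/-- The exterior derivative on `S` of a form with linear coefficients is determined by the values of
the trilinear map on tangent vectors. -/
theorem extDerivWithin_linearTwoForm {T : V →ₗ[ℝ] V →ₗ[ℝ] V →ₗ[ℝ] ℝ} {hT : ∀ J v, T J v v = 0}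
    {S : Set V} {x : V} (hx : x ∈ S)
    (h : ∀ a ∈ tangentSpaceAt S x, ∀ b ∈ tangentSpaceAt S x, ∀ c ∈ tangentSpaceAt S x, T a b c = 0)
    {v : Fin 3 → V} (hv : ∀ i, v i ∈ tangentSpaceAt S x) :
    extDerivWithin (linearTwoForm T hT) S x v = 0 := by
  rw [extDerivWithin, ContinuousAlternatingMap.alternatizeUncurryFin_apply]
  refine Finset.sum_eq_zero fun i _ => ?_
  rw [(linearTwoForm T hT).hasFDerivWithinAt.fderivWithin_apply_of_eqOn (fun _ _ => rfl) hx (hv i),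
    linearTwoForm_apply]
  exact (congrArg _ (h _ (hv i) _ (hv (i.succAbove 0)) _ (hv (i.succAbove 1)))).trans (smul_zero _)

end SymplecticForm

section GrassmannSymplectic

variable {n : ℕ}

/-- The trilinear map `(J, v, w) ↦ tr (J [v, w])`. -/
noncomputable def traceCommutator (n : ℕ) : Matrix (Idx n) (Idx n) ℝ →ₗ[ℝ]
    Matrix (Idx n) (Idx n) ℝ →ₗ[ℝ] Matrix (Idx n) (Idx n) ℝ →ₗ[ℝ] ℝ :=
  LinearMap.mk₂ ℝ
    (fun J v => Matrix.traceLinearMap (Idx n) ℝ ℝ ∘ₗ LinearMap.mulLeft ℝ J ∘ₗ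
      (LinearMap.mulLeft ℝ v - LinearMap.mulRight ℝ v))
    (by intro J J' v; ext1 w; simp [add_mul])
    (by intro c J v; ext1 w; simp)
    (by intro J v v'; ext1 w; simp [mul_add, add_mul, mul_sub]; ring)
    (by intro c J v; ext1 w; simp [mul_sub])

theorem traceCommutator_apply (J v w : Matrix (Idx n) (Idx n) ℝ) :
    traceCommutator n J v w = (J * (v * w - w * v)).trace := rfl

theorem traceCommutator_self (J v : Matrix (Idx n) (Idx n) ℝ) : traceCommutator n J v v = 0 := by
  rw [traceCommutator_apply, sub_self, Matrix.mul_zero, Matrix.trace_zero]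

/-- The form `ω_J(v, w) = tr (J [v, w])`, which induces the invariant symplectic form of the
Grassmannian, realized as an adjoint orbit of `SO(n + 2)`. -/
noncomputable def symplForm (n : ℕ) :
    Matrix (Idx n) (Idx n) ℝ →L[ℝ] Matrix (Idx n) (Idx n) ℝ [⋀^Fin 2]→L[ℝ] ℝ :=
  linearTwoForm (traceCommutator n) traceCommutator_self

/-- Products of two tangent vectors are block diagonal with respect to `E ⊕ F`. -/
theorem spanDeriv_mul_spanDeriv {x w w' : Matrix (Idx n) (Fin 2) ℝ} (hx : xᵀ * x = 1)
    (hw : xᵀ * w = 0) (hw' : xᵀ * w' = 0) :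
    spanDeriv x w * spanDeriv x w' = x * (eps * wᵀ * w' * eps) * xᵀ - w * w'ᵀ := by
  have h : wᵀ * x = 0 := by simpa using congrArg Matrix.transpose hw
  have e1 : w * eps * xᵀ * (w' * eps * xᵀ) = 0 := by
    calc _ = w * eps * (xᵀ * w') * eps * xᵀ := by simp only [Matrix.mul_assoc]
      _ = 0 := by rw [hw']; simp
  have e2 : x * eps * wᵀ * (x * eps * w'ᵀ) = 0 := by
    calc _ = x * eps * (wᵀ * x) * eps * w'ᵀ := by simp only [Matrix.mul_assoc]
      _ = 0 := by rw [h]; simp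
  have e3 : w * eps * xᵀ * (x * eps * w'ᵀ) = -(w * w'ᵀ) := by
    calc _ = w * (eps * (xᵀ * x) * eps) * w'ᵀ := by simp only [Matrix.mul_assoc]
      _ = _ := by rw [hx, Matrix.mul_one, eps_mul_eps]; simp
  rw [spanDeriv, spanDeriv, Matrix.add_mul, Matrix.mul_add, Matrix.mul_add, e1, e2, e3, zero_add,
    add_zero, neg_add_eq_sub]
  simp only [Matrix.mul_assoc]

/-- A product of three tangent vectors interchanges `E` and `F`, so that its trace vanishes. -/
theorem trace_spanDeriv_mul_mul {x w₀ w₁ w₂ : Matrix (Idx n) (Fin 2) ℝ} (hx : xᵀ * x = 1)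
    (h₀ : xᵀ * w₀ = 0) (h₁ : xᵀ * w₁ = 0) (h₂ : xᵀ * w₂ = 0) :
    (spanDeriv x w₀ * (spanDeriv x w₁ * spanDeriv x w₂)).trace = 0 := by
  have h₀' : w₀ᵀ * x = 0 := by simpa using congrArg Matrix.transpose h₀
  have h₂' : w₂ᵀ * x = 0 := by simpa using congrArg Matrix.transpose h₂
  rw [spanDeriv_mul_spanDeriv hx h₁ h₂]
  generalize eps * w₁ᵀ * w₂ * eps = M
  have e1 : (w₀ * eps * xᵀ * (x * M * xᵀ)).trace = 0 := by
    rw [← Matrix.mul_assoc, Matrix.trace_mul_comm, ← Matrix.mul_assoc, ← Matrix.mul_assoc,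
      ← Matrix.mul_assoc, ← Matrix.mul_assoc, h₀]
    simp
  have e2 : w₀ * eps * xᵀ * (w₁ * w₂ᵀ) = 0 := by
    calc _ = w₀ * eps * (xᵀ * w₁) * w₂ᵀ := by simp only [Matrix.mul_assoc]
      _ = 0 := by rw [h₁]; simp
  have e3 : x * eps * w₀ᵀ * (x * M * xᵀ) = 0 := by
    calc _ = x * eps * (w₀ᵀ * x) * M * xᵀ := by simp only [Matrix.mul_assoc]
      _ = 0 := by rw [h₀']; simp
  have e4 : (x * eps * w₀ᵀ * (w₁ * w₂ᵀ)).trace = 0 := by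
    rw [← Matrix.mul_assoc, Matrix.trace_mul_comm, ← Matrix.mul_assoc, ← Matrix.mul_assoc,
      ← Matrix.mul_assoc, h₂']
    simp
  rw [Matrix.mul_sub, spanDeriv, Matrix.add_mul, Matrix.add_mul, e2, e3, add_zero, zero_add,
    Matrix.trace_sub, e1, e4, sub_zero]

theorem symplForm_spanDeriv {x w w' : Matrix (Idx n) (Fin 2) ℝ} (hx : xᵀ * x = 1)
    (hw : xᵀ * w = 0) (hw' : xᵀ * w' = 0) :
    symplForm n (orientedSpan x) ![spanDeriv x w, spanDeriv x w'] = -2 * (wᵀ * w' * eps).trace := by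
  have key : ∀ a b : Matrix (Idx n) (Fin 2) ℝ, xᵀ * a = 0 → xᵀ * b = 0 →
      (orientedSpan x * (spanDeriv x a * spanDeriv x b)).trace = -(aᵀ * b * eps).trace := by
    intro a b ha hb
    have e : orientedSpan x * (spanDeriv x a * spanDeriv x b) = x * (-(aᵀ * b * eps) * xᵀ) := by
      rw [spanDeriv_mul_spanDeriv hx ha hb, orientedSpan_eq, Matrix.mul_sub]
      have e1 : x * eps * xᵀ * (a * bᵀ) = 0 := by
        calc _ = x * eps * (xᵀ * a) * bᵀ := by simp only [Matrix.mul_assoc]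
          _ = 0 := by rw [ha]; simp
      have e2 : x * eps * xᵀ * (x * (eps * aᵀ * b * eps) * xᵀ) =
          x * ((eps * (xᵀ * x) * eps) * (aᵀ * b * eps) * xᵀ) := by simp only [Matrix.mul_assoc]
      rw [e1, e2, hx, Matrix.mul_one, eps_mul_eps, sub_zero, Matrix.neg_mul, Matrix.one_mul]
    rw [e, Matrix.trace_mul_comm, Matrix.mul_assoc, hx, Matrix.mul_one, Matrix.trace_neg]
  have hsym : (w'ᵀ * w * eps).trace = -(wᵀ * w' * eps).trace := by
    rw [← Matrix.trace_transpose, Matrix.transpose_mul, Matrix.transpose_mul, transpose_eps,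
      Matrix.transpose_transpose, Matrix.trace_mul_comm, Matrix.mul_neg, Matrix.trace_neg]
  change (orientedSpan x * (spanDeriv x w * spanDeriv x w' - spanDeriv x w' * spanDeriv x w)).trace = _
  rw [Matrix.mul_sub, Matrix.trace_sub, key w w' hw hw', key w' w hw' hw, hsym]
  ring

theorem extDerivWithin_symplForm {J : Matrix (Idx n) (Idx n) ℝ} (hJ : J ∈ orientedGrassmannian n)
    {v : Fin 3 → Matrix (Idx n) (Idx n) ℝ}
    (hv : ∀ i, v i ∈ tangentSpaceAt (orientedGrassmannian n) J) :
    extDerivWithin (symplForm n) (orientedGrassmannian n) J v = 0 := by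
  refine extDerivWithin_linearTwoForm hJ ?_ hv
  obtain ⟨x, hx, rfl⟩ := hJ
  intro a ha b hb c hc
  obtain ⟨w₀, h₀, rfl⟩ := (mem_tangentSpaceAt_grassmannian hx).1 ha
  obtain ⟨w₁, h₁, rfl⟩ := (mem_tangentSpaceAt_grassmannian hx).1 hb
  obtain ⟨w₂, h₂, rfl⟩ := (mem_tangentSpaceAt_grassmannian hx).1 hc
  rw [traceCommutator_apply, Matrix.mul_sub, Matrix.trace_sub, trace_spanDeriv_mul_mul hx h₀ h₁ h₂,
    trace_spanDeriv_mul_mul hx h₀ h₂ h₁, sub_zero]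

/-- The symplectic form is non-degenerate: `w` is paired with `w ε`, that is, with its image under
the invariant complex structure. -/
theorem eq_zero_of_symplForm_eq_zero {J v : Matrix (Idx n) (Idx n) ℝ} (hJ : J ∈ orientedGrassmannian n)
    (hv : v ∈ tangentSpaceAt (orientedGrassmannian n) J)
    (h : ∀ w ∈ tangentSpaceAt (orientedGrassmannian n) J, symplForm n J ![v, w] = 0) : v = 0 := by
  obtain ⟨x, hx, rfl⟩ := hJ
  obtain ⟨w, hw, rfl⟩ := (mem_tangentSpaceAt_grassmannian hx).1 hv
  have hw' : xᵀ * (w * eps) = 0 := by rw [← Matrix.mul_assoc, hw, Matrix.zero_mul]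
  have h1 := h _ ((mem_tangentSpaceAt_grassmannian hx).2 ⟨_, hw', rfl⟩)
  rw [symplForm_spanDeriv hx hw hw', Matrix.mul_assoc, Matrix.mul_assoc w, eps_mul_eps] at h1
  have h2 : (wᴴ * w).trace = 0 := by
    rw [Matrix.conjTranspose_eq_transpose_of_trivial]
    simpa using h1
  rw [Matrix.trace_conjTranspose_mul_self_eq_zero_iff] at h2
  rw [h2]
  simp [spanDeriv]

end GrassmannSymplectic

/-! ### The PCS-structure on the Grassmannian -/

section GrassmannPCS

variable {n : ℕ}

/-- The PCS-structure of Grassmannian type on `G₂⁺(ℝ^{n+2})`.  The orientations and the trivialization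
are given by the chosen adapted frames, and turn out not to depend on this choice. -/
noncomputable def grassmannPACS (hn : 0 < n) :
    PACSData n (orientedGrassmannian n) (Idx n → ℝ) (Idx n → ℝ) where
  E := planeOf
  F := normalOf
  iso := grassmannIso hn
  orE J := (planeBasis hn J).orientation
  orF J := (normalBasis hn J).orientation
  vol J := (LinearMap.toSpanSingleton ℝ _ (normalBasis hn J).det).compAlternatingMap
    (planeBasis hn J).det
  ell J := Submodule.span ℝ {restrictForm (orientedGrassmannian n) J (symplForm n J)}

theorem colMat_planeBasis (hn : 0 < n) (J : orientedGrassmannian n) :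
    colMat (fun i => (planeBasis hn J i : Idx n → ℝ)) = (adaptedFrame hn J).1 :=
  colMat_colBasis _ _ _

theorem colMat_normalBasis (hn : 0 < n) (J : orientedGrassmannian n) :
    colMat (fun i => (normalBasis hn J i : Idx n → ℝ)) = (adaptedFrame hn J).2.2 :=
  colMat_colBasis _ _ _

/-- The matrices of oriented planes are non-zero, so that a factor of `J` can be read off. -/
theorem smul_orientedGrassmannian_injective (J : orientedGrassmannian n) :
    Function.Injective fun c : ℝ => c • (J : Matrix (Idx n) (Idx n) ℝ) := by
  refine smul_left_injective ℝ fun h => eps_ne_zero ?_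
  obtain ⟨x, hx, hJ⟩ := J.2
  have hx' : xᵀ * x = 1 := hx
  calc eps = (xᵀ * x) * eps * (xᵀ * x) := by rw [hx', Matrix.one_mul, Matrix.mul_one]
    _ = xᵀ * orientedSpan x * x := by rw [orientedSpan_eq]; simp only [Matrix.mul_assoc]
    _ = 0 := by rw [hJ, h, Matrix.mul_zero, Matrix.zero_mul]

/-- The trivialization of `Λ²E ⊗ ΛⁿF`, defined by the chosen adapted frame, is the determinant of
`ℝ^{n+2} = E ⊕ F`, since the adapted frame has determinant one. -/
theorem grassmannPACS_vol (hn : 0 < n) (J : orientedGrassmannian n) (e : Fin 2 → planeOf J)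
    (f : Fin n → normalOf J) : (grassmannPACS hn).vol J e f =
      (Matrix.fromCols (colMat fun i => (e i : Idx n → ℝ))
        (colMat fun i => (f i : Idx n → ℝ)) : Matrix (Idx n) (Idx n) ℝ).det := by
  have hu := adaptedFrame_mem hn J
  rw [colMat_eq_mul (planeBasis hn J) e, colMat_eq_mul (normalBasis hn J) f, colMat_planeBasis,
    colMat_normalBasis, det_fromCols_mul, det_fromCols_eq_one hu.1 hu.2.1 hu.2.2.1 hu.2.2.2.2,
    one_mul]
  rfl

theorem grassmannPACS_orE (hn : 0 < n) (J : orientedGrassmannian n)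
    (b : Module.Basis (Fin 2) ℝ (planeOf J)) :
    b.orientation = (grassmannPACS hn).orE J ↔ 0 < (planeBasis hn J).det b :=
  eq_comm.trans (Module.Basis.orientation_eq_iff_det_pos _ _)

theorem grassmannPACS_orF (hn : 0 < n) (J : orientedGrassmannian n)
    (b : Module.Basis (Fin n) ℝ (normalOf J)) :
    b.orientation = (grassmannPACS hn).orF J ↔ 0 < (normalBasis hn J).det b :=
  eq_comm.trans (Module.Basis.orientation_eq_iff_det_pos _ _)

/-- Each point of the total space of the `G₀`-structure consists of bases of `E` and `F` with the
required properties. -/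
theorem exists_adapted_bases (hn : 0 < n) {p : QuotSpace n}
    (hp : p ∈ (grassmannG0Structure n).total) (J : orientedGrassmannian n)
    (hpJ : (J : Matrix (Idx n) (Idx n) ℝ) = p.1) :
    ∃ (bE : Module.Basis (Fin 2) ℝ (planeOf J)) (bF : Module.Basis (Fin n) ℝ (normalOf J)),
      (∀ i, (bE i : Idx n → ℝ) = fun k => p.2.1 k i) ∧
      (∀ j, (bF j : Idx n → ℝ) = fun k => p.2.2 k j) ∧
      bE.orientation = (grassmannPACS hn).orE J ∧ bF.orientation = (grassmannPACS hn).orF J ∧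
      (∀ i j, standardMetric (normalOf J) (bF i) (bF j) = if i = j then 1 else 0) ∧
      (∀ X, (grassmannIso hn J (Matrix.toLin bE bF X) : Matrix (Idx n) (Idx n) ℝ) =
        (grassmannG0Structure n).frame p X) ∧
      (grassmannPACS hn).vol J bE bF = (Matrix.fromCols p.2.1 p.2.2).det := by
  have hδ := hp.1.2.2
  have hC := hp.1.2.1
  obtain ⟨u, hu, rfl⟩ := exists_quotMap_eq hp
  have hJ : (J : Matrix (Idx n) (Idx n) ℝ) = orientedSpan u.1 := hpJ
  have hA : IsUnit u.2.1.det := isUnit_iff_ne_zero.2 hu.2.2.2.1.ne'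
  have hinj : Function.Injective (u.1 * u.2.1).mulVecLin := by
    refine injective_mulVecLin_of_mul_eq_one (d := u.2.1⁻¹ * u.1ᵀ) ?_
    have h : u.1ᵀ * u.1 = 1 := hu.1
    rw [Matrix.mul_assoc, ← Matrix.mul_assoc u.1ᵀ, h, Matrix.one_mul, Matrix.nonsing_inv_mul _ hA]
  have hE : LinearMap.range (u.1 * u.2.1).mulVecLin = planeOf J := by
    rw [range_mulVecLin_mul _ (Matrix.mul_nonsing_inv _ hA), planeOf, hJ, range_orientedSpan hu.1]
  have hF : LinearMap.range u.2.2.mulVecLin = normalOf J := by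
    rw [normalOf, hJ]
    exact range_mulVecLin_eq_ker_orientedSpan hu.1 hu.2.1 hu.2.2.1
  let bE := colBasis (u.1 * u.2.1) hinj hE
  let bF := colBasis u.2.2 (injective_mulVecLin_of_mul_eq_one (d := u.2.2ᵀ) hu.2.2.1) hF
  have hbE : colMat (fun i => (bE i : Idx n → ℝ)) = u.1 * u.2.1 := colMat_colBasis _ _ _
  have hbF : colMat (fun i => (bF i : Idx n → ℝ)) = u.2.2 := colMat_colBasis _ _ _
  have hdet : (planeBasis hn J).det bE = (Matrix.fromCols (u.1 * u.2.1) u.2.2).det := by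
    have h := (spanDeriv_colMat hn J 0 bE).1
    rw [hbE, orientedSpan_mul, ← hJ] at h
    rw [det_fromCols_mul_left hu]
    exact (smul_orientedGrassmannian_injective J h).symm
  have hvol : (grassmannPACS hn).vol J bE bF = (Matrix.fromCols (u.1 * u.2.1) u.2.2).det := by
    rw [← hbE, ← hbF]
    exact grassmannPACS_vol hn J bE bF
  refine ⟨bE, bF, colBasis_apply _ _ _, colBasis_apply _ _ _, ?_, ?_, ?_, ?_, hvol⟩
  · rw [grassmannPACS_orE, hdet]
    exact hδ
  · rw [grassmannPACS_orF]
    have h : (planeBasis hn J).det bE * (normalBasis hn J).det bF =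
      (Matrix.fromCols (u.1 * u.2.1) u.2.2).det := hvol
    rw [hdet] at h
    have h' := mul_left_cancel₀ hδ.ne' (h.trans (mul_one _).symm)
    rw [h']
    exact one_pos
  · intro i j
    have h := congrFun (congrFun hC i) j
    change (bF i : Idx n → ℝ) ⬝ᵥ (bF j : Idx n → ℝ) = _
    rw [colBasis_apply, colBasis_apply]
    exact h.trans (Matrix.one_apply ..)
  · intro X
    have h := (spanDeriv_colMat hn J (Matrix.toLin bE bF X) bE).2
    have hX : colMat (fun i => (Matrix.toLin bE bF X (bE i) : Idx n → ℝ)) = u.2.2 * X := by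
      rw [colMat_eq_mul bF fun i => Matrix.toLin bE bF X (bE i), hbF]
      congr 1
      ext j i
      exact (LinearMap.toMatrix_apply bE bF _ j i).symm.trans
        (congrFun (congrFun (LinearMap.toMatrix_toLin bE bF X) j) i)
    rw [hdet, hbE, hX] at h
    change _ = (Matrix.fromCols (u.1 * u.2.1) u.2.2).det⁻¹ • (u.2.2 * (X * eps * (u.1 * u.2.1)ᵀ) +
      u.1 * u.2.1 * eps * Xᵀ * u.2.2ᵀ)
    rw [eq_inv_smul_iff₀ (a := (Matrix.fromCols (u.1 * u.2.1) u.2.2).det) hδ.ne', ← h, spanDeriv,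
      Matrix.transpose_mul u.2.2]
    simp only [Matrix.mul_assoc]

/-- The symplectic form on `Hom(E, F)`. -/
theorem symplForm_grassmannIso (hn : 0 < n) (J : orientedGrassmannian n)
    (φ ψ : planeOf J →ₗ[ℝ] normalOf J) :
    symplForm n (J : Matrix (Idx n) (Idx n) ℝ) ![(grassmannIso hn J φ : Matrix (Idx n) (Idx n) ℝ),
        (grassmannIso hn J ψ : Matrix (Idx n) (Idx n) ℝ)] =
      -2 * ((φ (planeBasis hn J 0) : Idx n → ℝ) ⬝ᵥ (ψ (planeBasis hn J 1) : Idx n → ℝ) -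
        (φ (planeBasis hn J 1) : Idx n → ℝ) ⬝ᵥ (ψ (planeBasis hn J 0) : Idx n → ℝ)) := by
  have hu := adaptedFrame_mem hn J
  have key : ∀ φ : planeOf J →ₗ[ℝ] normalOf J, ∃ W : Matrix (Idx n) (Fin 2) ℝ,
      W = colMat (fun i => (φ (planeBasis hn J i) : Idx n → ℝ)) ∧
      (adaptedFrame hn J).1ᵀ * W = 0 ∧
      (grassmannIso hn J φ : Matrix (Idx n) (Idx n) ℝ) = spanDeriv (adaptedFrame hn J).1 W := by
    intro φ
    refine ⟨_, rfl, ?_, ?_⟩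
    · rw [colMat_eq_mul (normalBasis hn J) fun i => φ (planeBasis hn J i), colMat_normalBasis,
        ← Matrix.mul_assoc, hu.2.1, Matrix.zero_mul]
    · have h := (spanDeriv_colMat hn J φ (planeBasis hn J)).2
      rw [Module.Basis.det_self, one_smul, colMat_planeBasis] at h
      exact h.symm
  obtain ⟨W, hW, hW0, hφ⟩ := key φ
  obtain ⟨W', hW', hW0', hψ⟩ := key ψ
  rw [hφ, hψ, ← orientedSpan_adaptedFrame hn J, symplForm_spanDeriv hu.1 hW0 hW0']
  congr 1
  have h : ∀ i j, (Wᵀ * W') i j =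
      (φ (planeBasis hn J i) : Idx n → ℝ) ⬝ᵥ (ψ (planeBasis hn J j) : Idx n → ℝ) := by
    intro i j
    rw [hW, hW']
    rfl
  rw [Matrix.trace_fin_two, Matrix.mul_apply, Matrix.mul_apply, Fin.sum_univ_two, Fin.sum_univ_two,
    h, h, h, h]
  simp [eps, sub_eq_add_neg]

/-- The symplectic form is, up to a factor, the tensor product of the area form on `E*` and the
standard metric on `F`. -/
theorem symplForm_smulRight (hn : 0 < n) (J : orientedGrassmannian n)
    (a b : Module.Dual ℝ (planeOf J)) (f f' : normalOf J) :
    symplForm n (J : Matrix (Idx n) (Idx n) ℝ)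
        ![(grassmannIso hn J (LinearMap.smulRight a f) : Matrix (Idx n) (Idx n) ℝ),
          (grassmannIso hn J (LinearMap.smulRight b f') : Matrix (Idx n) (Idx n) ℝ)] =
      -2 * (a (planeBasis hn J 0) * b (planeBasis hn J 1) -
        a (planeBasis hn J 1) * b (planeBasis hn J 0)) * standardMetric (normalOf J) f f' := by
  have e : standardMetric (normalOf J) f f' = (f : Idx n → ℝ) ⬝ᵥ (f' : Idx n → ℝ) := rfl
  rw [symplForm_grassmannIso, e]
  simp only [LinearMap.smulRight_apply, Submodule.coe_smul, smul_dotProduct, dotProduct_smul,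
    smul_eq_mul]
  ring

theorem inRay_standardMetric (hn : 0 < n) (J : orientedGrassmannian n) :
    (grassmannPACS hn).InRay J (standardMetric (normalOf J)) where
  symm f f' := dotProduct_comm (f : Idx n → ℝ) (f' : Idx n → ℝ)
  pos f hf := by
    change 0 < (f : Idx n → ℝ) ⬝ᵥ (f : Idx n → ℝ)
    refine lt_of_le_of_ne (Finset.sum_nonneg fun _ _ => mul_self_nonneg _) fun h => hf ?_
    exact Subtype.ext (dotProduct_self_eq_zero.1 h.symm)
  decomposes := by
    intro β hβ
    obtain ⟨c, rfl⟩ := Submodule.mem_span_singleton.1 hβ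
    refine ⟨(c * -2) • (Matrix.detRowAlternating (n := Fin 2) (R := ℝ)).compLinearMap
      (LinearMap.pi fun i => Module.Dual.eval ℝ _ (planeBasis hn J i)), fun a b f f' => ?_⟩
    refine (congrArg (c * ·) (symplForm_smulRight hn J a b f f')).trans ?_
    have e : (Matrix.detRowAlternating (n := Fin 2) (R := ℝ)).compLinearMap
        (LinearMap.pi fun i => Module.Dual.eval ℝ _ (planeBasis hn J i)) ![a, b] =
        a (planeBasis hn J 0) * b (planeBasis hn J 1) -
        a (planeBasis hn J 1) * b (planeBasis hn J 0) := by
      rw [AlternatingMap.compLinearMap_apply]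
      exact Matrix.det_fin_two _
    refine Eq.trans ?_ (congrArg (fun t : ℝ => (c * -2) * t * standardMetric (normalOf J) f f') e.symm)
    have assoc : ∀ D m : ℝ, c * (-2 * D * m) = c * -2 * D * m := fun _ _ => by ring
    exact assoc _ _

end GrassmannPCS

/-! ### The conformally symplectic, Hermitian and standard Grassmannian properties -/

section GrassmannPCSProperties

variable {n : ℕ}

/-- Local sections of the `G₀`-structure are smooth local frames of `E` and `F`. -/
theorem isGrassmannian_grassmannPACS (hn : 0 < n) : (grassmannPACS hn).IsGrassmannian := by
  rintro _ ⟨x₀, hx₀, rfl⟩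
  obtain ⟨O, y, hO, hxO, hy, hyx, hyO⟩ := exists_local_section hx₀
  obtain ⟨O', C, hO', hxO', hC, hCO⟩ := exists_local_completion hn hx₀
  have hW : IsOpen (O ∩ y ⁻¹' O') := hy.continuousOn.isOpen_inter_preimage hO hO'
  have hyW : ContDiffOn ℝ ∞ y (orientedGrassmannian n ∩ (O ∩ y ⁻¹' O')) :=
    hy.mono fun J hJ => hJ.2.1
  have hCW : ContDiffOn ℝ ∞ (fun J => C (y J)) (orientedGrassmannian n ∩ (O ∩ y ⁻¹' O')) :=
    hC.comp hyW fun J hJ => hJ.2.2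
  have hp : ContDiffOn ℝ ∞ (fun J => (orientedSpan (y J), y J, C (y J)))
      (orientedGrassmannian n ∩ (O ∩ y ⁻¹' O')) :=
    (contDiff_orientedSpan.comp_contDiffOn hyW).prodMk (hyW.prodMk hCW)
  have hmem : ∀ J ∈ orientedGrassmannian n ∩ (O ∩ y ⁻¹' O'),
      (orientedSpan (y J), y J, C (y J)) ∈ (grassmannG0Structure n).total := by
    intro J hJ
    have h1 := (hyO J ⟨hJ.1, hJ.2.1⟩).1
    obtain ⟨c1, c2, c3⟩ := hCO _ ⟨h1, hJ.2.2⟩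
    have h := quotMap_mem (u := (y J, 1, C (y J))) ⟨h1, c1, c2, by simp, c3⟩
    rwa [quotMap, Matrix.mul_one] at h
  refine ⟨O ∩ y ⁻¹' O', fun J i k => y J k i, fun J j k => C (y J) k j,
    fun J X => (grassmannG0Structure n).frame (orientedSpan (y J), y J, C (y J)) X,
    fun J => (Matrix.fromCols (y J) (C (y J))).det, hW, ⟨hxO, ?_⟩, ?_, ?_, ?_, ?_, ?_⟩
  · change y (orientedSpan x₀) ∈ O'
    rwa [hyx]
  · exact contDiffOn_pi.2 fun i => contDiffOn_pi.2 fun k => ContDiffOn.matrix_entry hyW k i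
  · exact contDiffOn_pi.2 fun j => contDiffOn_pi.2 fun k => ContDiffOn.matrix_entry hCW k j
  · exact fun X => ((isG0Structure_grassmannG0Structure hn).frame_smooth X).comp hp hmem
  · exact contDiff_det_fromCols.comp_contDiffOn (hyW.prodMk hCW)
  · intro J hJ
    have hJ' : (J : Matrix (Idx n) (Idx n) ℝ) ∈ orientedGrassmannian n ∩ (O ∩ y ⁻¹' O') := ⟨J.2, hJ⟩
    obtain ⟨bE, bF, h1, h2, h3, h4, -, h6, h7⟩ := exists_adapted_bases hn (hmem J hJ') J
      (hyO J ⟨J.2, hJ.1⟩).2.symm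
    exact ⟨bE, bF, h1, h2, h3, h4, h6, h7, (hmem J hJ').1.2.2⟩

theorem mul_col {l m : Type} [Fintype m] (M : Matrix l m ℝ) (A : Matrix m m ℝ) (i : m) :
    (fun k => (M * A) k i) = ∑ j, A j i • fun k => M k j := by
  ext k
  rw [Finset.sum_apply, Matrix.mul_apply]
  exact Finset.sum_congr rfl fun j _ => mul_comm _ _

theorem hasG0Structure_grassmannPACS (hn : 0 < n) :
    (grassmannPACS hn).HasG0Structure (grassmannG0Structure n) := by
  refine ⟨isG0Structure_grassmannG0Structure hn, fun J => standardMetric (normalOf J),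
    fun p i k => p.2.1 k i, fun p j k => p.2.2 k j, inRay_standardMetric hn, ?_, ?_, ?_, ?_⟩
  · exact contDiffOn_pi.2 fun i => contDiffOn_pi.2 fun k =>
      ContDiffOn.matrix_entry (contDiff_fst.comp contDiff_snd).contDiffOn k i
  · exact contDiffOn_pi.2 fun j => contDiffOn_pi.2 fun k =>
      ContDiffOn.matrix_entry (contDiff_snd.comp contDiff_snd).contDiffOn k j
  · intro p _ a _
    exact ⟨mul_col p.2.1 a.1, mul_col p.2.2 a.2⟩
  · intro p hp J hJ
    obtain ⟨bE, bF, h1, h2, h3, h4, h5, h6, -⟩ := exists_adapted_bases hn hp J hJ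
    exact ⟨bE, bF, h1, h2, h3, h4, h5, h6⟩

theorem symplForm_nondegenerate {J : orientedGrassmannian n}
    {v : tangentSpaceAt (orientedGrassmannian n) (J : Matrix (Idx n) (Idx n) ℝ)}
    (h : ∀ w, restrictForm (orientedGrassmannian n) J (symplForm n J) ![v, w] = 0) : v = 0 :=
  Subtype.ext (eq_zero_of_symplForm_eq_zero J.2 v.2 fun w hw => h ⟨w, hw⟩)

theorem restrictForm_symplForm_ne_zero (hn : 0 < n) (J : orientedGrassmannian n) :
    restrictForm (orientedGrassmannian n) J (symplForm n J) ≠ 0 := by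
  intro h0
  let X : Matrix (Fin n) (Fin 2) ℝ := Matrix.of fun _ _ => 1
  have hX : X = 0 := by
    refine (Matrix.toLin (planeBasis hn J) (normalBasis hn J)).map_eq_zero_iff.1 ?_
    exact (grassmannIso hn J).map_eq_zero_iff.1 (symplForm_nondegenerate fun w => by rw [h0]; rfl)
  exact one_ne_zero (congrFun (congrFun hX ⟨0, hn⟩) 0)

theorem isLocalGenerator_symplForm (hn : 0 < n) :
    (grassmannPACS hn).IsLocalGenerator Set.univ (symplForm n) :=
  ⟨(linearTwoForm (traceCommutator n) traceCommutator_self).contDiff.contDiffOn,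
    fun J _ => ⟨restrictForm_symplForm_ne_zero hn J, rfl⟩⟩

theorem isCS_grassmannPACS (hn : 0 < n) : (grassmannPACS hn).IsCS where
  acs :=
    { line := fun _ _ => ⟨Set.univ, symplForm n, isOpen_univ, trivial, isLocalGenerator_symplForm hn⟩
      nondegenerate := by
        intro J β hβ hβ0 v hv
        obtain ⟨c, rfl⟩ := Submodule.mem_span_singleton.1 hβ
        have hc : c ≠ 0 := fun hc => hβ0 (by rw [hc, zero_smul])
        exact symplForm_nondegenerate fun w => (mul_eq_zero.1 (hv w)).resolve_left hc }
  closed _ _ := ⟨Set.univ, symplForm n, isOpen_univ, trivial, isLocalGenerator_symplForm hn,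
    fun _ hy _ hv => extDerivWithin_symplForm hy.1 hv⟩

theorem isHermitian_grassmannPACS (hn : 0 < n) : (grassmannPACS hn).IsHermitian := by
  intro J β hβ a b f g
  obtain ⟨ν, hν⟩ := (inRay_standardMetric hn J).decomposes β hβ
  have hsymm : standardMetric (normalOf J) g f = standardMetric (normalOf J) f g :=
    (inRay_standardMetric hn J).symm g f
  have hswap : ν ![b, a] = -ν ![a, b] := by
    -- `![b, a]` is `![a, b]` composed with a transposition
    have h := ν.map_swap ![a, b] (i := 0) (j := 1) (by decide)
    rw [← h]
    congr 1
    ext i : 1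
    fin_cases i <;> rfl
  have h1 := hν a b f g
  have h2 := hν b a f g
  have h3 := hν a b g f
  rw [hswap] at h2
  refine ⟨?_, ?_⟩
  · rw [h1, h2]
    exact (neg_eq_iff_eq_neg.2 (neg_mul _ _)).symm
  · rw [h1, h3]
    exact congrArg _ hsymm.symm

theorem isPCS_grassmannPACS (hn : 0 < n) : (grassmannPACS hn).IsPCS where
  submanifold := isSubmanifold_orientedGrassmannian hn
  grassmannian := isGrassmannian_grassmannPACS hn
  cs := isCS_grassmannPACS hn
  hermitian := isHermitian_grassmannPACS hn
  positive J := ⟨_, inRay_standardMetric hn J⟩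

theorem transpose_of_mem_orientedGrassmannian {J : Matrix (Idx n) (Idx n) ℝ}
    (hJ : J ∈ orientedGrassmannian n) : Jᵀ = -J := by
  obtain ⟨x, -, rfl⟩ := hJ
  rw [orientedSpan_eq, Matrix.transpose_mul, Matrix.transpose_mul, transpose_eps,
    Matrix.transpose_transpose, Matrix.neg_mul, Matrix.mul_neg, Matrix.mul_assoc]

/-- The matrix of the plane `J`, as a bilinear form, is the area form of the plane. -/
theorem dotProduct_mulVec_eq_det (hn : 0 < n) (J : orientedGrassmannian n) (b : Fin 2 → planeOf J) :
    (b 1 : Idx n → ℝ) ⬝ᵥ (J : Matrix (Idx n) (Idx n) ℝ) *ᵥ (b 0 : Idx n → ℝ) =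
      (planeBasis hn J).det b := by
  have hx : (adaptedFrame hn J).1ᵀ * (adaptedFrame hn J).1 = 1 := (adaptedFrame_mem hn J).1
  have h1 := colMat_eq_mul (planeBasis hn J) b
  rw [colMat_planeBasis] at h1
  have h2 : (colMat fun i => (b i : Idx n → ℝ))ᵀ * ((J : Matrix (Idx n) (Idx n) ℝ) *
      colMat fun i => (b i : Idx n → ℝ)) = (planeBasis hn J).det b • eps := by
    rw [h1, ← orientedSpan_adaptedFrame hn J, orientedSpan_eq, Module.Basis.det_apply,
      ← transpose_mul_eps_mul]
    generalize (planeBasis hn J).toMatrix b = A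
    generalize (adaptedFrame hn J).1 = x at hx
    calc _ = Aᵀ * ((xᵀ * x) * eps * (xᵀ * x)) * A := by
          rw [Matrix.transpose_mul]; simp only [Matrix.mul_assoc]
      _ = _ := by rw [hx, Matrix.one_mul, Matrix.mul_one]
  have h3 := congrFun (congrFun h2 1) 0
  refine Eq.trans ?_ (h3.trans ?_)
  · rfl
  · simp [eps]

theorem isStandardGrassmannian_grassmannPACS (hn : 0 < n) :
    IsStandardGrassmannian (grassmannPACS hn) where
  E_eq _ := rfl
  mem_F := by
    intro J w
    have hJ := transpose_of_mem_orientedGrassmannian J.2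
    have key : ∀ z : Idx n → ℝ, (J : Matrix (Idx n) (Idx n) ℝ) *ᵥ z ⬝ᵥ w =
        -(z ⬝ᵥ (J : Matrix (Idx n) (Idx n) ℝ) *ᵥ w) := by
      intro z
      rw [← Matrix.vecMul_transpose, hJ, ← Matrix.dotProduct_mulVec, Matrix.neg_mulVec, dotProduct_neg]
    change (J : Matrix (Idx n) (Idx n) ℝ) *ᵥ w = 0 ↔
      ∀ v ∈ LinearMap.range (J : Matrix (Idx n) (Idx n) ℝ).mulVecLin, v ⬝ᵥ w = 0
    constructor
    · rintro h _ ⟨z, rfl⟩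
      rw [Matrix.mulVecLin_apply, key, h, dotProduct_zero, neg_zero]
    · intro h
      rw [← dotProduct_self_eq_zero, ← neg_eq_zero, ← key]
      exact h _ ⟨_, rfl⟩
  iso_eq := by
    intro J φ v₁ v₂ hv
    let e : Fin 2 → planeOf J := ![v₁, v₂]
    have hx : orientedSpan (colMat fun i => (e i : Idx n → ℝ)) = (J : Matrix (Idx n) (Idx n) ℝ) := hv
    obtain ⟨h1, h2⟩ := spanDeriv_colMat hn J φ e
    have hdet : (planeBasis hn J).det e = 1 :=
      smul_orientedGrassmannian_injective J (h1.symm.trans (hx.trans (one_smul ℝ _).symm))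
    rw [hdet, one_smul] at h2
    obtain ⟨D, hD, hDw⟩ := hasFDerivAt_orientedSpan (colMat fun i => (e i : Idx n → ℝ))
    have hline : HasDerivAt (fun t : ℝ => (colMat fun i => (e i : Idx n → ℝ)) +
        t • colMat fun i => (φ (e i) : Idx n → ℝ)) (colMat fun i => (φ (e i) : Idx n → ℝ)) 0 := by
      have h := ((hasDerivAt_id (0 : ℝ)).smul_const
        (colMat fun i => (φ (e i) : Idx n → ℝ))).const_add (colMat fun i => (e i : Idx n → ℝ))
      rwa [one_smul] at h
    have hD' : HasFDerivAt orientedSpan D ((colMat fun i => (e i : Idx n → ℝ)) +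
        (0 : ℝ) • colMat fun i => (φ (e i) : Idx n → ℝ)) := by
      rwa [zero_smul, add_zero]
    have h := hD'.comp_hasDerivAt (0 : ℝ) hline
    exact ((hDw _).trans h2) ▸ h
  orE_eq := by
    intro J b
    refine (grassmannPACS_orE hn J b).trans (Iff.of_eq (congrArg (0 < ·) ?_))
    exact (dotProduct_mulVec_eq_det hn J b).symm
  vol_eq := by
    intro J e f
    refine (grassmannPACS_vol hn J e f).trans (congrArg Matrix.det ?_)
    ext i k
    cases k <;> rfl
  orF_eq := by
    intro J b c hb
    have hb' := (grassmannPACS_orE hn J b).1 hb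
    refine (grassmannPACS_orF hn J c).trans ?_
    exact (mul_pos_iff_of_pos_left hb').symm

end GrassmannPCSProperties

theorem mainTheorem5 (n : ℕ) (hn : 3 ≤ n)
    (Z : Matrix (Big n) (Big n) ℝ) (hZ : Z ∈ lieCenterKsharp n) (hZ0 : Z ≠ 0) :
    IsHomogeneousModel n ∧
    (homogeneousLieContact n).IsLieContact (stiefel n) ∧
    (homogeneousLieContact n).IsTransversalSymmetry (stiefel n) (actionGenerator Z) ∧
    ∃ (S : PACSData n (orientedGrassmannian n) (Idx n → ℝ) (Idx n → ℝ))
      (P : G0StructureData n (Matrix (Idx n) (Idx n) ℝ)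
        (Matrix (Idx n) (Idx n) ℝ × Matrix (Idx n) (Fin 2) ℝ × Matrix (Idx n) (Fin n) ℝ))
      (q₀ : Matrix (Idx n) (Fin 2) ℝ × Matrix (Fin 2) (Fin 2) ℝ × Matrix (Idx n) (Fin n) ℝ →
        Matrix (Idx n) (Idx n) ℝ × Matrix (Idx n) (Fin 2) ℝ × Matrix (Idx n) (Fin n) ℝ),
      S.IsPCS ∧ S.HasG0Structure P ∧ IsKInvariant P ∧
      IsPCSQuotient (homogeneousLieContact n) P (actionGenerator Z) orientedSpan q₀ ∧
      IsStandardGrassmannian S ∧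
      ∀ J, S.InRay J (standardMetric (S.F J)) := by
  have hn' : 0 < n := by lia
  obtain ⟨c, hc, rfl⟩ := exists_eq_of_mem_lieCenterKsharp hn' hZ hZ0
  have hξ : actionGenerator (Matrix.fromBlocks (c • eps) 0 0 0 : Matrix (Big n) (Big n) ℝ) =
      fun x => -(c • (x * eps)) := funext (actionGenerator_eq c)
  rw [hξ]
  exact ⟨isHomogeneousModel hn', isLieContact_homogeneousLieContact hn', isTransversalSymmetry hc,
    grassmannPACS hn', grassmannG0Structure n, quotMap, isPCS_grassmannPACS hn',
    hasG0Structure_grassmannPACS hn', isKInvariant_grassmannG0Structure hn', isPCSQuotient_quotMap hc,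
    isStandardGrassmannian_grassmannPACS hn', inRay_standardMetric hn'⟩
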